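/- Let $m\ge 1$ and let $\Omega\subset\mathbb{R}^m$ be a non-empty bounded open set (not necessarily connected) with boundary $\Gamma=\partial\Omega$. Let $ds$ be the surface measure, i.e. the normalised $(m-1)$-dimensional Hausdorff measure, and suppose that $\Omega$ lies on one side of $\Gamma$ up to a null set: the points of $\Gamma$ that are interior to $\overline\Omega$ form a set of zero surface measure (so that functions in $H^1(\Omega)$ have single-valued traces on $\Gamma$). For an open set $U\subset\mathbb{R}^m$ and $\gamma>0$ put $$\Lambda(U;\gamma)=\inf_{v\in H^1(U),\,v\not\equiv0}\frac{\int_U|\nabla v|^2\,dx-\gamma\int_{\partial U}|v|^2\,ds}{\int_U|v|^2\,dx}\in[-\infty,\infty),$$ where the values of $v$ on $\partial U$ are the boundary trace, i.e. the extension by continuity of the restriction map from functions in $C_c^\infty(\mathbb{R}^m)$. A cone is a set $\{x\in\mathbb{R}^m\setminus\{0\}: x/|x|\in M\}$ with $M\subset S^{m-1}$. Suppose that $\Omega$ is piecewise smooth in the following sense: for each $y\in\Gamma$ there is a cone $K_y$ such that, for some $r>0$, there is a $C^\infty$ diffeomorphism $f_y$ from an open neighbourhood of $B(0,r)$ onto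 an open subset of $\mathbb{R}^m$ with $$f_y(K_y\cap B(0,r))=\Omega\cap B(y,r),\qquad f_y(0)=y,\qquad Df_y(0)=I.$$ Suppose also that the uniform interior cone condition holds: there is a fixed cone $K$ with non-empty interior such that each $K_y$, $y\in\Gamma$, contains the image of $K$ under some isometry of $\mathbb{R}^m$. Put $C_y=-\Lambda(K_y;1)$. Then $\Lambda(\Omega;\gamma)$ is finite for every $\gamma>0$, $\sup_{y\in\Gamma}C_y$ is finite, and $$\Lambda(\Omega;\gamma)=-\gamma^2\sup_{y\in\Gamma}C_y+o(\gamma^2),\qquad\gamma\to+\infty.$$ -/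

import Mathlib

open MeasureTheory Set Filter
open scoped Topology ContDiff

noncomputable section

namespace RobinCone

/-- `G` is the weak (distributional) gradient of `v` in the open set `Ω ⊆ ℝᵐ`:
`∫_Ω v ∇φ = - ∫_Ω φ G` for every test function `φ ∈ C_c^∞(Ω)`. -/
def IsWeakGradient {m : ℕ} (Ω : Set (EuclideanSpace ℝ (Fin m)))
    (v : EuclideanSpace ℝ (Fin m) → ℝ)
    (G : EuclideanSpace ℝ (Fin m) → EuclideanSpace ℝ (Fin m)) : Prop :=
  ∀ φ : EuclideanSpace ℝ (Fin m) → ℝ, ContDiff ℝ ∞ φ → HasCompactSupport φ → tsupport φ ⊆ Ω →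
    ∫ x in Ω, v x • gradient φ x = - ∫ x in Ω, φ x • G x

/-- `v` belongs to the Sobolev space `H¹(Ω)` and `G` is its weak gradient. -/
structure MemH1 {m : ℕ} (Ω : Set (EuclideanSpace ℝ (Fin m)))
    (v : EuclideanSpace ℝ (Fin m) → ℝ)
    (G : EuclideanSpace ℝ (Fin m) → EuclideanSpace ℝ (Fin m)) : Prop where
  memLp : MemLp v 2 (volume.restrict Ω)
  memLp_grad : MemLp G 2 (volume.restrict Ω)
  isWeakGradient : IsWeakGradient Ω v G

/-- The surface measure `ds` on the boundary `Γ = ∂Ω` of `Ω ⊆ ℝᵐ`, `m ≥ 1`: the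
`(m-1)`-dimensional Hausdorff measure, normalised so as to agree with Lebesgue measure on
`(m-1)`-dimensional affine subspaces, restricted to `Γ`. -/
def surfaceMeasure {m : ℕ} (Ω : Set (EuclideanSpace ℝ (Fin m))) :
    Measure (EuclideanSpace ℝ (Fin m)) :=
  (Measure.euclideanHausdorffMeasure (m - 1)).restrict (frontier Ω)

/-- `g ∈ L²(Γ)` is the boundary trace of `v ∈ H¹(Ω)` (with weak gradient `G`): the trace map is the
extension by continuity of the restriction map `φ ↦ φ|_Γ` on functions smooth up to the boundary.
That is, there are `φₙ ∈ C_c^∞(ℝᵐ)` with `φₙ → v` in `H¹(Ω)` and `φₙ|_Γ → g` in `L²(Γ)`. -/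
structure IsTrace {m : ℕ} (Ω : Set (EuclideanSpace ℝ (Fin m)))
    (v : EuclideanSpace ℝ (Fin m) → ℝ)
    (G : EuclideanSpace ℝ (Fin m) → EuclideanSpace ℝ (Fin m))
    (g : EuclideanSpace ℝ (Fin m) → ℝ) : Prop where
  memLp : MemLp g 2 (surfaceMeasure Ω)
  exists_approx : ∃ φ : ℕ → EuclideanSpace ℝ (Fin m) → ℝ,
    (∀ n, ContDiff ℝ ∞ (φ n) ∧ HasCompactSupport (φ n)) ∧
    Tendsto (fun n => eLpNorm (fun x => φ n x - v x) 2 (volume.restrict Ω)) atTop (𝓝 0) ∧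
    Tendsto (fun n => eLpNorm (fun x => gradient (φ n) x - G x) 2 (volume.restrict Ω))
      atTop (𝓝 0) ∧
    Tendsto (fun n => eLpNorm (fun x => φ n x - g x) 2 (surfaceMeasure Ω)) atTop (𝓝 0)

/-- The Rayleigh quotient `(∫_Ω |∇v|² dx - γ ∫_Γ |v|² ds) / ∫_Ω |v|² dx`, where `G = ∇v` and `g` is
the boundary trace of `v`. -/
def rayleigh {m : ℕ} (Ω : Set (EuclideanSpace ℝ (Fin m))) (γ : ℝ)
    (v : EuclideanSpace ℝ (Fin m) → ℝ)
    (G : EuclideanSpace ℝ (Fin m) → EuclideanSpace ℝ (Fin m))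
    (g : EuclideanSpace ℝ (Fin m) → ℝ) : ℝ :=
  ((∫ x in Ω, ‖G x‖ ^ 2) - γ * ∫ x, g x ^ 2 ∂(surfaceMeasure Ω)) / ∫ x in Ω, v x ^ 2

/-- The bottom of the Robin spectrum `Λ(Ω; γ) ∈ [-∞, ∞]`: the infimum of the Rayleigh quotient over
all `v ∈ H¹(Ω)`, `v ≢ 0`. -/
def bottom {m : ℕ} (Ω : Set (EuclideanSpace ℝ (Fin m))) (γ : ℝ) : EReal :=
  sInf {q : EReal | ∃ (v : EuclideanSpace ℝ (Fin m) → ℝ)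
      (G : EuclideanSpace ℝ (Fin m) → EuclideanSpace ℝ (Fin m))
      (g : EuclideanSpace ℝ (Fin m) → ℝ),
    MemH1 Ω v G ∧ IsTrace Ω v G g ∧ ¬ (v =ᵐ[volume.restrict Ω] 0) ∧
      q = ((rayleigh Ω γ v G g : ℝ) : EReal)}

/-- `K = {x : x / |x| ∈ M}` is the infinite cone over some cross-section `M ⊆ S^{m-1}`.
(The vertex is not in `K`, since `0 / |0|` is `0` here, which is not on the sphere.) -/
def IsCone {m : ℕ} (K : Set (EuclideanSpace ℝ (Fin m))) : Prop :=
  ∃ M ⊆ Metric.sphere (0 : EuclideanSpace ℝ (Fin m)) 1, K = {x | ‖x‖⁻¹ • x ∈ M}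

/-- `Ω ∼ K` near `y`: `K` is an infinite cone, and for some `r > 0` there is a smooth diffeomorphism
`f` between neighbourhoods of `B(0,r)` and of `y` which maps `K ∩ B(0,r)` onto `Ω ∩ B(y,r)`, with
`f 0 = y` and with the identity as its derivative at `0`. -/
def IsModelCone {m : ℕ} (Ω : Set (EuclideanSpace ℝ (Fin m))) (y : EuclideanSpace ℝ (Fin m))
    (K : Set (EuclideanSpace ℝ (Fin m))) : Prop :=
  IsCone K ∧ ∃ r > 0,
    ∃ f : OpenPartialHomeomorph (EuclideanSpace ℝ (Fin m)) (EuclideanSpace ℝ (Fin m)),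
      Metric.ball 0 r ⊆ f.source ∧
      ContDiffOn ℝ ∞ f f.source ∧ ContDiffOn ℝ ∞ f.symm f.target ∧
      f '' (K ∩ Metric.ball 0 r) = Ω ∩ Metric.ball y r ∧
      f 0 = y ∧
      HasFDerivAt f (ContinuousLinearMap.id ℝ (EuclideanSpace ℝ (Fin m))) 0

/-- The uniform interior cone condition for a family of model cones `K y`, `y ∈ Γ = ∂Ω`: there is a
fixed cone `K₀` with non-empty interior such that each `K y` contains a cone congruent to `K₀`. -/
def UniformInteriorCone {m : ℕ} (Ω : Set (EuclideanSpace ℝ (Fin m)))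
    (K : EuclideanSpace ℝ (Fin m) → Set (EuclideanSpace ℝ (Fin m))) : Prop :=
  ∃ K₀ : Set (EuclideanSpace ℝ (Fin m)), IsCone K₀ ∧ (interior K₀).Nonempty ∧
    ∀ y ∈ frontier Ω, ∃ τ : EuclideanSpace ℝ (Fin m) ≃ᵢ EuclideanSpace ℝ (Fin m), τ '' K₀ ⊆ K y

/-- The constant `C = -Λ(K; 1)` of a cone `K`. -/
def coneConst {m : ℕ} (K : Set (EuclideanSpace ℝ (Fin m))) : EReal := - bottom K 1

end RobinCone

end

noncomputable section

namespace RobinCone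

open scoped NNReal ENNReal

variable {m : ℕ}

set_option hygiene false in
local notation "𝔼" => EuclideanSpace ℝ (Fin m)

/-! Lower bounds for the bottom of the spectrum are inequalities `γ ∫_∂U φ² ≤ ∫_U |∇φ|² + β ∫_U φ²`
for test functions (`FormBound`): a trace is by definition a limit of restrictions, so such an
inequality passes to all of H¹, and conversely test functions are admissible. On a cone the
inequality scales, so the constant β at γ = 1 becomes γ²β at γ. Near a boundary point the domain is
the image of its model cone under a diffeomorphism with derivative the identity, hence bi-Lipschitz
with constants near 1 on a small ball, and all three integrals change by factors near 1.

Upper bound: a test function on K_y that beats a constant c < C_y, concentrated at scale 1/γ and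
transplanted to y, beats γ²c on Ω for large γ (`IsModelCone.eventually_bottom_lt`). Lower bound: by
compactness of the boundary the cone inequalities hold on balls of one radius with a small loss,
uniformly in γ; averaging over all translates of a cutoff glues them at the cost of a multiple of ∫
φ² independent of γ, hence o(γ²) (`exists_formBound_domain`).

Finiteness rests on a trace inequality `∫_∂Ω |u| ≤ B ∫_Ω (|∇u| + |u|)`. Applied to u = φ² it gives a
form bound with constant γ²B² + γB; comparison with the upper bound then bounds every C_y.

The trace inequality comes from the model cones, by induction on the codimension of the lineality
space L of the cone (`exists_trace_inequality_modelCone`). Near a boundary point off L the cone is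
diffeomorphic to another model cone, whose lineality space is strictly larger because the radial
direction has been added (`LocalDiffeo.finrank_lineality_lt`). Translations along L and dilations
reduce these local inequalities to a compact set. Summing over Whitney balls with respect to the
distance to L leaves an error ∫ |u|/dist(x,L), which Hardy's inequality absorbs when L has
codimension at least two (`exists_hardy`). In codimension one the boundary lies in the hyperplane L,
and integration along normals suffices. -/

/-! ### Transport of volume and surface integrals by bi-Lipschitz maps -/

theorem euclideanHausdorffMeasure_image_le {X Y : Type*} [EMetricSpace X] [MeasurableSpace X]
    [BorelSpace X] [EMetricSpace Y] [MeasurableSpace Y] [BorelSpace Y] {f : X → Y} {s : Set X}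
    {L : ℝ≥0} (h : LipschitzOnWith L f s) (d : ℕ) :
    μHE[d] (f '' s) ≤ (L : ℝ≥0∞) ^ d * μHE[d] s := by
  simp_rw [Measure.euclideanHausdorffMeasure_def, Measure.smul_apply, ENNReal.smul_def, smul_eq_mul]
  rw [mul_left_comm]
  gcongr
  simpa using h.hausdorffMeasure_image_le (d := d) (by positivity)

theorem euclideanHausdorffMeasure_eq_volume : (μHE[m] : Measure 𝔼) = volume :=
  EuclideanSpace.euclideanHausdorffMeasure_eq_volume m

/-- `g` is a smooth bi-Lipschitz diffeomorphism of the open set `W` onto its image (with constants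
`L₁` for `g` and `L₂` for its inverse) under which `U` corresponds to `V`. -/
structure BiLipOn (g : OpenPartialHomeomorph 𝔼 𝔼) (W : Set 𝔼) (L₁ L₂ : ℝ≥0) (U V : Set 𝔼) :
    Prop where
  isOpen : IsOpen W
  subset : W ⊆ g.source
  smooth : ContDiffOn ℝ ∞ g W
  smooth_symm : ContDiffOn ℝ ∞ g.symm (g '' W)
  lip : LipschitzOnWith L₁ g W
  lip_symm : LipschitzOnWith L₂ g.symm (g '' W)
  mem_iff : ∀ x ∈ W, x ∈ U ↔ g x ∈ V

namespace BiLipOn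

variable {g : OpenPartialHomeomorph 𝔼 𝔼} {W : Set 𝔼} {L₁ L₂ : ℝ≥0} {U V : Set 𝔼}

theorem left_inv (h : BiLipOn g W L₁ L₂ U V) {x : 𝔼} (hx : x ∈ W) : g.symm (g x) = x :=
  g.left_inv (h.subset hx)

theorem symm_image (h : BiLipOn g W L₁ L₂ U V) : g.symm '' (g '' W) = W := by
  ext x
  constructor
  · rintro ⟨_, ⟨y, hy, rfl⟩, rfl⟩
    rwa [h.left_inv hy]
  · intro hx
    exact ⟨_, ⟨x, hx, rfl⟩, h.left_inv hx⟩

theorem isOpen_image (h : BiLipOn g W L₁ L₂ U V) : IsOpen (g '' W) :=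
  g.isOpen_image_of_subset_source h.isOpen h.subset

theorem symm (h : BiLipOn g W L₁ L₂ U V) : BiLipOn g.symm (g '' W) L₂ L₁ V U where
  isOpen := h.isOpen_image
  subset := by
    rintro _ ⟨x, hx, rfl⟩
    exact g.map_source (h.subset hx)
  smooth := h.smooth_symm
  smooth_symm := by simpa [h.symm_image] using h.smooth
  lip := h.lip_symm
  lip_symm := by simpa [h.symm_image] using h.lip
  mem_iff := by
    rintro _ ⟨x, hx, rfl⟩
    rw [h.left_inv hx, h.mem_iff x hx]

theorem mono (h : BiLipOn g W L₁ L₂ U V) {W' : Set 𝔼} (hW' : IsOpen W') (hs : W' ⊆ W) :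
    BiLipOn g W' L₁ L₂ U V where
  isOpen := hW'
  subset := hs.trans h.subset
  smooth := h.smooth.mono hs
  smooth_symm := h.smooth_symm.mono (image_mono hs)
  lip := h.lip.mono hs
  lip_symm := h.lip_symm.mono (image_mono hs)
  mem_iff x hx := h.mem_iff x (hs hx)

theorem mem_closure (h : BiLipOn g W L₁ L₂ U V) {x : 𝔼} (hx : x ∈ W) (hxU : x ∈ closure U) :
    g x ∈ closure V := by
  have h1 : x ∈ closure (U ∩ W) := by
    rw [mem_closure_iff_nhdsWithin_neBot] at hxU ⊢
    rwa [nhdsWithin_inter_of_mem' (mem_nhdsWithin_of_mem_nhds (h.isOpen.mem_nhds hx))]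
  have hc : ContinuousAt g x := g.continuousAt (h.subset hx)
  have h2 := mem_closure_image hc h1
  refine closure_mono ?_ h2
  rintro _ ⟨z, hz, rfl⟩
  exact (h.mem_iff z hz.2).1 hz.1

theorem compl (h : BiLipOn g W L₁ L₂ U V) : BiLipOn g W L₁ L₂ Uᶜ Vᶜ :=
  { h with mem_iff := fun x hx => not_congr (h.mem_iff x hx) }

theorem mem_frontier (h : BiLipOn g W L₁ L₂ U V) {x : 𝔼} (hx : x ∈ W) (hxU : x ∈ frontier U) :
    g x ∈ frontier V := by
  rw [frontier_eq_closure_inter_closure] at hxU ⊢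
  exact ⟨h.mem_closure hx hxU.1, h.compl.mem_closure hx hxU.2⟩

theorem frontier_iff (h : BiLipOn g W L₁ L₂ U V) {x : 𝔼} (hx : x ∈ W) :
    x ∈ frontier U ↔ g x ∈ frontier V := by
  refine ⟨h.mem_frontier hx, fun hg => ?_⟩
  simpa [h.left_inv hx] using h.symm.mem_frontier (mem_image_of_mem g hx) hg

theorem measure_image_le (h : BiLipOn g W L₁ L₂ U V) (d : ℕ) {S : Set 𝔼} (hS : S ⊆ W) :
    μHE[d] (g '' S) ≤ (L₁ : ℝ≥0∞) ^ d * μHE[d] S :=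
  euclideanHausdorffMeasure_image_le (h.lip.mono hS) d

/-- A Lipschitz map enlarges d-dimensional Hausdorff measure by at most L₁^d, so the measure on T ∩
g(W) is dominated by L₁^d times a push-forward. This replaces any Jacobian formula: d = m gives
volume, d = m - 1 gives surface, and `symm` gives the reverse estimates. -/
theorem lintegral_le (h : BiLipOn g W L₁ L₂ U V) (d : ℕ) {S T : Set 𝔼} (hS : MeasurableSet S)
    (hST : ∀ x ∈ W, x ∈ S ↔ g x ∈ T) {F : 𝔼 → ℝ≥0∞} (hF : Measurable F) {G : 𝔼 → ℝ≥0∞}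
    (hFs : ∀ y, y ∉ g '' W → F y = 0) (hG : ∀ x ∈ W, F (g x) ≤ G x) :
    ∫⁻ y in T, F y ∂μHE[d] ≤ (L₁ : ℝ≥0∞) ^ d * ∫⁻ x in S, G x ∂μHE[d] := by
  have hWm := h.isOpen.measurableSet
  have hgm : AEMeasurable g ((μHE[d] : Measure 𝔼).restrict (S ∩ W)) :=
    ((g.continuousOn.mono h.subset).aemeasurable hWm).mono_measure
      (Measure.restrict_mono inter_subset_right le_rfl)
  have hle : (μHE[d] : Measure 𝔼).restrict (T ∩ g '' W) ≤
      ((L₁ : ℝ≥0∞) ^ d) • (((μHE[d] : Measure 𝔼).restrict (S ∩ W)).map g) := by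
    refine Measure.le_iff.2 fun B hB => ?_
    rw [Measure.restrict_apply hB, Measure.smul_apply, Measure.map_apply_of_aemeasurable hgm hB,
      smul_eq_mul]
    have e : B ∩ (T ∩ g '' W) = g '' (g ⁻¹' B ∩ (S ∩ W)) := by
      ext y
      constructor
      · rintro ⟨hy, hyT, x, hx, rfl⟩
        exact ⟨x, ⟨hy, (hST x hx).2 hyT, hx⟩, rfl⟩
      · rintro ⟨x, ⟨hxB, hxS, hx⟩, rfl⟩
        exact ⟨hxB, (hST x hx).1 hxS, x, hx, rfl⟩
    rw [e]
    refine (h.measure_image_le d (fun x hx => hx.2.2)).trans ?_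
    exact mul_le_mul_right (Measure.le_restrict_apply _ _) _
  calc ∫⁻ y in T, F y ∂μHE[d] = ∫⁻ y in T ∩ g '' W, F y ∂μHE[d] := by
        symm
        rw [inter_comm, ← Measure.restrict_restrict h.isOpen_image.measurableSet]
        refine setLIntegral_eq_of_support_subset fun y hy => ?_
        by_contra hh
        exact hy (hFs y hh)
    _ ≤ ∫⁻ y, F y ∂(((L₁ : ℝ≥0∞) ^ d) • (((μHE[d] : Measure 𝔼).restrict (S ∩ W)).map g)) :=
        lintegral_mono' hle le_rfl
    _ = (L₁ : ℝ≥0∞) ^ d * ∫⁻ x in S ∩ W, F (g x) ∂μHE[d] := by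
        rw [lintegral_smul_measure, lintegral_map' hF.aemeasurable hgm, smul_eq_mul]
    _ ≤ (L₁ : ℝ≥0∞) ^ d * ∫⁻ x in S, G x ∂μHE[d] := by
        gcongr 1
        calc ∫⁻ x in S ∩ W, F (g x) ∂μHE[d] ≤ ∫⁻ x in S ∩ W, G x ∂μHE[d] :=
              setLIntegral_mono' (hS.inter hWm) fun x hx => hG x hx.2
          _ ≤ _ := lintegral_mono_set inter_subset_left

variable {u v : 𝔼 → ℝ}

theorem eq_comp_symm (h : BiLipOn g W L₁ L₂ U V) (huv : ∀ x ∈ W, v x = u (g x)) {y : 𝔼}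
    (hy : y ∈ g '' W) : u y = v (g.symm y) := by
  obtain ⟨x, hx, rfl⟩ := hy
  rw [h.left_inv hx, huv x hx]

theorem lintegral_pow_le (h : BiLipOn g W L₁ L₂ U V) (hU : IsOpen U)
    (hu : Continuous u) (hus : tsupport u ⊆ g '' W) (huv : ∀ x ∈ W, v x = u (g x)) {p : ℕ}
    (hp : p ≠ 0) :
    ∫⁻ y in V, ‖u y‖ₑ ^ p ≤ (L₁ : ℝ≥0∞) ^ m * ∫⁻ x in U, ‖v x‖ₑ ^ p := by
  rw [← euclideanHausdorffMeasure_eq_volume]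
  refine h.lintegral_le m hU.measurableSet h.mem_iff (by fun_prop)
    (fun y hy => ?_) (fun x hx => ?_)
  · rw [image_eq_zero_of_notMem_tsupport fun hh => hy (hus hh)]
    simp [hp]
  · rw [huv x hx]

theorem lintegral_surface_pow_le (h : BiLipOn g W L₁ L₂ U V)
    (hu : Continuous u) (hus : tsupport u ⊆ g '' W) (huv : ∀ x ∈ W, v x = u (g x)) {p : ℕ}
    (hp : p ≠ 0) :
    ∫⁻ y, ‖u y‖ₑ ^ p ∂surfaceMeasure V ≤
      (L₁ : ℝ≥0∞) ^ (m - 1) * ∫⁻ x, ‖v x‖ₑ ^ p ∂surfaceMeasure U := by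
  refine h.lintegral_le (m - 1) measurableSet_frontier
    (fun x hx => h.frontier_iff hx) (by fun_prop) (fun y hy => ?_) (fun x hx => ?_)
  · rw [image_eq_zero_of_notMem_tsupport fun hh => hy (hus hh)]
    simp [hp]
  · rw [huv x hx]

/-- Near g x one has u = v ∘ g⁻¹, and the Lipschitz constant of g⁻¹ bounds the norm of its
derivative. -/
theorem enorm_fderiv_le (h : BiLipOn g W L₁ L₂ U V) (hv : Differentiable ℝ v)
    (huv : ∀ x ∈ W, v x = u (g x)) {x : 𝔼} (hx : x ∈ W) :
    ‖fderiv ℝ u (g x)‖ₑ ≤ L₂ * ‖fderiv ℝ v x‖ₑ := by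
  have hgx : g x ∈ g '' W := mem_image_of_mem g hx
  have hO := h.isOpen_image.mem_nhds hgx
  have he : u =ᶠ[𝓝 (g x)] v ∘ g.symm := by
    filter_upwards [hO] with y hy using h.eq_comp_symm huv hy
  have hd : DifferentiableAt ℝ g.symm (g x) :=
    (h.smooth_symm.contDiffAt hO).differentiableAt (by simp)
  rw [he.fderiv_eq, fderiv_comp _ (hv _) hd, h.left_inv hx]
  have h2 : ‖fderiv ℝ g.symm (g x)‖ ≤ L₂ := norm_fderiv_le_of_lipschitzOn ℝ hO h.lip_symm
  calc _ ≤ ‖fderiv ℝ v x‖ₑ * ‖fderiv ℝ g.symm (g x)‖ₑ := by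
        have := ContinuousLinearMap.opNorm_comp_le (fderiv ℝ v x) (fderiv ℝ g.symm (g x))
        simp_rw [← ofReal_norm]
        rw [← ENNReal.ofReal_mul (norm_nonneg _)]
        exact ENNReal.ofReal_le_ofReal this
    _ ≤ _ := by
        rw [mul_comm]
        gcongr
        rw [← ofReal_norm, ← ENNReal.ofReal_coe_nnreal]
        exact ENNReal.ofReal_le_ofReal h2

theorem lintegral_fderiv_pow_le (h : BiLipOn g W L₁ L₂ U V) (hU : IsOpen U)
    (hu : ContDiff ℝ 1 u) (hv : ContDiff ℝ 1 v) (hus : tsupport u ⊆ g '' W)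
    (huv : ∀ x ∈ W, v x = u (g x)) {p : ℕ} (hp : p ≠ 0) :
    ∫⁻ y in V, ‖fderiv ℝ u y‖ₑ ^ p ≤
      (L₁ : ℝ≥0∞) ^ m * (L₂ : ℝ≥0∞) ^ p * ∫⁻ x in U, ‖fderiv ℝ v x‖ₑ ^ p := by
  rw [← euclideanHausdorffMeasure_eq_volume]
  have hdu : Continuous (fderiv ℝ u) := hu.continuous_fderiv one_ne_zero
  have hdv : Continuous (fderiv ℝ v) := hv.continuous_fderiv one_ne_zero
  refine (h.lintegral_le (G := fun x => (L₂ : ℝ≥0∞) ^ p * ‖fderiv ℝ v x‖ₑ ^ p) m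
    hU.measurableSet h.mem_iff
    (F := fun y => ‖fderiv ℝ u y‖ₑ ^ p) (by fun_prop) (fun y hy => ?_) (fun x hx => ?_)).trans ?_
  · have : fderiv ℝ u y = 0 :=
      image_eq_zero_of_notMem_tsupport fun hh => hy (hus (tsupport_fderiv_subset ℝ hh))
    rw [← ofReal_norm, this, norm_zero, ENNReal.ofReal_zero, zero_pow hp]
  · rw [← mul_pow]
    gcongr
    exact h.enorm_fderiv_le (hv.differentiable one_ne_zero) huv hx
  · rw [lintegral_const_mul _ (by fun_prop), mul_assoc]

/-- The pull-back of a function supported in `g '' W`. -/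
theorem exists_pullback (h : BiLipOn g W L₁ L₂ U V) {n : ℕ∞} (hu : ContDiff ℝ n u)
    (huc : HasCompactSupport u) (hus : tsupport u ⊆ g '' W) :
    ∃ v : 𝔼 → ℝ, ContDiff ℝ n v ∧ HasCompactSupport v ∧ tsupport v ⊆ W ∧
      (∀ x ∈ W, v x = u (g x)) := by
  classical
  set v : 𝔼 → ℝ := W.indicator (u ∘ g) with hv
  have hvW : ∀ x ∈ W, v x = u (g x) := fun x hx => indicator_of_mem hx _
  set S : Set 𝔼 := g.symm '' tsupport u with hS
  have hSc : IsCompact S := huc.isCompact.image_of_continuousOn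
    (h.lip_symm.continuousOn.mono hus)
  have hSW : S ⊆ W := by
    rintro _ ⟨y, hy, rfl⟩
    obtain ⟨x, hx, rfl⟩ := hus hy
    rwa [h.left_inv hx]
  have hsup : Function.support v ⊆ S := by
    intro x hx
    have hxW : x ∈ W := by
      by_contra hh
      exact hx (indicator_of_notMem hh _)
    refine ⟨g x, subset_tsupport _ ?_, h.left_inv hxW⟩
    rwa [Function.mem_support, ← hvW x hxW]
  have hts : tsupport v ⊆ S := closure_minimal hsup hSc.isClosed
  refine ⟨v, ?_, hSc.of_isClosed_subset (isClosed_tsupport v) hts, hts.trans hSW, hvW⟩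
  rw [contDiff_iff_contDiffAt]
  intro x
  by_cases hx : x ∈ W
  · have he : v =ᶠ[𝓝 x] u ∘ g := by
      filter_upwards [h.isOpen.mem_nhds hx] with z hz using hvW z hz
    refine ContDiffAt.congr_of_eventuallyEq ?_ he
    refine hu.contDiffAt.comp x ?_
    exact (h.smooth.contDiffAt (h.isOpen.mem_nhds hx)).of_le (by exact_mod_cast le_top)
  · have hx' : x ∉ tsupport v := fun hh => hx (hSW (hts hh))
    have he : v =ᶠ[𝓝 x] fun _ => 0 := notMem_tsupport_iff_eventuallyEq.1 hx'
    exact contDiffAt_const.congr_of_eventuallyEq he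

end BiLipOn

/-! ### Local trace inequalities and their invariance under diffeomorphisms -/

/-- A trace inequality in `W^{1,1}` for functions supported in the ball `B(z,ρ)`. -/
def TraceBound (U : Set 𝔼) (z : 𝔼) (ρ : ℝ) (A : ℝ≥0) : Prop :=
  ∀ u : 𝔼 → ℝ, ContDiff ℝ 1 u → HasCompactSupport u → tsupport u ⊆ Metric.ball z ρ →
    ∫⁻ x, ‖u x‖ₑ ∂surfaceMeasure U ≤ A * ∫⁻ x in U, ‖fderiv ℝ u x‖ₑ

/-- The trace inequality holds near the point `z`. -/
def HasTraceBoundAt (U : Set 𝔼) (z : 𝔼) : Prop := ∃ ρ > 0, ∃ A, TraceBound U z ρ A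

namespace TraceBound

variable {U V : Set 𝔼} {z z' : 𝔼} {ρ ρ' : ℝ} {A A' : ℝ≥0}

theorem mono (h : TraceBound U z ρ A) (hs : Metric.ball z' ρ' ⊆ Metric.ball z ρ) (hA : A ≤ A') :
    TraceBound U z' ρ' A' := by
  intro u hu huc hus
  refine (h u hu huc (hus.trans hs)).trans ?_
  gcongr

/-- The factor L₁^(m-1) comes from the surface integral, L₁ from the gradient of the pull-back, and
L₂^m from the volume integral taken back to V. -/
theorem of_biLipOn {g : OpenPartialHomeomorph 𝔼 𝔼} {W : Set 𝔼} {L₁ L₂ : ℝ≥0}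
    (h : TraceBound U z ρ A) (hg : BiLipOn g W L₁ L₂ U V) (hV : IsOpen V)
    (hs : Metric.ball z' ρ' ⊆ g '' (W ∩ Metric.ball z ρ)) :
    TraceBound V z' ρ' (L₁ ^ (m - 1) * L₁ * L₂ ^ m * A) := by
  intro u hu huc hus
  have hg' := hg.mono (hg.isOpen.inter Metric.isOpen_ball)
    (inter_subset_left : W ∩ Metric.ball z ρ ⊆ W)
  obtain ⟨v, hv, hvc, hvs, huv⟩ := hg'.exists_pullback (n := 1) hu huc (hus.trans hs)
  have h1 := hg'.lintegral_surface_pow_le hu.continuous (hus.trans hs) huv one_ne_zero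
  have h2 := h v hv hvc (hvs.trans inter_subset_right)
  have h3 := hg'.symm.lintegral_fderiv_pow_le hV hv hu
    (by rw [hg'.symm_image]; exact hvs) (fun y hy => hg'.eq_comp_symm huv hy) one_ne_zero
  simp only [pow_one] at h1 h3
  calc ∫⁻ x, ‖u x‖ₑ ∂surfaceMeasure V
      ≤ (L₁ : ℝ≥0∞) ^ (m - 1) * (A * ((L₂ : ℝ≥0∞) ^ m * L₁ * ∫⁻ x in V, ‖fderiv ℝ u x‖ₑ)) :=
        h1.trans (by gcongr; exact h2.trans (by gcongr))
    _ = _ := by push_cast; ring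

end TraceBound

/-- A smooth diffeomorphism near `a`, under which `U` near `a` corresponds to `V` near `g a`. -/
structure LocalDiffeo (g : OpenPartialHomeomorph 𝔼 𝔼) (a : 𝔼) (U V : Set 𝔼) : Prop where
  mem_source : a ∈ g.source
  smooth : ContDiffOn ℝ ∞ g g.source
  smooth_symm : ContDiffOn ℝ ∞ g.symm g.target
  mem_iff : ∀ᶠ x in 𝓝 a, x ∈ U ↔ g x ∈ V

namespace LocalDiffeo

variable {g : OpenPartialHomeomorph 𝔼 𝔼} {a : 𝔼} {U V V' : Set 𝔼}

theorem symm (h : LocalDiffeo g a U V) : LocalDiffeo g.symm (g a) V U where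
  mem_source := g.map_source h.mem_source
  smooth := h.smooth_symm
  smooth_symm := h.smooth
  mem_iff := by
    have hc : Tendsto g.symm (𝓝 (g a)) (𝓝 a) := g.tendsto_symm h.mem_source
    filter_upwards [hc.eventually h.mem_iff,
      g.open_target.mem_nhds (g.map_source h.mem_source)] with y hy hyt
    rw [hy, g.right_inv hyt]

theorem trans {g' : OpenPartialHomeomorph 𝔼 𝔼} (h : LocalDiffeo g a U V)
    (h' : LocalDiffeo g' (g a) V V') : LocalDiffeo (g.trans g') a U V' where
  mem_source := by
    rw [g.trans_source]
    exact ⟨h.mem_source, h'.mem_source⟩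
  smooth := by
    rw [g.trans_source]
    exact h'.smooth.comp (h.smooth.mono inter_subset_left) inter_subset_right
  smooth_symm := by
    rw [g.trans_target]
    exact h.smooth_symm.comp (h'.smooth_symm.mono inter_subset_left) inter_subset_right
  mem_iff := by
    have hc : Tendsto g (𝓝 a) (𝓝 (g a)) := g.continuousAt h.mem_source
    filter_upwards [h.mem_iff, hc.eventually h'.mem_iff] with x hx hx'
    rw [hx, hx']
    rfl

theorem contDiffAt (h : LocalDiffeo g a U V) : ContDiffAt ℝ ∞ g a :=
  h.smooth.contDiffAt (g.open_source.mem_nhds h.mem_source)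

theorem differentiableAt (h : LocalDiffeo g a U V) : DifferentiableAt ℝ g a :=
  h.contDiffAt.differentiableAt (by simp)

theorem at_nhds (h : LocalDiffeo g a U V) : ∀ᶠ x in 𝓝 a, LocalDiffeo g x U V := by
  filter_upwards [h.mem_iff.eventually_nhds, g.open_source.mem_nhds h.mem_source] with x hx hs
  exact ⟨hs, h.smooth, h.smooth_symm, hx⟩

/-- A C¹ map is Lipschitz near a point with any constant above the norm of its derivative there.
When that derivative is the identity, both constants can be taken arbitrarily close to 1. -/
theorem exists_biLipOn (h : LocalDiffeo g a U V) {L₁ L₂ : ℝ≥0} (h₁ : ‖fderiv ℝ g a‖₊ < L₁)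
    (h₂ : ‖fderiv ℝ g.symm (g a)‖₊ < L₂) : ∃ W, a ∈ W ∧ BiLipOn g W L₁ L₂ U V := by
  obtain ⟨s₁, hs₁, hl₁⟩ := (h.contDiffAt.of_le
    (by exact_mod_cast le_top)).exists_lipschitzOnWith_of_nnnorm_lt L₁ h₁
  obtain ⟨s₂, hs₂, hl₂⟩ := (h.symm.contDiffAt.of_le
    (by exact_mod_cast le_top)).exists_lipschitzOnWith_of_nnnorm_lt L₂ h₂
  have hc : Tendsto g (𝓝 a) (𝓝 (g a)) := g.continuousAt h.mem_source
  have hN : ∀ᶠ x in 𝓝 a, x ∈ s₁ ∧ g x ∈ s₂ ∧ x ∈ g.source ∧ (x ∈ U ↔ g x ∈ V) := by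
    filter_upwards [hs₁, hc hs₂, g.open_source.mem_nhds h.mem_source, h.mem_iff] with x a b c d
    exact ⟨a, b, c, d⟩
  obtain ⟨W, hW, hWo, haW⟩ := eventually_nhds_iff.1 hN
  exact ⟨W, haW,
    { isOpen := hWo
      subset := fun x hx => (hW x hx).2.2.1
      smooth := h.smooth.mono fun x hx => (hW x hx).2.2.1
      smooth_symm := h.smooth_symm.mono <| by
        rintro _ ⟨x, hx, rfl⟩
        exact g.map_source (hW x hx).2.2.1
      lip := hl₁.mono fun x hx => (hW x hx).1
      lip_symm := hl₂.mono <| by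
        rintro _ ⟨x, hx, rfl⟩
        exact (hW x hx).2.1
      mem_iff := fun x hx => (hW x hx).2.2.2 }⟩

theorem hasTraceBoundAt (h : LocalDiffeo g a U V) (hV : IsOpen V) (hU : HasTraceBoundAt U a) :
    HasTraceBoundAt V (g a) := by
  obtain ⟨ρ, hρ, A, hA⟩ := hU
  obtain ⟨W, haW, hW⟩ := h.exists_biLipOn (L₁ := ‖fderiv ℝ g a‖₊ + 1)
    (L₂ := ‖fderiv ℝ g.symm (g a)‖₊ + 1) (lt_add_one _) (lt_add_one _)
  have hO : IsOpen (g '' (W ∩ Metric.ball a ρ)) :=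
    g.isOpen_image_of_subset_source (hW.isOpen.inter Metric.isOpen_ball)
      (inter_subset_left.trans hW.subset)
  obtain ⟨ρ', hρ', hb⟩ := Metric.isOpen_iff.1 hO (g a)
    (mem_image_of_mem g ⟨haW, Metric.mem_ball_self hρ⟩)
  exact ⟨ρ', hρ', _, hA.of_biLipOn hW hV hb⟩

theorem mem_frontier_iff (h : LocalDiffeo g a U V) : a ∈ frontier U ↔ g a ∈ frontier V := by
  obtain ⟨W, haW, hW⟩ := h.exists_biLipOn (L₁ := ‖fderiv ℝ g a‖₊ + 1)
    (L₂ := ‖fderiv ℝ g.symm (g a)‖₊ + 1) (lt_add_one _) (lt_add_one _)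
  exact hW.frontier_iff haW

theorem symm_fderiv_comp (h : LocalDiffeo g a U V) :
    (fderiv ℝ g.symm (g a)).comp (fderiv ℝ g a) = ContinuousLinearMap.id ℝ 𝔼 := by
  rw [← fderiv_comp _ h.symm.differentiableAt h.differentiableAt]
  have : g.symm ∘ g =ᶠ[𝓝 a] id := by
    filter_upwards [g.open_source.mem_nhds h.mem_source] with x hx using g.left_inv hx
  rw [this.fderiv_eq, fderiv_id]

theorem fderiv_comp_symm (h : LocalDiffeo g a U V) :
    (fderiv ℝ g a).comp (fderiv ℝ g.symm (g a)) = ContinuousLinearMap.id ℝ 𝔼 := by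
  have := h.symm.symm_fderiv_comp
  simpa [g.left_inv h.mem_source] using this

end LocalDiffeo

/-- The affine map `x ↦ l + t x`. -/
def affineHomeo (l : 𝔼) (t : ℝ) (ht : t ≠ 0) : OpenPartialHomeomorph 𝔼 𝔼 :=
  ((Homeomorph.smulOfNeZero t ht).trans (Homeomorph.addLeft l)).toOpenPartialHomeomorph

@[simp] theorem affineHomeo_apply (l : 𝔼) (t : ℝ) (ht : t ≠ 0) (x : 𝔼) :
    affineHomeo l t ht x = l + t • x := rfl

@[simp] theorem affineHomeo_symm_apply (l : 𝔼) (t : ℝ) (ht : t ≠ 0) (x : 𝔼) :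
    (affineHomeo l t ht).symm x = t⁻¹ • (-l + x) := rfl

theorem biLipOn_affineHomeo {U V : Set 𝔼} (l : 𝔼) {t : ℝ≥0} (ht : (t : ℝ) ≠ 0)
    (h : ∀ x, x ∈ U ↔ l + (t : ℝ) • x ∈ V) :
    BiLipOn (affineHomeo l t ht) univ t t⁻¹ U V where
  isOpen := isOpen_univ
  subset := fun _ _ => mem_univ _
  smooth := by
    have : ContDiff ℝ ∞ fun x : 𝔼 => l + (t : ℝ) • x := by fun_prop
    exact this.contDiffOn
  smooth_symm := by
    have : ContDiff ℝ ∞ fun x : 𝔼 => (t : ℝ)⁻¹ • (-l + x) := by fun_prop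
    exact this.contDiffOn
  lip := by
    refine (LipschitzWith.of_dist_le_mul fun x y => ?_).lipschitzOnWith
    simp [dist_eq_norm, ← smul_sub, norm_smul]
  lip_symm := by
    refine (LipschitzWith.of_dist_le_mul fun x y => ?_).lipschitzOnWith
    simp [dist_eq_norm, ← smul_sub, norm_smul]
  mem_iff := fun x _ => h x

/-- Both sides of the W^{1,1} trace inequality scale like t^(m-1), so A is unchanged: in
`TraceBound.of_biLipOn` the factor is t^(m-1) · t · t^(-m) = 1. -/
theorem TraceBound.affine {U V : Set 𝔼} (hm : 1 ≤ m) (hV : IsOpen V) {z : 𝔼} {ρ : ℝ} {A : ℝ≥0}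
    (h : TraceBound U z ρ A) (l : 𝔼) {t : ℝ} (ht : 0 < t) (hUV : ∀ x, x ∈ U ↔ l + t • x ∈ V) :
    TraceBound V (l + t • z) (t * ρ) A := by
  lift t to ℝ≥0 using ht.le
  have ht' : t ≠ 0 := by exact_mod_cast ht.ne'
  have h1 := h.of_biLipOn (biLipOn_affineHomeo l ht.ne' hUV) hV (z' := l + (t : ℝ) • z)
    (ρ' := t * ρ) ?_
  · convert h1 using 1
    obtain ⟨k, rfl⟩ : ∃ k, m = k + 1 := ⟨m - 1, by omega⟩
    rw [Nat.add_sub_cancel, ← pow_succ, ← mul_pow, mul_inv_cancel₀ ht', one_pow, one_mul]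
  · intro y hy
    refine ⟨(t : ℝ)⁻¹ • (-l + y), ⟨mem_univ _, ?_⟩, ?_⟩
    · rw [Metric.mem_ball, dist_eq_norm] at hy ⊢
      have : (t : ℝ)⁻¹ • (-l + y) - z = (t : ℝ)⁻¹ • (y - (l + (t : ℝ) • z)) := by
        rw [smul_sub, smul_add, smul_add, smul_smul, inv_mul_cancel₀ ht.ne', one_smul, smul_neg]
        abel
      rw [this, norm_smul, norm_inv, Real.norm_of_nonneg ht.le, inv_mul_lt_iff₀ ht]
      exact hy
    · simp [smul_smul, mul_inv_cancel₀ ht.ne']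

theorem lintegral_enorm_lt_top {F : Type*} [NormedAddCommGroup F] {f : 𝔼 → F} (hf : Continuous f)
    (hc : HasCompactSupport f) (μ : Measure 𝔼) [IsFiniteMeasureOnCompacts μ] :
    ∫⁻ x, ‖f x‖ₑ ∂μ < ⊤ :=
  (hf.integrable_of_hasCompactSupport hc).hasFiniteIntegral

/-- Testing the inequality on a bump function bounds the surface measure of a smaller ball, so local
finiteness need not be known beforehand. -/
theorem TraceBound.surfaceMeasure_ball_lt_top {U : Set 𝔼} {z : 𝔼} {ρ : ℝ} {A : ℝ≥0}
    (h : TraceBound U z ρ A) (hρ : 0 < ρ) : surfaceMeasure U (Metric.ball z (ρ / 4)) < ⊤ := by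
  let η : ContDiffBump z := ⟨ρ / 4, ρ / 2, by positivity, by linarith⟩
  have hη : ContDiff ℝ 1 η := η.contDiff
  have h1 := h η hη η.hasCompactSupport (by
    rw [η.tsupport_eq]
    exact Metric.closedBall_subset_ball (by simp only [η]; linarith))
  have h2 : ∫⁻ x in U, ‖fderiv ℝ η x‖ₑ < ⊤ :=
    (lintegral_mono' Measure.restrict_le_self le_rfl).trans_lt
      (lintegral_enorm_lt_top (hη.continuous_fderiv one_ne_zero)
        (η.hasCompactSupport.fderiv ℝ) volume)
  calc surfaceMeasure U (Metric.ball z (ρ / 4))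
      = ∫⁻ x in Metric.ball z (ρ / 4), 1 ∂surfaceMeasure U := by simp
    _ ≤ ∫⁻ x in Metric.ball z (ρ / 4), ‖η x‖ₑ ∂surfaceMeasure U := by
        refine setLIntegral_mono' Metric.isOpen_ball.measurableSet fun x hx => ?_
        rw [η.one_of_mem_closedBall (Metric.ball_subset_closedBall hx)]
        simp
    _ ≤ ∫⁻ x, ‖η x‖ₑ ∂surfaceMeasure U := setLIntegral_le_lintegral _ _
    _ < ⊤ := h1.trans_lt (ENNReal.mul_lt_top ENNReal.coe_lt_top h2)

theorem sigmaFinite_restrict_of_forall_nhds {μ : Measure 𝔼} {S : Set 𝔼} (hS : MeasurableSet S)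
    {B : 𝔼 → Set 𝔼} (hB : ∀ z ∈ S, B z ∈ 𝓝 z) (hμ : ∀ z ∈ S, μ (B z) < ⊤) :
    SigmaFinite (μ.restrict S) := by
  obtain ⟨t, htS, htc, ht⟩ := TopologicalSpace.countable_cover_nhdsWithin
    (f := B) (s := S) fun x hx => mem_nhdsWithin_of_mem_nhds (hB x hx)
  refine Measure.sigmaFinite_of_countable (S := insert Sᶜ (B '' t)) ((htc.image B).insert _) ?_ ?_
  · rintro s (rfl | ⟨z, hz, rfl⟩)
    · rw [Measure.restrict_apply hS.compl]
      simp
    · exact (Measure.restrict_le_self _).trans_lt (hμ z (htS hz))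
  · rw [eq_univ_iff_forall]
    intro x
    by_cases hx : x ∈ S
    · obtain ⟨z, hz, hxz⟩ := mem_iUnion₂.1 (ht hx)
      exact ⟨B z, Or.inr ⟨z, hz, rfl⟩, hxz⟩
    · exact ⟨Sᶜ, Or.inl rfl, hx⟩

theorem volume_ball_eq (x : 𝔼) {r : ℝ} (hr : 0 < r) :
    volume (Metric.ball x r) = ENNReal.ofReal (r ^ m) * volume (Metric.ball (0 : 𝔼) 1) := by
  rw [Measure.addHaar_ball_of_pos _ _ hr, finrank_euclideanSpace_fin]

/-! ### Summation of local trace inequalities over Whitney balls -/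

/-- A fixed smooth cutoff, equal to `1` on the ball of radius `1/4` and supported in the ball of
radius `1/2`. -/
def cutoff : ContDiffBump (0 : 𝔼) := ⟨1 / 4, 1 / 2, by norm_num, by norm_num⟩

theorem exists_cutoff_fderiv_bound :
    ∃ M : ℝ≥0, ∀ x : 𝔼, ‖fderiv ℝ (cutoff (m := m)) x‖ₑ ≤ M := by
  have hη : ContDiff ℝ 1 (cutoff (m := m)) := cutoff.contDiff
  obtain ⟨C, hC⟩ := (hη.continuous_fderiv one_ne_zero).bounded_above_of_compact_support
    (cutoff.hasCompactSupport.fderiv ℝ)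
  refine ⟨C.toNNReal, fun x => ?_⟩
  rw [← ofReal_norm]
  exact ENNReal.ofReal_le_ofReal (hC x)

/-- The cutoff centred at `z` at scale `r`. -/
def cutoffAt (z : 𝔼) (r : ℝ) (x : 𝔼) : ℝ := cutoff (m := m) (r⁻¹ • (x - z))

theorem contDiff_cutoffAt (z : 𝔼) (r : ℝ) {n : ℕ∞} : ContDiff ℝ n (cutoffAt z r) := by
  have : ContDiff ℝ n (cutoff (m := m)) := cutoff.contDiff
  exact this.comp (by fun_prop)

theorem enorm_cutoffAt_le (z : 𝔼) (r : ℝ) (x : 𝔼) : ‖cutoffAt z r x‖ₑ ≤ 1 := by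
  rw [cutoffAt, ← ofReal_norm, Real.norm_of_nonneg cutoff.nonneg]
  exact ENNReal.ofReal_le_one.2 cutoff.le_one

theorem cutoffAt_eq_one {z : 𝔼} {r : ℝ} (hr : 0 < r) {x : 𝔼} (hx : ‖x - z‖ ≤ r / 4) :
    cutoffAt z r x = 1 := by
  refine cutoff.one_of_mem_closedBall ?_
  rw [mem_closedBall_zero_iff, norm_smul, norm_inv, Real.norm_of_nonneg hr.le,
    inv_mul_le_iff₀ hr]
  simpa [cutoff] using hx.trans_eq (by ring)

theorem cutoffAt_eq_zero {z : 𝔼} {r : ℝ} (hr : 0 < r) {x : 𝔼} (hx : r / 2 ≤ ‖x - z‖) :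
    cutoffAt z r x = 0 := by
  refine cutoff.zero_of_le_dist ?_
  rw [dist_zero_right, norm_smul, norm_inv, Real.norm_of_nonneg hr.le, le_inv_mul_iff₀ hr]
  simpa [cutoff] using hx.trans_eq' (by ring)

theorem tsupport_cutoffAt_subset {z : 𝔼} {r : ℝ} (hr : 0 < r) :
    tsupport (cutoffAt z r) ⊆ Metric.ball z r := by
  have : tsupport (cutoffAt z r) ⊆ Metric.closedBall z (r / 2) := by
    refine closure_minimal (fun x hx => ?_) Metric.isClosed_closedBall
    by_contra hh
    rw [Metric.mem_closedBall, dist_eq_norm, not_le] at hh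
    exact hx (cutoffAt_eq_zero hr hh.le)
  exact this.trans (Metric.closedBall_subset_ball (by linarith))

theorem enorm_fderiv_cutoffAt_le {M : ℝ≥0} (hM : ∀ x : 𝔼, ‖fderiv ℝ (cutoff (m := m)) x‖ₑ ≤ M)
    {z : 𝔼} {r : ℝ} (hr : 0 < r) (x : 𝔼) :
    ‖fderiv ℝ (cutoffAt z r) x‖ₑ ≤ ENNReal.ofReal r⁻¹ * M := by
  have hη : ContDiff ℝ 1 (cutoff (m := m)) := cutoff.contDiff
  have hd : HasFDerivAt (cutoffAt z r)
      ((fderiv ℝ (cutoff (m := m)) (r⁻¹ • (x - z))).comp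
        (r⁻¹ • ContinuousLinearMap.id ℝ 𝔼)) x :=
    ((hη.differentiable one_ne_zero _).hasFDerivAt).comp x
      (((hasFDerivAt_id x).sub_const z).const_smul r⁻¹)
  rw [hd.fderiv, ContinuousLinearMap.comp_smul, ContinuousLinearMap.comp_id, ← ofReal_norm,
    norm_smul, norm_inv, Real.norm_of_nonneg hr.le, ENNReal.ofReal_mul (by positivity), ofReal_norm]
  gcongr
  exact hM _

theorem enorm_fderiv_mul_le {u v : 𝔼 → ℝ} (hu : ContDiff ℝ 1 u) (hv : ContDiff ℝ 1 v) (x : 𝔼) :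
    ‖fderiv ℝ (fun x => u x * v x) x‖ₑ ≤
      ‖u x‖ₑ * ‖fderiv ℝ v x‖ₑ + ‖v x‖ₑ * ‖fderiv ℝ u x‖ₑ := by
  rw [fderiv_fun_mul (hu.differentiable one_ne_zero x) (hv.differentiable one_ne_zero x)]
  simp_rw [← ofReal_norm]
  rw [← ENNReal.ofReal_mul (norm_nonneg _), ← ENNReal.ofReal_mul (norm_nonneg _),
    ← ENNReal.ofReal_add (by positivity) (by positivity), ← norm_smul, ← norm_smul]
  exact ENNReal.ofReal_le_ofReal (norm_add_le _ _)

open Classical in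
/-- The weight `d(z)^{-m}` restricted to the pairs `(z,x)` with `|x - z| ≤ d(z)/4`. -/
def whitneyKernel (d : 𝔼 → ℝ) (z x : 𝔼) : ℝ≥0∞ :=
  if ‖x - z‖ ≤ d z / 4 ∧ 0 < d z then ENNReal.ofReal ((d z)⁻¹ ^ m) else 0

theorem measurable_whitneyKernel {d : 𝔼 → ℝ} (hd : Continuous d) :
    Measurable (Function.uncurry (whitneyKernel d)) := by
  have hdm : Measurable d := hd.measurable
  refine Measurable.ite ?_ (by fun_prop) measurable_const
  exact (measurableSet_le (f := fun p : 𝔼 × 𝔼 => ‖p.2 - p.1‖) (g := fun p => d p.1 / 4)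
    (by fun_prop) (by fun_prop)).inter
    (measurableSet_lt (f := fun _ : 𝔼 × 𝔼 => (0 : ℝ)) (g := fun p => d p.1)
    (by fun_prop) (by fun_prop))

theorem whitneyKernel_eq_zero {d : 𝔼 → ℝ} {z x : 𝔼} (h : ¬ (‖x - z‖ ≤ d z / 4 ∧ 0 < d z)) :
    whitneyKernel d z x = 0 := if_neg h

theorem whitneyKernel_eq {d : 𝔼 → ℝ} {z x : 𝔼} (h : ‖x - z‖ ≤ d z / 4) (h0 : 0 < d z) :
    whitneyKernel d z x = ENNReal.ofReal ((d z)⁻¹ ^ m) := if_pos ⟨h, h0⟩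

attribute [irreducible] whitneyKernel

/-- Bounded overlap in continuous form: as d is 1-Lipschitz, d(z) and d(x) are comparable on the
support of the kernel, so z lies in B(x, d(x)) and the weight is at most (2/d(x))^m. -/
theorem lintegral_whitneyKernel_le {d : 𝔼 → ℝ} (hd : LipschitzWith 1 d) (x : 𝔼) :
    ∫⁻ z, whitneyKernel d z x ≤ ENNReal.ofReal (2 ^ m) * volume (Metric.ball (0 : 𝔼) 1) := by
  have hl : ∀ z, |d x - d z| ≤ ‖x - z‖ := fun z => by
    have := hd.dist_le_mul x z
    rwa [NNReal.coe_one, one_mul, Real.dist_eq, dist_eq_norm] at this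
  by_cases hx : 0 < d x
  · calc ∫⁻ z, whitneyKernel d z x
        ≤ ∫⁻ z, (Metric.ball x (d x)).indicator (fun _ => ENNReal.ofReal ((2 / d x) ^ m)) z := by
          refine lintegral_mono fun z => ?_
          by_cases h : ‖x - z‖ ≤ d z / 4 ∧ 0 < d z
          · have h1 := abs_le.1 (hl z)
            have hzx : z ∈ Metric.ball x (d x) := by
              rw [Metric.mem_ball, dist_comm, dist_eq_norm]
              linarith [h.1, h.2, h1.1, h1.2]
            rw [whitneyKernel_eq h.1 h.2, indicator_of_mem hzx]
            refine ENNReal.ofReal_le_ofReal (pow_le_pow_left₀ (by positivity [h.2]) ?_ m)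
            rw [inv_eq_one_div, div_le_div_iff₀ h.2 hx]
            linarith [h.1, h.2, h1.1, h1.2]
          · rw [whitneyKernel_eq_zero h]
            exact zero_le
      _ = ENNReal.ofReal ((2 / d x) ^ m) * volume (Metric.ball x (d x)) := by
          rw [lintegral_indicator Metric.isOpen_ball.measurableSet, setLIntegral_const]
      _ = _ := by
          rw [volume_ball_eq x hx, ← mul_assoc, ← ENNReal.ofReal_mul (by positivity), ← mul_pow,
            div_mul_cancel₀ _ hx.ne']
  · have : ∀ z, whitneyKernel d z x = 0 := fun z => by
      refine whitneyKernel_eq_zero fun h => hx ?_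
      have h1 := abs_le.1 (hl z)
      linarith [h.1, h.2, h1.1, h1.2]
    simp [this]

/-- The covering counterpart: for |x - z| < ρ d(x)/8 one has d(x)/2 ≤ d(z) ≤ 2 d(x), so the cutoff
centred at z equals 1 at x and the weight is at least (2 d(x))^(-m). -/
theorem le_lintegral_whitney_cutoff {d : 𝔼 → ℝ} (hd : LipschitzWith 1 d) {ρ : ℝ} (hρ : 0 < ρ)
    (hρ' : ρ ≤ 1 / 4) {x : 𝔼} (hx : 0 < d x) :
    ENNReal.ofReal ((ρ / 16) ^ m) * volume (Metric.ball (0 : 𝔼) 1) ≤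
      ∫⁻ z, ENNReal.ofReal ((d z)⁻¹ ^ m) * ‖cutoffAt z (ρ * d z) x‖ₑ := by
  have hl : ∀ z, |d x - d z| ≤ ‖x - z‖ := fun z => by
    have := hd.dist_le_mul x z
    rwa [NNReal.coe_one, one_mul, Real.dist_eq, dist_eq_norm] at this
  have hr : 0 < ρ * d x / 8 := by positivity
  calc ENNReal.ofReal ((ρ / 16) ^ m) * volume (Metric.ball (0 : 𝔼) 1)
      = ∫⁻ z in Metric.ball x (ρ * d x / 8), ENNReal.ofReal ((2 * d x)⁻¹ ^ m) := by
        rw [setLIntegral_const, volume_ball_eq x hr, ← mul_assoc,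
          ← ENNReal.ofReal_mul (by positivity), ← mul_pow]
        congr 3
        field_simp
        norm_num
    _ ≤ ∫⁻ z in Metric.ball x (ρ * d x / 8),
          ENNReal.ofReal ((d z)⁻¹ ^ m) * ‖cutoffAt z (ρ * d z) x‖ₑ := by
        refine setLIntegral_mono' Metric.isOpen_ball.measurableSet fun z hz => ?_
        rw [Metric.mem_ball, dist_comm, dist_eq_norm] at hz
        have h1 := abs_le.1 (hl z)
        have h2 : ρ * d x ≤ 1 / 4 * d x := by gcongr
        have hz0 : d x / 2 ≤ d z := by linarith [h1.1, h1.2]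
        have hz1 : d z ≤ 2 * d x := by linarith [h1.1, h1.2]
        have hz2 : 0 < d z := by linarith
        have h3 : ρ * (d x / 2) ≤ ρ * d z := by gcongr
        rw [cutoffAt_eq_one (by positivity) (by linarith)]
        simp only [enorm_one, mul_one]
        refine ENNReal.ofReal_le_ofReal (pow_le_pow_left₀ (by positivity) ?_ m)
        exact inv_anti₀ hz2 hz1
    _ ≤ _ := setLIntegral_le_lintegral _ _

theorem measurable_cutoffAt {r : 𝔼 → ℝ} (hr : Measurable r) :
    Measurable fun p : 𝔼 × 𝔼 => cutoffAt p.2 (r p.2) p.1 := by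
  have hη : Continuous (cutoff (m := m)) := cutoff.continuous
  have h1 : Measurable fun p : 𝔼 × 𝔼 => (r p.2)⁻¹ • (p.1 - p.2) := by fun_prop
  exact hη.measurable.comp h1

set_option maxHeartbeats 800000 in
/-- A trace inequality on Whitney balls can be summed up. -/
theorem exists_lintegral_surface_le_of_whitney (hm : 1 ≤ m) {U : Set 𝔼} {d : 𝔼 → ℝ}
    (hd : LipschitzWith 1 d) (hd0 : ∀ z, 0 ≤ d z) {ρ : ℝ} (hρ : 0 < ρ) (hρ' : ρ ≤ 1 / 4) {A : ℝ≥0}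
    (hT : ∀ z, 0 < d z → TraceBound U z (ρ * d z) A) :
    ∃ B : ℝ≥0, ∀ u : 𝔼 → ℝ, ContDiff ℝ 1 u → HasCompactSupport u →
      ∫⁻ x in {x | 0 < d x}, ‖u x‖ₑ ∂surfaceMeasure U ≤
        B * ∫⁻ x in U, (‖fderiv ℝ u x‖ₑ + ‖u x‖ₑ / ENNReal.ofReal (d x)) := by
  obtain ⟨M, hM⟩ := exists_cutoff_fderiv_bound (m := m)
  have hl : ∀ x z, |d x - d z| ≤ ‖x - z‖ := fun x z => by
    have := hd.dist_le_mul x z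
    rwa [NNReal.coe_one, one_mul, Real.dist_eq, dist_eq_norm] at this
  have hdm : Measurable d := hd.continuous.measurable
  set P : Set 𝔼 := {x | 0 < d x} with hP
  have hPo : IsOpen P := isOpen_lt continuous_const hd.continuous
  set κ : ℝ≥0∞ := volume (Metric.ball (0 : 𝔼) 1) with hκ
  have hκ0 : κ ≠ 0 := (Metric.measure_ball_pos volume _ one_pos).ne'
  have hκt : κ ≠ ⊤ := measure_ball_lt_top.ne
  set c₀ : ℝ≥0∞ := ENNReal.ofReal ((ρ / 16) ^ m) * κ with hc₀
  have hc₀0 : c₀ ≠ 0 := mul_ne_zero (ENNReal.ofReal_pos.2 (by positivity)).ne' hκ0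
  have hc₀t : c₀ ≠ ⊤ := ENNReal.mul_ne_top ENNReal.ofReal_ne_top hκt
  set C₀ : ℝ≥0∞ := ENNReal.ofReal (2 ^ m) * κ with hC₀
  have hC₀t : C₀ ≠ ⊤ := ENNReal.mul_ne_top ENNReal.ofReal_ne_top hκt
  set b : ℝ≥0∞ := 1 + ENNReal.ofReal (2 / ρ) * M with hb
  have hbt : b ≠ ⊤ := by simp [hb, ENNReal.mul_eq_top]
  have hBt : c₀⁻¹ * (A * (b * C₀)) ≠ ⊤ := by
    refine ENNReal.mul_ne_top (ENNReal.inv_ne_top.2 hc₀0) ?_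
    exact ENNReal.mul_ne_top ENNReal.coe_ne_top (ENNReal.mul_ne_top hbt hC₀t)
  -- Needed to exchange the surface integral with the integral over centres z.
  have hsf : SigmaFinite ((surfaceMeasure U).restrict P) := by
    refine sigmaFinite_restrict_of_forall_nhds hPo.measurableSet
      (B := fun z => Metric.ball z (ρ * d z / 4)) (fun z hz => ?_) (fun z hz => ?_)
    · exact Metric.ball_mem_nhds _ (by have : 0 < d z := hz; positivity)
    · exact (hT z hz).surfaceMeasure_ball_lt_top (mul_pos hρ hz)
  refine ⟨(c₀⁻¹ * (A * (b * C₀))).toNNReal, fun u hu huc => ?_⟩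
  rw [ENNReal.coe_toNNReal hBt]
  set Φ : 𝔼 → ℝ≥0∞ := fun x => ‖fderiv ℝ u x‖ₑ + ‖u x‖ₑ / ENNReal.ofReal (d x) with hΦ
  have hdu : Continuous (fderiv ℝ u) := hu.continuous_fderiv one_ne_zero
  have huc' := hu.continuous
  have hΦm : Measurable Φ := by fun_prop
  set w : 𝔼 → ℝ≥0∞ := fun z => ENNReal.ofReal ((d z)⁻¹ ^ m) with hw
  have hwm : Measurable w := by fun_prop
  -- pointwise bound for the localised gradient
  have key : ∀ z, 0 < d z → ∀ x,
      w z * ‖fderiv ℝ (fun x => cutoffAt z (ρ * d z) x * u x) x‖ₑ ≤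
        b * (whitneyKernel d z x * Φ x) := by
    intro z hz x
    have hr : 0 < ρ * d z := mul_pos hρ hz
    by_cases hxz : ‖x - z‖ ≤ d z / 4
    · rw [whitneyKernel_eq hxz hz]
      have h1 := abs_le.1 (hl x z)
      have hx : 0 < d x := by linarith [h1.1]
      have h2 : ‖fderiv ℝ (cutoffAt z (ρ * d z)) x‖ₑ ≤
          -- The cutoff has gradient at most M/(ρ d(z)), and d(x) ≤ 2 d(z) on its support; this
          -- produces the constant 2/ρ.
          ENNReal.ofReal (2 / ρ) * M * (ENNReal.ofReal (d x))⁻¹ := by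
        refine (enorm_fderiv_cutoffAt_le hM hr x).trans ?_
        rw [← ENNReal.ofReal_inv_of_pos hx, mul_right_comm, ← ENNReal.ofReal_mul (by positivity)]
        gcongr
        rw [mul_inv, div_eq_mul_inv, mul_comm (2 : ℝ), mul_assoc]
        gcongr
        rw [← div_eq_mul_inv, inv_eq_one_div, div_le_div_iff₀ hz hx]
        linarith [h1.2]
      rw [mul_left_comm]
      refine mul_le_mul_right ?_ (w z)
      calc _ ≤ ‖cutoffAt z (ρ * d z) x‖ₑ * ‖fderiv ℝ u x‖ₑ +
            ‖u x‖ₑ * ‖fderiv ℝ (cutoffAt z (ρ * d z)) x‖ₑ :=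
            enorm_fderiv_mul_le (contDiff_cutoffAt z _ (n := 1)) hu x
        _ ≤ 1 * ‖fderiv ℝ u x‖ₑ +
            ‖u x‖ₑ * (ENNReal.ofReal (2 / ρ) * M * (ENNReal.ofReal (d x))⁻¹) := by
            gcongr
            exact enorm_cutoffAt_le _ _ _
        _ = 1 * ‖fderiv ℝ u x‖ₑ +
            ENNReal.ofReal (2 / ρ) * M * (‖u x‖ₑ / ENNReal.ofReal (d x)) := by
            rw [ENNReal.div_eq_inv_mul]; ring
        _ ≤ b * ‖fderiv ℝ u x‖ₑ + b * (‖u x‖ₑ / ENNReal.ofReal (d x)) := by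
            gcongr
            · exact le_self_add
            · exact le_add_self
        _ = b * Φ x := by rw [hΦ, mul_add]
    · have h0 : fderiv ℝ (fun x => cutoffAt z (ρ * d z) x * u x) x = 0 := by
        have hn : ∀ᶠ y in 𝓝 x, d z / 4 < ‖y - z‖ :=
          (continuous_id.sub continuous_const).norm.continuousAt.eventually_const_lt
            (not_le.1 hxz)
        have he : (fun x => cutoffAt z (ρ * d z) x * u x) =ᶠ[𝓝 x] fun _ => 0 := by
          filter_upwards [hn] with y hy
          have : ρ * d z ≤ 1 / 4 * d z := by gcongr
          rw [cutoffAt_eq_zero hr (by linarith), zero_mul]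
        rw [he.fderiv_eq]
        simp
      rw [← ofReal_norm, h0]
      simp
  have hloc : ∀ z, w z * ∫⁻ x in P, ‖cutoffAt z (ρ * d z) x * u x‖ₑ ∂surfaceMeasure U ≤
      A * ∫⁻ x in U, b * (whitneyKernel d z x * Φ x) := by
    intro z
    by_cases hz : 0 < d z
    · have hr : 0 < ρ * d z := mul_pos hρ hz
      have h1 := hT z hz (fun x => cutoffAt z (ρ * d z) x * u x)
        ((contDiff_cutoffAt z _ (n := 1)).mul hu) huc.mul_left
        ((tsupport_mul_subset_left (f := cutoffAt z (ρ * d z))).trans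
          (tsupport_cutoffAt_subset hr))
      calc _ ≤ w z * (A * ∫⁻ x in U, ‖fderiv ℝ (fun x => cutoffAt z (ρ * d z) x * u x) x‖ₑ) := by
            gcongr
            exact (setLIntegral_le_lintegral _ _).trans h1
        _ = A * ∫⁻ x in U, w z * ‖fderiv ℝ (fun x => cutoffAt z (ρ * d z) x * u x) x‖ₑ := by
            rw [lintegral_const_mul' _ _ ENNReal.ofReal_ne_top]
            ring
        _ ≤ _ := by
            exact mul_le_mul_right (lintegral_mono fun x => key z hz x) _
    -- Centres with d(z) = 0 contribute nothing: `0⁻¹ = 0` and m ≥ 1 make the weight zero.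
    · have hz0 : d z = 0 := le_antisymm (not_lt.1 hz) (hd0 z)
      have : w z = 0 := by simp [hw, hz0, show m ≠ 0 by omega]
      rw [this, zero_mul]
      exact zero_le
  calc ∫⁻ x in P, ‖u x‖ₑ ∂surfaceMeasure U
      = c₀⁻¹ * (∫⁻ x in P, c₀ * ‖u x‖ₑ ∂surfaceMeasure U) := by
        rw [lintegral_const_mul' _ _ hc₀t, ← mul_assoc, ENNReal.inv_mul_cancel hc₀0 hc₀t, one_mul]
    _ ≤ c₀⁻¹ * (∫⁻ x in P, (∫⁻ z, w z * ‖cutoffAt z (ρ * d z) x * u x‖ₑ)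
          ∂surfaceMeasure U) := by
        refine mul_le_mul_right (setLIntegral_mono' hPo.measurableSet fun x hx => ?_) _
        simp_rw [enorm_mul, ← mul_assoc]
        rw [lintegral_mul_const' _ _ enorm_ne_top]
        gcongr
        exact le_lintegral_whitney_cutoff hd hρ hρ' hx
    _ = c₀⁻¹ * (∫⁻ z, w z * ∫⁻ x in P, ‖cutoffAt z (ρ * d z) x * u x‖ₑ ∂surfaceMeasure U) := by
        rw [lintegral_lintegral_swap]
        · congr 1
          refine lintegral_congr fun z => ?_
          rw [lintegral_const_mul' _ _ ENNReal.ofReal_ne_top]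
        · refine Measurable.aemeasurable ?_
          have h1 := measurable_cutoffAt (r := fun z => ρ * d z) (hdm.const_mul ρ)
          exact (hwm.comp measurable_snd).mul
            (h1.mul (huc'.measurable.comp measurable_fst)).enorm
    _ ≤ c₀⁻¹ * (∫⁻ z, A * ∫⁻ x in U, b * (whitneyKernel d z x * Φ x)) := by
        exact mul_le_mul_right (lintegral_mono hloc) _
    _ = c₀⁻¹ * (A * (b * ∫⁻ x in U, (∫⁻ z, whitneyKernel d z x) * Φ x)) := by
        have hk := measurable_whitneyKernel hd.continuous
        rw [lintegral_const_mul' _ _ ENNReal.coe_ne_top]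
        simp_rw [lintegral_const_mul' _ _ hbt]
        rw [lintegral_lintegral_swap]
        · congr 3
          refine lintegral_congr fun x => ?_
          rw [lintegral_mul_const]
          exact hk.of_uncurry_right
        · have h1 : Measurable fun p : 𝔼 × 𝔼 => Φ p.2 := hΦm.comp measurable_snd
          exact (hk.mul h1).aemeasurable
    _ ≤ c₀⁻¹ * (A * (b * ∫⁻ x in U, C₀ * Φ x)) := by
        refine mul_le_mul_right (mul_le_mul_right (mul_le_mul_right
          (lintegral_mono fun x => ?_) _) _) _
        exact mul_le_mul_left (lintegral_whitneyKernel_le hd x) _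
    _ = c₀⁻¹ * (A * (b * C₀)) * ∫⁻ x in U, Φ x := by
        rw [lintegral_const_mul' _ _ hC₀t]
        ring

/-! ### Cones, lineality spaces and Hardy's inequality -/

theorem IsCone.zero_notMem {K : Set 𝔼} (hK : IsCone K) : (0 : 𝔼) ∉ K := by
  obtain ⟨M, hM, rfl⟩ := hK
  intro h
  have := hM h
  simp at this

theorem IsCone.smul_mem_iff {K : Set 𝔼} (hK : IsCone K) {t : ℝ} (ht : 0 < t) {x : 𝔼} :
    t • x ∈ K ↔ x ∈ K := by
  obtain ⟨M, hM, rfl⟩ := hK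
  simp only [mem_ofPred_eq, norm_smul, Real.norm_of_nonneg ht.le, mul_inv, smul_smul]
  rw [mul_right_comm, inv_mul_cancel₀ ht.ne', one_mul]

/-- The subspace of all directions along which `K` is translation invariant. -/
def lineality (K : Set 𝔼) : Submodule ℝ 𝔼 where
  carrier := {w | ∀ s : ℝ, ∀ x ∈ K, x + s • w ∈ K}
  zero_mem' := by simp
  add_mem' := by
    intro v w hv hw s x hx
    rw [smul_add, ← add_assoc]
    exact hw s _ (hv s x hx)
  smul_mem' := by
    intro c w hw s x hx
    rw [smul_smul]
    exact hw _ x hx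

theorem add_mem_iff_of_mem_lineality {K : Set 𝔼} {w : 𝔼} (hw : w ∈ lineality K) {x : 𝔼} :
    x + w ∈ K ↔ x ∈ K := by
  refine ⟨fun h => ?_, fun h => by simpa using hw 1 x h⟩
  simpa using hw (-1) _ h

theorem notMem_of_mem_lineality {K : Set 𝔼} (h0 : (0 : 𝔼) ∉ K) {w : 𝔼} (hw : w ∈ lineality K) :
    w ∉ K := fun h => h0 ((add_mem_iff_of_mem_lineality hw).1 (by simpa using h))

theorem sub_orthogonal_starProjection_mem (L : Submodule ℝ 𝔼) (x : 𝔼) :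
    x - Lᗮ.starProjection x ∈ L := by
  have := L.starProjection_apply_mem x
  rwa [← sub_eq_of_eq_add (L.starProjection_add_starProjection_orthogonal x).symm] at this

theorem orthogonal_starProjection_eq_zero_iff (L : Submodule ℝ 𝔼) (x : 𝔼) :
    Lᗮ.starProjection x = 0 ↔ x ∈ L := by
  rw [Lᗮ.starProjection_apply_eq_zero_iff, Submodule.orthogonal_orthogonal]

theorem IsCone.starProjection_mem_iff {K : Set 𝔼} {x : 𝔼} :
    (lineality K)ᗮ.starProjection x ∈ K ↔ x ∈ K := by
  have := add_mem_iff_of_mem_lineality (x := (lineality K)ᗮ.starProjection x)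
    (sub_orthogonal_starProjection_mem (lineality K) x)
  rw [← this]
  simp

/-- The affine maps `x ↦ l + t x` with `t > 0` and `l` in the lineality space preserve the cone. -/
theorem IsCone.affine_mem_iff {K : Set 𝔼} (hK : IsCone K) {l : 𝔼} (hl : l ∈ lineality K) {t : ℝ}
    (ht : 0 < t) {x : 𝔼} : l + t • x ∈ K ↔ x ∈ K := by
  rw [add_comm, add_mem_iff_of_mem_lineality hl, hK.smul_mem_iff ht]

/-- The half-line x + s v, s ≤ 0, eventually leaves the compact support, so u(x) is the integral of
its derivative along it. In the applications v points towards the lineality space, so that for s < 0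
the half-line stays in the cone. -/
theorem enorm_le_lintegral_line {u : 𝔼 → ℝ} (hu : ContDiff ℝ 1 u) (huc : HasCompactSupport u)
    (x : 𝔼) {v : 𝔼} (hv : v ≠ 0) :
    ‖u x‖ₑ ≤ ∫⁻ s in Iic (0 : ℝ), ‖fderiv ℝ u (x + s • v)‖ₑ * ‖v‖ₑ := by
  have hemb : Topology.IsClosedEmbedding fun s : ℝ => x + s • v :=
    (Homeomorph.addLeft x).isClosedEmbedding.comp (isClosedEmbedding_smul_left hv)
  have hf : ContDiff ℝ 1 fun s : ℝ => u (x + s • v) := hu.comp (by fun_prop)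
  have hfc : HasCompactSupport fun s : ℝ => u (x + s • v) := huc.comp_isClosedEmbedding hemb
  have h := hfc.enorm_le_lintegral_Ici_deriv hf 0
  simp only [zero_smul, add_zero] at h
  refine h.trans (lintegral_mono fun s => ?_)
  have hd : HasDerivAt (fun s : ℝ => u (x + s • v)) (fderiv ℝ u (x + s • v) v) s := by
    have h1 : HasDerivAt (fun s : ℝ => x + s • v) v s := by
      simpa using ((hasDerivAt_id s).smul_const v).const_add x
    exact (hu.differentiable one_ne_zero _).hasFDerivAt.comp_hasDerivAt s h1
  rw [hd.deriv]
  simp_rw [← ofReal_norm]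
  rw [← ENNReal.ofReal_mul (norm_nonneg _)]
  exact ENNReal.ofReal_le_ofReal (ContinuousLinearMap.le_opNorm _ _)

/-- The linear map which is the identity on `L` and multiplication by `1 - s` on its orthogonal
complement. -/
def orthStretch (L : Submodule ℝ 𝔼) (s : ℝ) : 𝔼 →ₗ[ℝ] 𝔼 :=
  LinearMap.id - s • (Lᗮ.starProjection : 𝔼 →ₗ[ℝ] 𝔼)

theorem orthStretch_apply (L : Submodule ℝ 𝔼) (s : ℝ) (x : 𝔼) :
    orthStretch L s x = x - s • Lᗮ.starProjection x := rfl

/-- L is invariant; the map induces the identity on L and multiplication by 1 - s on the quotient by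
L, and determinants multiply. -/
theorem det_orthStretch (L : Submodule ℝ 𝔼) (s : ℝ) :
    LinearMap.det (orthStretch L s) = (1 - s) ^ Module.finrank ℝ Lᗮ := by
  have hfix : ∀ x ∈ L, orthStretch L s x = x := fun x hx => by
    rw [orthStretch_apply, (orthogonal_starProjection_eq_zero_iff L x).2 hx, smul_zero, sub_zero]
  have hcomap : L ≤ L.comap (orthStretch L s) := fun x hx => by
    rw [Submodule.mem_comap, hfix x hx]
    exact hx
  rw [LinearMap.det_eq_det_mul_det L _ hcomap]
  have h1 : (orthStretch L s).restrict hcomap = LinearMap.id := by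
    ext x
    simp [hfix x x.2]
  have h2 : L.mapQ L (orthStretch L s) hcomap = (1 - s) • LinearMap.id := by
    ext x
    simp only [LinearMap.coe_comp, Function.comp_apply, Submodule.mkQ_apply, Submodule.mapQ_apply,
      LinearMap.smul_apply, LinearMap.id_apply]
    rw [← Submodule.Quotient.mk_smul, Submodule.Quotient.eq, orthStretch_apply]
    have : x - s • Lᗮ.starProjection x - (1 - s) • x = s • (x - Lᗮ.starProjection x) := by
      rw [smul_sub, sub_smul, one_smul]; abel
    rw [this]
    exact L.smul_mem _ (sub_orthogonal_starProjection_mem L x)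
  have h3 : Module.finrank ℝ (𝔼 ⧸ L) = Module.finrank ℝ Lᗮ := by
    have h4 := L.finrank_quotient_add_finrank
    have h5 := L.finrank_add_finrank_orthogonal
    omega
  rw [h1, h2, LinearMap.det_id, LinearMap.det_smul, LinearMap.det_id, h3, one_mul, mul_one]

/-- For s ≤ 0 the stretch is the dilation by 1 - s > 0 followed by a translation along the lineality
space. -/
theorem IsCone.orthStretch_mem_iff {K : Set 𝔼} (hK : IsCone K) {s : ℝ} (hs : s ≤ 0) {x : 𝔼} :
    orthStretch (lineality K) s x ∈ K ↔ x ∈ K := by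
  have : orthStretch (lineality K) s x =
      s • (x - (lineality K)ᗮ.starProjection x) + (1 - s) • x := by
    rw [orthStretch_apply, smul_sub, sub_smul, one_smul]; abel
  rw [this]
  exact hK.affine_mem_iff ((lineality K).smul_mem _ (sub_orthogonal_starProjection_mem _ x))
    (by linarith)

/-- The inverse determinant (1 - s)^(-n) is at most 1/(1 + s²) for s ≤ 0 once n ≥ 2. This is
integrable in s, which is exactly what fails in codimension one. -/
theorem lintegral_comp_orthStretch_le {K : Set 𝔼} (hKo : IsOpen K) (hK : IsCone K)
    (hn : 2 ≤ Module.finrank ℝ (lineality K)ᗮ) {s : ℝ} (hs : s ≤ 0) {F : 𝔼 → ℝ≥0∞}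
    (hF : Measurable F) :
    ∫⁻ x in K, F (orthStretch (lineality K) s x) ≤
      ENNReal.ofReal (1 + s ^ 2)⁻¹ * ∫⁻ x in K, F x := by
  have hm := hKo.measurableSet
  have hdet : 1 + s ^ 2 ≤ LinearMap.det (orthStretch (lineality K) s) := by
    rw [det_orthStretch]
    calc 1 + s ^ 2 ≤ (1 - s) ^ 2 := by nlinarith
      _ ≤ _ := pow_le_pow_right₀ (by linarith) hn
  have hdet0 : 0 < LinearMap.det (orthStretch (lineality K) s) := by nlinarith [sq_nonneg s]
  have hTm : Measurable (orthStretch (lineality K) s) :=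
    (orthStretch (lineality K) s).continuous_of_finiteDimensional.measurable
  calc ∫⁻ x in K, F (orthStretch (lineality K) s x)
      = ∫⁻ x, K.indicator F (orthStretch (lineality K) s x) := by
        rw [← lintegral_indicator hm]
        refine lintegral_congr fun x => ?_
        by_cases hx : x ∈ K
        · rw [indicator_of_mem hx, indicator_of_mem ((hK.orthStretch_mem_iff hs).2 hx)]
        · rw [indicator_of_notMem hx,
            indicator_of_notMem fun h => hx ((hK.orthStretch_mem_iff hs).1 h)]
    _ = ∫⁻ x, K.indicator F x ∂(volume.map (orthStretch (lineality K) s)) :=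
        (lintegral_map (hF.indicator hm) hTm).symm
    _ = ENNReal.ofReal |(LinearMap.det (orthStretch (lineality K) s))⁻¹| * ∫⁻ x in K, F x := by
        rw [Measure.map_linearMap_addHaar_eq_smul_addHaar _ hdet0.ne', lintegral_smul_measure,
          lintegral_indicator hm, smul_eq_mul]
    _ ≤ _ := by
        gcongr
        rw [abs_of_pos (inv_pos.2 hdet0)]
        exact inv_anti₀ (by positivity) hdet

/-- Hardy's inequality on a cone whose lineality space has codimension at least two. -/
theorem exists_hardy {K : Set 𝔼} (hKo : IsOpen K) (hK : IsCone K)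
    (hn : 2 ≤ Module.finrank ℝ (lineality K)ᗮ) :
    ∃ B : ℝ≥0, ∀ u : 𝔼 → ℝ, ContDiff ℝ 1 u → HasCompactSupport u →
      ∫⁻ x in K, ‖u x‖ₑ / ENNReal.ofReal ‖(lineality K)ᗮ.starProjection x‖ ≤
        B * ∫⁻ x in K, ‖fderiv ℝ u x‖ₑ := by
  have hint : ∫⁻ s in Iic (0 : ℝ), ENNReal.ofReal (1 + s ^ 2)⁻¹ ≠ ⊤ := by
    refine ((lintegral_mono' Measure.restrict_le_self le_rfl).trans_lt ?_).ne
    exact (integrable_inv_one_add_sq.lintegral_lt_top)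
  refine ⟨(∫⁻ s in Iic (0 : ℝ), ENNReal.ofReal (1 + s ^ 2)⁻¹).toNNReal, fun u hu huc => ?_⟩
  rw [ENNReal.coe_toNNReal hint]
  have hdu : Continuous (fderiv ℝ u) := hu.continuous_fderiv one_ne_zero
  set L := lineality K with hL
  set P := Lᗮ.starProjection with hP
  -- Write u(x) as an integral along the ray x - s P x, s ≤ 0, which runs away from L inside K; its
  -- speed |P x| cancels the Hardy weight.
  calc ∫⁻ x in K, ‖u x‖ₑ / ENNReal.ofReal ‖P x‖
      ≤ ∫⁻ x in K, ∫⁻ s in Iic (0 : ℝ), ‖fderiv ℝ u (orthStretch L s x)‖ₑ := by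
        refine setLIntegral_mono' hKo.measurableSet fun x hx => ?_
        have hPx : P x ≠ 0 := fun h => notMem_of_mem_lineality hK.zero_notMem
          ((orthogonal_starProjection_eq_zero_iff L x).1 h) hx
        have h0 : ‖P x‖ₑ ≠ 0 := enorm_ne_zero.2 hPx
        rw [ofReal_norm, ENNReal.div_le_iff h0 enorm_ne_top]
        refine (enorm_le_lintegral_line hu huc x (neg_ne_zero.2 hPx)).trans_eq ?_
        rw [enorm_neg, lintegral_mul_const' _ _ enorm_ne_top]
        simp only [orthStretch_apply, smul_neg, sub_eq_add_neg, hP]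
    _ = ∫⁻ s in Iic (0 : ℝ), ∫⁻ x in K, ‖fderiv ℝ u (orthStretch L s x)‖ₑ := by
        rw [lintegral_lintegral_swap]
        refine Measurable.aemeasurable ?_
        have h1 : Continuous fun p : 𝔼 × ℝ => p.1 - p.2 • P p.1 := by fun_prop
        exact (hdu.comp h1).enorm.measurable
    _ ≤ ∫⁻ s in Iic (0 : ℝ), ENNReal.ofReal (1 + s ^ 2)⁻¹ * ∫⁻ x in K, ‖fderiv ℝ u x‖ₑ :=
        setLIntegral_mono' measurableSet_Iic fun s hs =>
          lintegral_comp_orthStretch_le hKo hK hn hs hdu.enorm.measurable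
    _ = _ := lintegral_mul_const _ (by fun_prop)

/-- Off the hyperplane L, membership in K depends only on the sign of ⟨e, x⟩, so K is one or both of
the open half-spaces bounded by L. -/
theorem frontier_subset_of_finrank_eq_one {K : Set 𝔼} (hKo : IsOpen K) (hK : IsCone K)
    {e : 𝔼} (he : e ∈ (lineality K)ᗮ) (h1 : Module.finrank ℝ (lineality K)ᗮ = 1)
    (heK : e ∈ K) :
    frontier K ⊆ lineality K := by
  set L := lineality K with hL
  have he0 : e ≠ 0 := fun h => hK.zero_notMem (h ▸ heK)
  have hspan : ∀ x, ∃ c : ℝ, c • e = Lᗮ.starProjection x := fun x => by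
    obtain ⟨c, hc⟩ := exists_smul_eq_of_finrank_eq_one h1 (x := (⟨e, he⟩ : Lᗮ))
      (by simpa using he0) ⟨Lᗮ.starProjection x, Lᗮ.starProjection_apply_mem x⟩
    exact ⟨c, congrArg Subtype.val hc⟩
  have hee : 0 < inner ℝ e e := real_inner_self_pos.2 he0
  have hinner : ∀ x (c : ℝ), c • e = Lᗮ.starProjection x → inner ℝ e x = c * inner ℝ e e := by
    intro x c hc
    have h2 : inner ℝ e (x - Lᗮ.starProjection x) = 0 :=
      (Submodule.mem_orthogonal' _ _).1 he _ (sub_orthogonal_starProjection_mem L x)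
    rw [inner_sub_right, sub_eq_zero] at h2
    rw [h2, ← hc, inner_smul_right]
  have hpos : ∀ x, 0 < inner ℝ e x → x ∈ K := fun x hx => by
    obtain ⟨c, hc⟩ := hspan x
    rw [hinner x c hc] at hx
    rw [← IsCone.starProjection_mem_iff, ← hL, ← hc, hK.smul_mem_iff (pos_of_mul_pos_left hx hee.le)]
    exact heK
  intro x hx
  by_contra hxL
  obtain ⟨c, hc⟩ := hspan x
  have hc0 : c ≠ 0 := by
    rintro rfl
    rw [zero_smul] at hc
    exact hxL ((orthogonal_starProjection_eq_zero_iff L x).1 hc.symm)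
  rw [hKo.frontier_eq] at hx
  rcases lt_or_gt_of_ne hc0 with hneg | hp
  · -- on the negative side `K` is a half-space or empty
    have hev : ∀ y, inner ℝ e y < 0 → (y ∈ K ↔ -e ∈ K) := fun y hy => by
      obtain ⟨b, hb⟩ := hspan y
      rw [hinner y b hb] at hy
      have hb0 : b < 0 := by
        by_contra hh
        exact absurd hy (not_lt.2 (mul_nonneg (not_lt.1 hh) hee.le))
      rw [← IsCone.starProjection_mem_iff, ← hL, ← hb, ← neg_smul_neg,
        hK.smul_mem_iff (neg_pos.2 hb0)]
    have hxn : inner ℝ e x < 0 := by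
      rw [hinner x c hc]
      exact mul_neg_of_neg_of_pos hneg hee
    obtain ⟨y, hyn, hyK⟩ := mem_closure_iff.1 hx.1 {y | inner ℝ e y < 0}
      (isOpen_lt (by fun_prop) continuous_const) hxn
    exact hx.2 ((hev x hxn).2 ((hev y hyn).1 hyK))
  · exact hx.2 (hpos x (by rw [hinner x c hc]; exact mul_pos hp hee))

/-! ### The trace inequality on a cone -/

/-- The trace inequality for a cone whose lineality space is a hyperplane. -/
theorem lintegral_surface_le_of_finrank_eq_one (hm : 1 ≤ m) {K : Set 𝔼} (hKo : IsOpen K)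
    (hK : IsCone K) (hne : K.Nonempty) (h1 : Module.finrank ℝ (lineality K)ᗮ = 1) {u : 𝔼 → ℝ}
    (hu : ContDiff ℝ 1 u) (huc : HasCompactSupport u) :
    ∫⁻ x, ‖u x‖ₑ ∂surfaceMeasure K ≤ ∫⁻ x in K, ‖fderiv ℝ u x‖ₑ := by
  set L := lineality K with hL
  obtain ⟨e, he, heK, he1⟩ : ∃ e : 𝔼, e ∈ Lᗮ ∧ e ∈ K ∧ ‖e‖ = 1 := by
    obtain ⟨x, hx⟩ := hne
    have hxK : Lᗮ.starProjection x ∈ K := IsCone.starProjection_mem_iff.2 hx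
    have hx0 : Lᗮ.starProjection x ≠ 0 := fun h => hK.zero_notMem (h ▸ hxK)
    refine ⟨‖Lᗮ.starProjection x‖⁻¹ • Lᗮ.starProjection x,
      Lᗮ.smul_mem _ (Lᗮ.starProjection_apply_mem x), ?_, norm_smul_inv_norm hx0⟩
    rw [hK.smul_mem_iff (inv_pos.2 (norm_pos_iff.2 hx0))]
    exact hxK
  have hdim : Module.finrank ℝ L = m - 1 := by
    have := L.finrank_add_finrank_orthogonal
    rw [finrank_euclideanSpace_fin] at this
    omega
  have hdu : Continuous (fderiv ℝ u) := hu.continuous_fderiv one_ne_zero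
  have hsurf : ∫⁻ x, ‖u x‖ₑ ∂surfaceMeasure K ≤ ∫⁻ l : L, ‖u l‖ₑ := by
    calc ∫⁻ x, ‖u x‖ₑ ∂surfaceMeasure K
        ≤ ∫⁻ x in (L : Set 𝔼), ‖u x‖ₑ ∂μHE[m - 1] :=
          lintegral_mono_set (frontier_subset_of_finrank_eq_one hKo hK he h1 heK)
      _ = ∫⁻ x, ‖u x‖ₑ ∂((μHE[m - 1] : Measure L).map Subtype.val) := by
          have hiso : Isometry (Subtype.val : L → 𝔼) := isometry_subtype_coe
          have hr : range (Subtype.val : L → 𝔼) = L := Subtype.range_coe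
          rw [hiso.map_euclideanHausdorffMeasure, hr]
      _ = ∫⁻ l : L, ‖u l‖ₑ ∂μHE[m - 1] :=
          lintegral_map hu.continuous.enorm.measurable measurable_subtype_coe
      _ = ∫⁻ l : L, ‖u l‖ₑ := by
          rw [← hdim, InnerProductSpace.euclideanHausdorffMeasure_eq_volume]
  have hv : (⟨-e, Lᗮ.neg_mem he⟩ : Lᗮ) ≠ 0 := by
    simp only [ne_eq, Submodule.mk_eq_zero, neg_eq_zero]
    rintro rfl
    simp at he1
  set G : 𝔼 → ℝ≥0∞ := K.indicator fun x => ‖fderiv ℝ u x‖ₑ with hG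
  have hGm : Measurable G := hdu.enorm.measurable.indicator hKo.measurableSet
  -- Fubini on L × Lᗮ, the line Lᗮ being parametrised by the unit vector -e so that s < 0 lies on
  -- the side of K containing e.
  have hfub : ∫⁻ x in K, ‖fderiv ℝ u x‖ₑ = ∫⁻ l : L, ∫⁻ s : ℝ, G (l + s • (-e)) := by
    have hmp := (L.measurePreserving_measurableEquivProd (0 : 𝔼)).symm
    rw [finrank_euclideanSpace_fin, euclideanHausdorffMeasure_eq_volume] at hmp
    rw [← lintegral_indicator hKo.measurableSet, ← hmp.lintegral_comp hGm,
      Measure.volume_eq_prod, lintegral_prod _ (by fun_prop)]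
    refine lintegral_congr fun l => ?_
    simp only [Submodule.measurableEquivProd_symm_apply, vadd_eq_add, add_zero]
    have hm2 : Measurable fun w : Lᗮ => G (l + w) := hGm.comp (by fun_prop)
    rw [volume_eq_of_finrank_eq_one h1 hv, lintegral_smul_measure, lintegral_map hm2 (by fun_prop)]
    have : ‖(⟨-e, Lᗮ.neg_mem he⟩ : Lᗮ)‖ₑ = 1 := by
      rw [← ofReal_norm]
      simp [he1]
    rw [this, one_smul]
    rfl
  rw [hfub]
  refine hsurf.trans (lintegral_mono fun l => ?_)
  have hne : -e ≠ 0 := by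
    intro h
    exact hv (by ext1; exact h)
  -- The endpoint s = 0 lies on L, outside K, and is dropped as a null set.
  calc ‖u l‖ₑ ≤ ∫⁻ s in Iic (0 : ℝ), ‖fderiv ℝ u (l + s • (-e))‖ₑ * ‖-e‖ₑ :=
        enorm_le_lintegral_line hu huc l hne
    _ = ∫⁻ s in Iio (0 : ℝ), ‖fderiv ℝ u (l + s • (-e))‖ₑ := by
        rw [← ofReal_norm (-e), norm_neg, he1]
        simp only [ENNReal.ofReal_one, mul_one]
        exact setLIntegral_congr Iio_ae_eq_Iic.symm
    _ ≤ ∫⁻ s in Iio (0 : ℝ), G (l + s • (-e)) := by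
        refine setLIntegral_mono' measurableSet_Iio fun s hs => ?_
        have hmem : (l : 𝔼) + s • (-e) ∈ K := by
          rw [smul_neg, ← neg_smul, hK.affine_mem_iff l.2 (neg_pos.2 hs)]
          exact heK
        rw [hG, indicator_of_mem hmem]
    _ ≤ _ := setLIntegral_le_lintegral _ _

theorem euclideanHausdorffMeasure_submodule_eq_zero (L : Submodule ℝ 𝔼) {d : ℕ}
    (hd : Module.finrank ℝ L < d) : μHE[d] (L : Set 𝔼) = 0 := by
  have hdim : dimH (L : Set 𝔼) < (d : ℝ≥0) := by
    have h1 : dimH (range (Subtype.val : L → 𝔼)) ≤ dimH (univ : Set L) :=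
      LipschitzWith.dimH_range_le (LipschitzWith.subtype_val (L : Set 𝔼))
    rw [Subtype.range_coe, Real.dimH_univ_eq_finrank] at h1
    refine h1.trans_lt ?_
    exact_mod_cast hd
  have := hausdorffMeasure_of_dimH_lt hdim
  rw [Measure.euclideanHausdorffMeasure_def, Measure.smul_apply]
  simp only [NNReal.coe_natCast] at this
  rw [this, smul_zero]

theorem hasTraceBoundAt_of_notMem_frontier {U : Set 𝔼} {z : 𝔼} (hz : z ∉ frontier U) :
    HasTraceBoundAt U z := by
  obtain ⟨ρ, hρ, hb⟩ := Metric.isOpen_iff.1 isClosed_frontier.isOpen_compl z hz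
  refine ⟨ρ, hρ, 0, fun u _ _ hus => ?_⟩
  rw [surfaceMeasure, setLIntegral_eq_zero measurableSet_frontier]
  · exact zero_le
  · intro x hx
    have : u x = 0 := image_eq_zero_of_notMem_tsupport fun hh => hb (hus hh) hx
    simp [this]

/-- A bound on B(z, ρ) restricts to B(y, ρ/2) for all y within ρ/2 of z, so finitely many points
suffice. -/
theorem exists_uniform_traceBound {U : Set 𝔼} {S : Set 𝔼} (hS : IsCompact S)
    (h : ∀ z ∈ S, HasTraceBoundAt U z) : ∃ ρ > 0, ∃ A, ∀ z ∈ S, TraceBound U z ρ A := by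
  refine hS.induction_on (p := fun S => ∃ ρ > 0, ∃ A, ∀ z ∈ S, TraceBound U z ρ A)
    ⟨1, one_pos, 0, by simp⟩ ?_ ?_ ?_
  · rintro s t hst ⟨ρ, hρ, A, hA⟩
    exact ⟨ρ, hρ, A, fun z hz => hA z (hst hz)⟩
  · rintro s t ⟨ρ, hρ, A, hA⟩ ⟨ρ', hρ', A', hA'⟩
    refine ⟨min ρ ρ', lt_min hρ hρ', max A A', ?_⟩
    rintro z (hz | hz)
    · exact (hA z hz).mono (Metric.ball_subset_ball (min_le_left _ _)) (le_max_left _ _)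
    · exact (hA' z hz).mono (Metric.ball_subset_ball (min_le_right _ _)) (le_max_right _ _)
  · intro z hz
    obtain ⟨ρ, hρ, A, hA⟩ := h z hz
    refine ⟨Metric.ball z (ρ / 2), mem_nhdsWithin_of_mem_nhds (Metric.ball_mem_nhds _ (by positivity)),
      ρ / 2, by positivity, A, fun y hy => hA.mono ?_ le_rfl⟩
    refine Metric.ball_subset_ball' ?_
    rw [Metric.mem_ball] at hy
    linarith

/-- If the trace inequality holds near all points of a cone off its lineality space, then it holds
globally, hence near the vertex. -/
theorem IsCone.exists_trace_inequality (hm : 1 ≤ m) {K : Set 𝔼} (hKo : IsOpen K) (hK : IsCone K)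
    (hne : K.Nonempty) (h : ∀ z ∈ frontier K, z ∉ lineality K → HasTraceBoundAt K z) :
    ∃ A : ℝ≥0, ∀ u : 𝔼 → ℝ, ContDiff ℝ 1 u → HasCompactSupport u →
      ∫⁻ x, ‖u x‖ₑ ∂surfaceMeasure K ≤ A * ∫⁻ x in K, ‖fderiv ℝ u x‖ₑ := by
  set L := lineality K with hL
  set P := Lᗮ.starProjection with hP
  have hfin : Module.finrank ℝ L + Module.finrank ℝ Lᗮ = m := by
    simpa using L.finrank_add_finrank_orthogonal
  -- If L were the whole space, every point of K would be a direction of invariance, forcing 0 into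
  -- K.
  have hn0 : Module.finrank ℝ Lᗮ ≠ 0 := fun h0 => by
    obtain ⟨x, hx⟩ := hne
    refine notMem_of_mem_lineality hK.zero_notMem (w := x) ?_ hx
    rw [← orthogonal_starProjection_eq_zero_iff]
    have hbot : Lᗮ = ⊥ := Submodule.finrank_eq_zero.1 h0
    have hall : ∀ y ∈ Lᗮ, y = 0 := by
      rw [hbot]
      simp
    exact hall _ (Lᗮ.starProjection_apply_mem x)
  rcases Nat.lt_or_ge (Module.finrank ℝ Lᗮ) 2 with hlt | hn
  · have hone : Module.finrank ℝ Lᗮ = 1 := by omega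
    refine ⟨1, fun u hu huc => ?_⟩
    simpa using lintegral_surface_le_of_finrank_eq_one hm hKo hK hne hone hu huc
  have hgood : ∀ z, z ∉ L → HasTraceBoundAt K z := fun z hz => by
    by_cases hzf : z ∈ frontier K
    · exact h z hzf hz
    · exact hasTraceBoundAt_of_notMem_frontier hzf
  -- The maps x ↦ l + t x with l in L preserve K and carry this compact set onto the complement of
  -- L; uniform bounds here therefore give scale-invariant bounds with distance function |P z|.
  have hSc : IsCompact ((Lᗮ : Set 𝔼) ∩ Metric.sphere 0 1) :=
    (isCompact_sphere _ _).inter_left (Lᗮ.closed_of_finiteDimensional)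
  obtain ⟨ρ, hρ, A, hA⟩ := exists_uniform_traceBound (U := K) hSc fun z hz => hgood z fun hzL => by
    have hz0 : z = 0 := by
      have := Submodule.inner_right_of_mem_orthogonal hzL hz.1
      exact inner_self_eq_zero.1 this
    have := hz.2
    simp [hz0] at this
  have hd : LipschitzWith 1 fun x => ‖P x‖ := by
    refine LipschitzWith.of_dist_le_mul fun x y => ?_
    rw [NNReal.coe_one, one_mul, dist_eq_norm, dist_eq_norm]
    refine (abs_norm_sub_norm_le _ _).trans ?_
    rw [← map_sub]
    exact Lᗮ.norm_starProjection_apply_le _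
  have hT : ∀ z, 0 < ‖P z‖ → TraceBound K z (min ρ (1 / 4) * ‖P z‖) A := by
    intro z hz
    have hmem : ‖P z‖⁻¹ • P z ∈ (Lᗮ : Set 𝔼) ∩ Metric.sphere 0 1 := by
      refine ⟨Lᗮ.smul_mem _ (Lᗮ.starProjection_apply_mem z), ?_⟩
      rw [mem_sphere_zero_iff_norm]
      exact norm_smul_inv_norm (norm_pos_iff.1 hz)
    have h1 := (hA _ hmem).affine hm hKo (z - P z) hz fun x =>
      (hK.affine_mem_iff (sub_orthogonal_starProjection_mem L z) hz).symm
    rw [smul_smul, mul_inv_cancel₀ hz.ne', one_smul, sub_add_cancel] at h1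
    refine h1.mono (Metric.ball_subset_ball ?_) le_rfl
    rw [mul_comm]
    gcongr
    exact min_le_left _ _
  obtain ⟨B, hB⟩ := exists_lintegral_surface_le_of_whitney hm hd (fun z => norm_nonneg _)
    (lt_min hρ (by norm_num)) (min_le_right _ _) hT
  obtain ⟨C, hC⟩ := exists_hardy hKo hK hn
  refine ⟨B * (1 + C), fun u hu huc => ?_⟩
  have hdu : Continuous (fderiv ℝ u) := hu.continuous_fderiv one_ne_zero
  -- The Whitney sum sees only points off L; in codimension at least two, L has dimension below m -
  -- 1 and is null for surface measure.
  have hnull : ∀ᵐ x ∂surfaceMeasure K, x ∈ {x | 0 < ‖P x‖} := by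
    have h0 : surfaceMeasure K (L : Set 𝔼) = 0 := by
      refine le_antisymm ((Measure.restrict_le_self _).trans_eq ?_) zero_le
      exact euclideanHausdorffMeasure_submodule_eq_zero L (by omega)
    filter_upwards [measure_eq_zero_iff_ae_notMem.1 h0] with x hx
    exact norm_pos_iff.2 fun hh => hx ((orthogonal_starProjection_eq_zero_iff L x).1 hh)
  calc ∫⁻ x, ‖u x‖ₑ ∂surfaceMeasure K
      = ∫⁻ x in {x | 0 < ‖P x‖}, ‖u x‖ₑ ∂surfaceMeasure K := by
        rw [Measure.restrict_eq_self_of_ae_mem hnull]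
    _ ≤ B * ∫⁻ x in K, (‖fderiv ℝ u x‖ₑ + ‖u x‖ₑ / ENNReal.ofReal ‖P x‖) := hB u hu huc
    _ ≤ B * ((∫⁻ x in K, ‖fderiv ℝ u x‖ₑ) + C * ∫⁻ x in K, ‖fderiv ℝ u x‖ₑ) := by
        rw [lintegral_add_left (by fun_prop)]
        gcongr
        exact hC u hu huc
    _ = _ := by push_cast; ring

/-! ### Model cones and growth of the lineality space -/

/-- Dilations carry any point of K close to the vertex, so openness near the vertex spreads to the
whole cone. -/
theorem IsCone.isOpen_of_mem_nhds {K : Set 𝔼} (hK : IsCone K)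
    (h : ∀ᶠ x in 𝓝 (0 : 𝔼), x ∈ K → K ∈ 𝓝 x) : IsOpen K := by
  rw [isOpen_iff_mem_nhds]
  intro x hx
  have hc : Tendsto (fun t : ℝ => t • x) (𝓝[>] 0) (𝓝 0) := by
    have : Continuous fun t : ℝ => t • x := by fun_prop
    simpa using (this.tendsto 0).mono_left nhdsWithin_le_nhds
  obtain ⟨t, ht, ht0⟩ := ((hc.eventually h).and self_mem_nhdsWithin).exists
  have ht0 : 0 < t := ht0
  have h1 : K ∈ 𝓝 (t • x) := ht ((hK.smul_mem_iff ht0).2 hx)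
  have hc2 : Continuous fun z : 𝔼 => t • z := by fun_prop
  filter_upwards [hc2.continuousAt.preimage_mem_nhds h1] with z hz
  exact (hK.smul_mem_iff ht0).1 hz

theorem LocalDiffeo.mem_nhds {g : OpenPartialHomeomorph 𝔼 𝔼} {a : 𝔼} {U V : Set 𝔼}
    (h : LocalDiffeo g a U V) (hV : IsOpen V) (ha : a ∈ U) : U ∈ 𝓝 a := by
  have hc : Tendsto g (𝓝 a) (𝓝 (g a)) := g.continuousAt h.mem_source
  filter_upwards [h.mem_iff, hc (hV.mem_nhds (h.mem_iff.self_of_nhds.1 ha))] with x hx hx'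
  exact hx.2 hx'

theorem IsModelCone.exists_localDiffeo {Ω K : Set 𝔼} {y : 𝔼} (h : IsModelCone Ω y K) :
    ∃ f : OpenPartialHomeomorph 𝔼 𝔼, LocalDiffeo f 0 K Ω ∧ f 0 = y ∧
      fderiv ℝ f 0 = ContinuousLinearMap.id ℝ 𝔼 := by
  obtain ⟨-, r, hr, f, hs, hsm, hsm', himg, h0, hd⟩ := h
  have h0s : (0 : 𝔼) ∈ f.source := hs (Metric.mem_ball_self hr)
  refine ⟨f, ⟨h0s, hsm, hsm', ?_⟩, h0, hd.fderiv⟩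
  have hc : Tendsto f (𝓝 0) (𝓝 y) := by
    have := f.continuousAt h0s
    rwa [ContinuousAt, h0] at this
  filter_upwards [Metric.ball_mem_nhds (0 : 𝔼) hr, hc (Metric.ball_mem_nhds y hr)] with x hx hfx
  constructor
  · intro hxK
    have : f x ∈ f '' (K ∩ Metric.ball 0 r) := ⟨x, ⟨hxK, hx⟩, rfl⟩
    rw [himg] at this
    exact this.1
  · intro hfΩ
    have : f x ∈ Ω ∩ Metric.ball y r := ⟨hfΩ, hfx⟩
    rw [← himg] at this
    obtain ⟨x', ⟨hx'K, hx'⟩, he⟩ := this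
    rwa [← f.injOn (hs hx') (hs hx) he]

theorem IsModelCone.isOpen {Ω K : Set 𝔼} {y : 𝔼} (h : IsModelCone Ω y K) (hΩ : IsOpen Ω) :
    IsOpen K := by
  obtain ⟨f, hf, -, -⟩ := h.exists_localDiffeo
  refine h.1.isOpen_of_mem_nhds ?_
  filter_upwards [hf.at_nhds] with x hx hxK using hx.mem_nhds hΩ hxK

theorem IsModelCone.nonempty {Ω K : Set 𝔼} {y : 𝔼} (h : IsModelCone Ω y K)
    (hy : y ∈ frontier Ω) : K.Nonempty := by
  obtain ⟨f, hf, h0, -⟩ := h.exists_localDiffeo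
  rw [← h0, ← hf.mem_frontier_iff] at hy
  rw [nonempty_iff_ne_empty]
  rintro rfl
  simp at hy

/-- If a cone `K'` is locally diffeomorphic to a cone `K` near a point `p`, then the directions of
`lineality K` and the direction of `p` correspond to directions of invariance of `K'`. -/
theorem LocalDiffeo.mem_lineality {g : OpenPartialHomeomorph 𝔼 𝔼} {K K' : Set 𝔼}
    (h : LocalDiffeo g 0 K' K) (hK : IsCone K) (hK' : IsCone K') (hKo' : IsOpen K') {w a : 𝔼}
    (hw : w ∈ lineality K) {c : ℝ} (ha : fderiv ℝ g 0 a = w + c • g 0) : a ∈ lineality K' := by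
  intro s z hz
  set p := g 0 with hp
  -- The point g(t(z + s a)) is moved by a dilation and a translation that preserve K, chosen so
  -- that r(0) = p and r'(0) = Dg(0)z. Then g⁻¹(r(t))/t → z in the open cone K', so r(t), hence
  -- g(t(z + s a)), lies in K for some small t > 0, and z + s a lies in K'.
  set r : ℝ → 𝔼 := fun t => (1 + t * (s * c))⁻¹ • (g (t • (z + s • a)) - t • s • w) with hr
  have hr0 : r 0 = p := by simp [hr, hp]
  have hg : HasDerivAt (fun t : ℝ => g (t • (z + s • a))) (fderiv ℝ g 0 (z + s • a)) 0 := by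
    have h1 : HasDerivAt (fun t : ℝ => t • (z + s • a)) (z + s • a) 0 := by
      simpa using (hasDerivAt_id (0 : ℝ)).smul_const (z + s • a)
    have h2 : HasFDerivAt g (fderiv ℝ g 0) ((0 : ℝ) • (z + s • a)) := by
      rw [zero_smul]
      exact h.differentiableAt.hasFDerivAt
    exact h2.comp_hasDerivAt 0 h1
  have hrd : HasDerivAt r (fderiv ℝ g 0 z) 0 := by
    have h1 : HasDerivAt (fun t : ℝ => t • s • w) (s • w) 0 := by
      simpa using (hasDerivAt_id (0 : ℝ)).smul_const (s • w)
    have h2 : HasDerivAt (fun t : ℝ => (1 + t * (s * c))⁻¹) (-(s * c)) 0 := by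
      have := (((hasDerivAt_id (0 : ℝ)).mul_const (s * c)).const_add 1).fun_inv (by simp)
      simpa using this
    convert! h2.fun_smul (hg.fun_sub h1) using 1
    simp only [zero_smul, zero_mul, add_zero, inv_one, one_smul, sub_zero, map_add, map_smul, ha,
      smul_add, smul_smul, ← hp, neg_smul]
    abel
  set q : ℝ → 𝔼 := fun t => g.symm (r t) with hq
  have hq0 : q 0 = 0 := by
    rw [hq]
    simp only [hr0]
    exact g.left_inv h.mem_source
  have hqd : HasDerivAt q z 0 := by
    have h2 : HasFDerivAt g.symm (fderiv ℝ g.symm p) (r 0) := by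
      rw [hr0]
      exact h.symm.differentiableAt.hasFDerivAt
    have h3 := h2.comp_hasDerivAt 0 hrd
    have h4 : fderiv ℝ g.symm p (fderiv ℝ g 0 z) = z :=
      congrArg (fun T : 𝔼 →L[ℝ] 𝔼 => T z) h.symm_fderiv_comp
    rwa [h4] at h3
  have hqlim : Tendsto (fun t => t⁻¹ • q t) (𝓝[>] 0) (𝓝 z) := by
    have := (hasDerivAt_iff_tendsto_slope_zero.1 hqd).mono_left
      (nhdsWithin_mono (0 : ℝ) (s := Ioi 0) (t := {0}ᶜ) fun t ht => (mem_Ioi.1 ht).ne')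
    simpa [hq0] using this
  have hrc : Tendsto r (𝓝[>] 0) (𝓝 p) := by
    have := hrd.continuousAt.tendsto
    rw [hr0] at this
    exact this.mono_left nhdsWithin_le_nhds
  have hline : Tendsto (fun t : ℝ => t • (z + s • a)) (𝓝[>] 0) (𝓝 0) := by
    have : Continuous fun t : ℝ => t • (z + s • a) := by fun_prop
    simpa using (this.tendsto 0).mono_left nhdsWithin_le_nhds
  have hpos : ∀ᶠ t : ℝ in 𝓝[>] 0, 0 < 1 + t * (s * c) := by
    have : Continuous fun t : ℝ => 1 + t * (s * c) := by fun_prop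
    exact nhdsWithin_le_nhds (this.continuousAt.eventually_const_lt (by simp))
  obtain ⟨t, ht0, hqK, hrK, hgK, htp⟩ := (eventually_mem_nhdsWithin.and
    ((hqlim.eventually (hKo'.mem_nhds hz)).and ((hrc.eventually h.symm.mem_iff).and
      ((hline.eventually h.mem_iff).and hpos)))).exists
  have ht0 : 0 < t := ht0
  have h1 : q t ∈ K' := (hK'.smul_mem_iff (inv_pos.2 ht0)).1 hqK
  have h2 : r t ∈ K := hrK.2 h1
  have h3 : g (t • (z + s • a)) = (t * s) • w + (1 + t * (s * c)) • r t := by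
    simp only [hr]
    rw [smul_smul, mul_inv_cancel₀ htp.ne', one_smul, smul_smul]
    abel
  have h4 : g (t • (z + s • a)) ∈ K := by
    rw [h3]
    exact (hK.affine_mem_iff ((lineality K).smul_mem _ hw) htp).2 h2
  exact (hK'.smul_mem_iff ht0).1 (hgK.2 h4)

/-- The injective derivative of g⁻¹ at p = g 0 maps lineality K ⊕ ℝp into lineality K', and p adds a
dimension because it is off lineality K. This drives the induction. -/
theorem LocalDiffeo.finrank_lineality_lt {g : OpenPartialHomeomorph 𝔼 𝔼} {K K' : Set 𝔼}
    (h : LocalDiffeo g 0 K' K) (hK : IsCone K) (hK' : IsCone K') (hKo' : IsOpen K')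
    (hp : g 0 ∉ lineality K) :
    Module.finrank ℝ (lineality K) < Module.finrank ℝ (lineality K') := by
  set L := lineality K with hL
  have hinj : Function.Injective (fderiv ℝ g.symm (g 0) : 𝔼 →ₗ[ℝ] 𝔼) := by
    refine Function.LeftInverse.injective (g := fderiv ℝ g 0) fun x => ?_
    exact congrArg (fun T : 𝔼 →L[ℝ] 𝔼 => T x) h.fderiv_comp_symm
  have hlt : L < L ⊔ Submodule.span ℝ {g 0} := by
    refine lt_of_le_of_ne le_sup_left fun he => hp ?_
    rw [he]
    exact Submodule.mem_sup_right (Submodule.mem_span_singleton_self _)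
  have hle : (L ⊔ Submodule.span ℝ {g 0}).map (fderiv ℝ g.symm (g 0) : 𝔼 →ₗ[ℝ] 𝔼) ≤
      lineality K' := by
    rintro _ ⟨x, hx, rfl⟩
    obtain ⟨w, hw, v, hv, rfl⟩ := Submodule.mem_sup.1 hx
    obtain ⟨c, rfl⟩ := Submodule.mem_span_singleton.1 hv
    exact h.mem_lineality hK hK' hKo' hw
      (congrArg (fun T : 𝔼 →L[ℝ] 𝔼 => T (w + c • g 0)) h.fderiv_comp_symm)
  calc Module.finrank ℝ L < Module.finrank ℝ ↥(L ⊔ Submodule.span ℝ {g 0}) :=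
        Submodule.finrank_lt_finrank_of_lt hlt
    _ = Module.finrank ℝ ((L ⊔ Submodule.span ℝ {g 0}).map
          (fderiv ℝ g.symm (g 0) : 𝔼 →ₗ[ℝ] 𝔼)) :=
        (Submodule.equivMapOfInjective _ hinj _).finrank_eq
    _ ≤ _ := Submodule.finrank_mono hle

/-! ### The trace inequality for model cones and for the domain -/

/-- The trace inequality `∫_∂U |u| ≤ B ∫_U (|∇u| + |u|)`. -/
def HasTraceInequality (U : Set 𝔼) : Prop :=
  ∃ B : ℝ≥0, ∀ u : 𝔼 → ℝ, ContDiff ℝ 1 u → HasCompactSupport u →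
    ∫⁻ x, ‖u x‖ₑ ∂surfaceMeasure U ≤ B * ∫⁻ x in U, (‖fderiv ℝ u x‖ₑ + ‖u x‖ₑ)

theorem HasTraceInequality.isFiniteMeasureOnCompacts {U : Set 𝔼} (h : HasTraceInequality U) :
    IsFiniteMeasureOnCompacts (surfaceMeasure U) := by
  obtain ⟨B, hB⟩ := h
  refine ⟨fun S hS => ?_⟩
  obtain ⟨R, hR0, hR⟩ := hS.isBounded.subset_closedBall_lt 0 (0 : 𝔼)
  let η : ContDiffBump (0 : 𝔼) := ⟨R, R + 1, hR0, by linarith⟩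
  have hη : ContDiff ℝ 1 η := η.contDiff
  have h1 := hB η hη η.hasCompactSupport
  have h2 : ∫⁻ x in U, (‖fderiv ℝ η x‖ₑ + ‖η x‖ₑ) < ⊤ := by
    rw [lintegral_add_right _ hη.continuous.enorm.measurable]
    refine ENNReal.add_lt_top.2 ⟨?_, ?_⟩
    · exact (lintegral_mono' Measure.restrict_le_self le_rfl).trans_lt
        (lintegral_enorm_lt_top (hη.continuous_fderiv one_ne_zero)
          (η.hasCompactSupport.fderiv ℝ) volume)
    · exact (lintegral_mono' Measure.restrict_le_self le_rfl).trans_lt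
        (lintegral_enorm_lt_top hη.continuous η.hasCompactSupport volume)
  calc surfaceMeasure U S
      = ∫⁻ x in S, 1 ∂surfaceMeasure U := by simp
    _ ≤ ∫⁻ x in S, ‖η x‖ₑ ∂surfaceMeasure U := by
        refine setLIntegral_mono' hS.measurableSet fun x hx => ?_
        rw [η.one_of_mem_closedBall (hR hx)]
        simp
    _ ≤ ∫⁻ x, ‖η x‖ₑ ∂surfaceMeasure U := setLIntegral_le_lintegral _ _
    _ < ⊤ := h1.trans_lt (ENNReal.mul_lt_top ENNReal.coe_lt_top h2)

section PiecewiseSmooth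

variable {Ω : Set 𝔼} {K : 𝔼 → Set 𝔼}

/-- Strong induction on the codimension of the lineality space. A boundary point z off it, scaled
close to the vertex, corresponds under the chart to some y' in ∂Ω; composing charts identifies K y'
near 0 with K y near t z, and K y' has larger lineality. -/
theorem exists_trace_inequality_modelCone (hm : 1 ≤ m) (hΩ : IsOpen Ω)
    (hK : ∀ y ∈ frontier Ω, IsModelCone Ω y (K y)) {y : 𝔼} (hy : y ∈ frontier Ω) :
    ∃ A : ℝ≥0, ∀ u : 𝔼 → ℝ, ContDiff ℝ 1 u → HasCompactSupport u →
      ∫⁻ x, ‖u x‖ₑ ∂surfaceMeasure (K y) ≤ A * ∫⁻ x in K y, ‖fderiv ℝ u x‖ₑ := by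
  have hbound : ∀ y, Module.finrank ℝ (lineality (K y)) ≤ m := fun y => by
    simpa using (lineality (K y)).finrank_le
  induction hn : m - Module.finrank ℝ (lineality (K y)) using Nat.strong_induction_on
    generalizing y with
  | _ n ih =>
  have hKo := (hK y hy).isOpen hΩ
  have hKc := (hK y hy).1
  obtain ⟨f, hf, hf0, -⟩ := (hK y hy).exists_localDiffeo
  refine hKc.exists_trace_inequality hm hKo ((hK y hy).nonempty hy) fun z hz hzL => ?_
  have hc : Tendsto (fun t : ℝ => t • z) (𝓝[>] 0) (𝓝 0) := by
    have : Continuous fun t : ℝ => t • z := by fun_prop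
    simpa using (this.tendsto 0).mono_left nhdsWithin_le_nhds
  obtain ⟨t, hft, ht⟩ := ((hc.eventually hf.at_nhds).and self_mem_nhdsWithin).exists
  have ht : 0 < t := ht
  have hcone : ∀ s : ℝ, 0 < s → ∀ x, x ∈ K y ↔ 0 + s • x ∈ K y := fun s hs x => by
    rw [zero_add, hKc.smul_mem_iff hs]
  have htz : t • z ∈ frontier (K y) := by
    lift t to ℝ≥0 using ht.le
    simpa using (biLipOn_affineHomeo 0 ht.ne' (hcone t ht)).mem_frontier (mem_univ z) hz
  set y' := f (t • z) with hy'
  have hy'Γ : y' ∈ frontier Ω := hft.mem_frontier_iff.1 htz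
  obtain ⟨f', hf', hf'0, -⟩ := (hK y' hy'Γ).exists_localDiffeo
  have hback : LocalDiffeo f.symm (f' 0) Ω (K y) := by
    rw [hf'0]
    exact hft.symm
  have hg := hf'.trans hback
  have hg0 : (f'.trans f.symm) 0 = t • z := by
    change f.symm (f' 0) = _
    rw [hf'0]
    exact f.left_inv hft.mem_source
  have hrank := hg.finrank_lineality_lt hKc (hK y' hy'Γ).1 ((hK y' hy'Γ).isOpen hΩ) (by
    rw [hg0]
    intro hh
    apply hzL
    simpa [smul_smul, inv_mul_cancel₀ ht.ne'] using (lineality (K y)).smul_mem t⁻¹ hh)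
  obtain ⟨A, hA⟩ := ih _ (by have := hbound y'; omega) hy'Γ rfl
  have h0 : HasTraceBoundAt (K y') 0 := ⟨1, one_pos, A, fun u hu huc _ => hA u hu huc⟩
  have h1 : HasTraceBoundAt (K y) (t • z) := hg0 ▸ hg.hasTraceBoundAt hKo h0
  obtain ⟨ρ, hρ, B, hB⟩ := h1
  -- The bound obtained at t z is dilated back to z.
  have h2 := hB.affine hm hKo 0 (inv_pos.2 ht) (hcone _ (inv_pos.2 ht))
  rw [smul_smul, inv_mul_cancel₀ ht.ne', one_smul, zero_add] at h2
  exact ⟨_, by positivity, B, h2⟩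

theorem hasTraceInequality_modelCone (hm : 1 ≤ m) (hΩ : IsOpen Ω)
    (hK : ∀ y ∈ frontier Ω, IsModelCone Ω y (K y)) {y : 𝔼} (hy : y ∈ frontier Ω) :
    HasTraceInequality (K y) := by
  obtain ⟨A, hA⟩ := exists_trace_inequality_modelCone hm hΩ hK hy
  refine ⟨A, fun u hu huc => (hA u hu huc).trans ?_⟩
  gcongr
  exact le_self_add

theorem hasTraceBoundAt_of_isModelCone (hm : 1 ≤ m) (hΩ : IsOpen Ω)
    (hK : ∀ y ∈ frontier Ω, IsModelCone Ω y (K y)) {y : 𝔼} (hy : y ∈ frontier Ω) :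
    HasTraceBoundAt Ω y := by
  obtain ⟨A, hA⟩ := exists_trace_inequality_modelCone hm hΩ hK hy
  obtain ⟨f, hf, hf0, -⟩ := (hK y hy).exists_localDiffeo
  exact hf0 ▸ hf.hasTraceBoundAt hΩ ⟨1, one_pos, A, fun u hu huc _ => hA u hu huc⟩

theorem hasTraceInequality_domain (hm : 1 ≤ m) (hΩ : IsOpen Ω) (hb : Bornology.IsBounded Ω)
    (hK : ∀ y ∈ frontier Ω, IsModelCone Ω y (K y)) : HasTraceInequality Ω := by
  have hΓ : IsCompact (frontier Ω) :=
    Metric.isCompact_of_isClosed_isBounded isClosed_frontier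
      (hb.closure.subset frontier_subset_closure)
  obtain ⟨ρ, hρ, A, hA⟩ := exists_uniform_traceBound hΓ fun y hy =>
    hasTraceBoundAt_of_isModelCone hm hΩ hK hy
  have hT : ∀ z : 𝔼, TraceBound Ω z (ρ / 2) A := by
    intro z u hu huc hus
    by_cases hz : ∃ y ∈ frontier Ω, y ∈ Metric.ball z (ρ / 2)
    · obtain ⟨y, hy, hyz⟩ := hz
      refine hA y hy u hu huc (hus.trans (Metric.ball_subset_ball' ?_))
      rw [Metric.mem_ball, dist_comm] at hyz
      linarith
    · push Not at hz
      rw [surfaceMeasure, setLIntegral_eq_zero measurableSet_frontier]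
      · exact zero_le
      · intro x hx
        have : u x = 0 := image_eq_zero_of_notMem_tsupport fun hh => hz x hx (hus hh)
        simp [this]
  -- With the constant distance function 1 the Whitney summation serves as a uniform partition of
  -- unity, and its error term is just ∫ |u|.
  have hd : LipschitzWith 1 fun _ : 𝔼 => (1 : ℝ) := LipschitzWith.const' 1
  obtain ⟨B, hB⟩ := exists_lintegral_surface_le_of_whitney (U := Ω) (A := A) hm hd
    (fun _ => zero_le_one) (ρ := min (ρ / 2) (1 / 4)) (lt_min (by positivity) (by norm_num))
    (min_le_right _ _) fun z _ => (hT z).mono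
      (Metric.ball_subset_ball (by rw [mul_one]; exact min_le_left _ _)) le_rfl
  exact ⟨B, fun u hu huc => by simpa using hB u hu huc⟩

end PiecewiseSmooth

/-! ### Lower bounds for the bottom as inequalities for test functions -/

theorem eLpNorm_two_sq {F : Type*} [NormedAddCommGroup F] (f : 𝔼 → F) (μ : Measure 𝔼) :
    eLpNorm f 2 μ ^ 2 = ∫⁻ x, ‖f x‖ₑ ^ 2 ∂μ := by
  have := eLpNorm_nnreal_pow_eq_lintegral (f := f) (μ := μ) (p := 2) two_ne_zero
  simp only [NNReal.coe_ofNat, ENNReal.coe_ofNat, ENNReal.rpow_ofNat] at this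
  exact this

theorem enorm_gradient (φ : 𝔼 → ℝ) (x : 𝔼) : ‖gradient φ x‖ₑ = ‖fderiv ℝ φ x‖ₑ := by
  rw [← ofReal_norm, ← ofReal_norm, gradient, LinearIsometryEquiv.norm_map]

theorem continuous_gradient {φ : 𝔼 → ℝ} (hφ : ContDiff ℝ ∞ φ) : Continuous (gradient φ) :=
  (InnerProductSpace.toDual ℝ 𝔼).symm.continuous.comp (hφ.continuous_fderiv (by simp))

theorem hasCompactSupport_gradient {φ : 𝔼 → ℝ} (hφ : HasCompactSupport φ) :
    HasCompactSupport (gradient φ) :=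
  (hφ.fderiv ℝ).comp_left (g := (InnerProductSpace.toDual ℝ 𝔼).symm) (map_zero _)

theorem integral_norm_sq_eq {F : Type*} [NormedAddCommGroup F] {f : 𝔼 → F} {μ : Measure 𝔼}
    (hf : AEStronglyMeasurable f μ) : ∫ x, ‖f x‖ ^ 2 ∂μ = (∫⁻ x, ‖f x‖ₑ ^ 2 ∂μ).toReal := by
  rw [integral_eq_lintegral_of_nonneg_ae (f := fun x => ‖f x‖ ^ 2)
    (Eventually.of_forall fun x => by positivity) (hf.norm.pow 2)]
  congr 1
  refine lintegral_congr fun x => ?_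
  rw [ENNReal.ofReal_pow (norm_nonneg _), ofReal_norm]

theorem tendsto_eLpNorm_of_tendsto_sub {F : Type*} [NormedAddCommGroup F] {f : ℕ → 𝔼 → F}
    {g : 𝔼 → F} {μ : Measure 𝔼} (hf : ∀ n, AEStronglyMeasurable (f n) μ)
    (hg : AEStronglyMeasurable g μ)
    (h : Tendsto (fun n => eLpNorm (fun x => f n x - g x) 2 μ) atTop (𝓝 0)) :
    Tendsto (fun n => eLpNorm (f n) 2 μ) atTop (𝓝 (eLpNorm g 2 μ)) := by
  have h1 : Tendsto (fun n => eLpNorm g 2 μ - eLpNorm (fun x => f n x - g x) 2 μ) atTop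
      (𝓝 (eLpNorm g 2 μ)) := by
    simpa using ENNReal.Tendsto.sub tendsto_const_nhds h (Or.inr ENNReal.zero_ne_top)
  have h2 : Tendsto (fun n => eLpNorm g 2 μ + eLpNorm (fun x => f n x - g x) 2 μ) atTop
      (𝓝 (eLpNorm g 2 μ)) := by
    simpa using tendsto_const_nhds.add h
  refine tendsto_of_tendsto_of_tendsto_of_le_of_le h1 h2 (fun n => ?_) (fun n => ?_)
  · refine tsub_le_iff_right.2 ?_
    have := eLpNorm_sub_le (hf n) ((hf n).sub hg) (p := 2) one_le_two
    rw [sub_sub_cancel] at this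
    exact this
  · have := eLpNorm_add_le hg ((hf n).sub hg) (p := 2) one_le_two
    rw [add_sub_cancel] at this
    exact this

/-- `γ ∫_∂U |φ|² ≤ ∫_U |∇φ|² + β ∫_U |φ|²` for all test functions. -/
def FormBound (U : Set 𝔼) (γ β : ℝ≥0) : Prop :=
  ∀ φ : 𝔼 → ℝ, ContDiff ℝ ∞ φ → HasCompactSupport φ →
    γ * ∫⁻ x, ‖φ x‖ₑ ^ 2 ∂surfaceMeasure U ≤
      (∫⁻ x in U, ‖fderiv ℝ φ x‖ₑ ^ 2) + β * ∫⁻ x in U, ‖φ x‖ₑ ^ 2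

/-- The approximating test functions in the definition of the trace converge in all three norms, so
the inequality passes to the limit. -/
theorem FormBound.le_bottom {U : Set 𝔼} {γ β : ℝ≥0} (h : FormBound U γ β) :
    ((-(β : ℝ) : ℝ) : EReal) ≤ bottom U γ := by
  refine le_sInf ?_
  rintro q ⟨v, G, g, hv, hg, hne, rfl⟩
  obtain ⟨φ, hφ, h1, h2, h3⟩ := hg.exists_approx
  set μ := volume.restrict U
  set σ := surfaceMeasure U
  have hc : ∀ n, Continuous (φ n) := fun n => (hφ n).1.continuous
  have h1' := tendsto_eLpNorm_of_tendsto_sub (fun n => (hc n).aestronglyMeasurable)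
    hv.memLp.aestronglyMeasurable h1
  have h2' := tendsto_eLpNorm_of_tendsto_sub
    (fun n => (continuous_gradient (hφ n).1).aestronglyMeasurable)
    hv.memLp_grad.aestronglyMeasurable h2
  have h3' := tendsto_eLpNorm_of_tendsto_sub (fun n => (hc n).aestronglyMeasurable)
    hg.memLp.aestronglyMeasurable h3
  have hlim : (γ : ℝ≥0∞) * eLpNorm g 2 σ ^ 2 ≤ eLpNorm G 2 μ ^ 2 + β * eLpNorm v 2 μ ^ 2 := by
    refine le_of_tendsto_of_tendsto'
      (ENNReal.Tendsto.const_mul (ENNReal.Tendsto.pow h3') (Or.inr ENNReal.coe_ne_top))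
      ((ENNReal.Tendsto.pow h2').add
        (ENNReal.Tendsto.const_mul (ENNReal.Tendsto.pow h1') (Or.inr ENNReal.coe_ne_top))) fun n => ?_
    simp_rw [eLpNorm_two_sq, enorm_gradient]
    exact h (φ n) (hφ n).1 (hφ n).2
  have hvN := integral_norm_sq_eq hv.memLp.aestronglyMeasurable
  have hgN := integral_norm_sq_eq hg.memLp.aestronglyMeasurable
  have hGN := integral_norm_sq_eq hv.memLp_grad.aestronglyMeasurable
  simp only [Real.norm_eq_abs, sq_abs] at hvN hgN
  have hvt : eLpNorm v 2 μ ^ 2 ≠ ⊤ := ENNReal.pow_ne_top hv.memLp.eLpNorm_ne_top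
  have hGt : eLpNorm G 2 μ ^ 2 ≠ ⊤ := ENNReal.pow_ne_top hv.memLp_grad.eLpNorm_ne_top
  have hpos : 0 < ∫ x in U, v x ^ 2 := by
    rw [hvN, ← eLpNorm_two_sq]
    refine ENNReal.toReal_pos ?_ hvt
    refine pow_ne_zero 2 fun h0 => hne ?_
    exact (eLpNorm_eq_zero_iff hv.memLp.aestronglyMeasurable two_ne_zero).1 h0
  rw [EReal.coe_le_coe_iff, rayleigh, le_div_iff₀ hpos, hvN, hgN, hGN]
  have hlim' := ENNReal.toReal_mono
    (ENNReal.add_ne_top.2 ⟨hGt, ENNReal.mul_ne_top ENNReal.coe_ne_top hvt⟩) hlim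
  rw [ENNReal.toReal_add hGt (ENNReal.mul_ne_top ENNReal.coe_ne_top hvt), ENNReal.toReal_mul,
    ENNReal.toReal_mul, ENNReal.coe_toReal, ENNReal.coe_toReal, eLpNorm_two_sq, eLpNorm_two_sq,
    eLpNorm_two_sq] at hlim'
  linarith

theorem integral_smul_gradient_eq_neg {φ χ : 𝔼 → ℝ} (hφ : ContDiff ℝ ∞ φ) (hχ : ContDiff ℝ ∞ χ)
    (hχc : HasCompactSupport χ) :
    ∫ x, φ x • gradient χ x = - ∫ x, χ x • gradient φ x := by
  have hi1 : Integrable fun x => φ x • gradient χ x :=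
    (hφ.continuous.smul (continuous_gradient hχ)).integrable_of_hasCompactSupport
      (hasCompactSupport_gradient hχc).smul_left
  have hi2 : Integrable fun x => χ x • gradient φ x :=
    (hχ.continuous.smul (continuous_gradient hφ)).integrable_of_hasCompactSupport
      hχc.smul_right
  have hgr : ∀ (ψ : 𝔼 → ℝ) (x w : 𝔼), inner ℝ w (gradient ψ x) = fderiv ℝ ψ x w := fun ψ x w => by
    rw [real_inner_comm, gradient, InnerProductSpace.toDual_symm_apply]
  refine ext_inner_left ℝ fun w => ?_
  rw [inner_neg_right, ← integral_inner hi1, ← integral_inner hi2]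
  simp only [inner_smul_right, hgr]
  have hdφ : Continuous fun x => fderiv ℝ φ x w := by
    have := hφ.continuous_fderiv (n := ∞) (by simp)
    fun_prop
  have hdχ : Continuous fun x => fderiv ℝ χ x w := by
    have := hχ.continuous_fderiv (n := ∞) (by simp)
    fun_prop
  rw [integral_mul_fderiv_eq_neg_fderiv_mul_of_integrable]
  · simp_rw [mul_comm]
  · exact (hdφ.mul hχ.continuous).integrable_of_hasCompactSupport hχc.mul_left
  · refine (hφ.continuous.mul hdχ).integrable_of_hasCompactSupport (HasCompactSupport.mul_left ?_)
    exact hχc.fderiv_apply ℝ w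
  · exact (hφ.continuous.mul hχ.continuous).integrable_of_hasCompactSupport hχc.mul_left
  · exact fun x _ => hφ.differentiable (by simp) x
  · exact fun x _ => hχ.differentiable (by simp) x

theorem memH1_of_contDiff (U : Set 𝔼) {φ : 𝔼 → ℝ} (hφ : ContDiff ℝ ∞ φ)
    (hφc : HasCompactSupport φ) : MemH1 U φ (gradient φ) where
  memLp := (hφ.continuous.memLp_of_hasCompactSupport hφc).restrict U
  memLp_grad := ((continuous_gradient hφ).memLp_of_hasCompactSupport
    (hasCompactSupport_gradient hφc)).restrict U
  isWeakGradient := by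
    intro χ hχ hχc hχs
    have h1 : ∀ x, x ∉ U → χ x = 0 := fun x hx =>
      image_eq_zero_of_notMem_tsupport fun hh => hx (hχs hh)
    have h2 : ∀ x, x ∉ U → gradient χ x = 0 := fun x hx => by
      have : fderiv ℝ χ x = 0 :=
        image_eq_zero_of_notMem_tsupport fun hh => hx (hχs (tsupport_fderiv_subset ℝ hh))
      rw [gradient, this, map_zero]
    rw [setIntegral_eq_integral_of_forall_compl_eq_zero fun x hx => by rw [h2 x hx, smul_zero],
      setIntegral_eq_integral_of_forall_compl_eq_zero fun x hx => by rw [h1 x hx, zero_smul]]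
    exact integral_smul_gradient_eq_neg hφ hχ hχc

/-- Only almost everywhere equality is asked, so that 0 can serve as the trace of a function
supported inside U with no finiteness assumption on the surface measure. -/
theorem isTrace_of_ae_eq (U : Set 𝔼) {φ g : 𝔼 → ℝ} (hφ : ContDiff ℝ ∞ φ)
    (hφc : HasCompactSupport φ) (hg : MemLp g 2 (surfaceMeasure U))
    (hgφ : φ =ᵐ[surfaceMeasure U] g) : IsTrace U φ (gradient φ) g where
  memLp := hg
  exists_approx := by
    refine ⟨fun _ => φ, fun _ => ⟨hφ, hφc⟩, by simp, by simp, ?_⟩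
    have : eLpNorm (fun x => φ x - g x) 2 (surfaceMeasure U) = 0 := by
      refine eLpNorm_eq_zero_of_ae_zero ?_
      filter_upwards [hgφ] with x hx
      simp [hx]
    simp [this]

theorem lintegral_sq_lt_top {F : Type*} [NormedAddCommGroup F] {f : 𝔼 → F} (hf : Continuous f)
    (hc : HasCompactSupport f) (μ : Measure 𝔼) [IsFiniteMeasureOnCompacts μ] :
    ∫⁻ x, ‖f x‖ₑ ^ 2 ∂μ < ⊤ := by
  rw [← eLpNorm_two_sq]
  exact ENNReal.pow_lt_top (hf.memLp_of_hasCompactSupport hc).eLpNorm_lt_top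

/-- Converse to `FormBound.le_bottom`: local finiteness of the surface measure puts the boundary
values of a test function in L², so it is admissible. -/
theorem formBound_of_le_bottom {U : Set 𝔼} (hU : IsOpen U)
    [IsFiniteMeasureOnCompacts (surfaceMeasure U)] {γ β : ℝ≥0}
    (h : ((-(β : ℝ) : ℝ) : EReal) ≤ bottom U γ) : FormBound U γ β := by
  intro φ hφ hφc
  -- A function vanishing on U has no Rayleigh quotient; by continuity it also vanishes on the
  -- boundary, and the inequality is trivial.
  by_cases hne : φ =ᵐ[volume.restrict U] 0
  · have h0 : ∀ x ∈ U, φ x = 0 := by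
      have := Measure.eqOn_of_ae_eq hne hφ.continuous.continuousOn continuousOn_const
        (by rw [hU.interior_eq]; exact subset_closure)
      exact this
    have h1 : ∀ x ∈ closure U, φ x = 0 := fun x hx =>
      closure_minimal (t := {x | φ x = 0}) h0 (isClosed_eq hφ.continuous continuous_const) hx
    rw [surfaceMeasure, setLIntegral_eq_zero measurableSet_frontier]
    · simp
    · intro x hx
      simp [h1 x (frontier_subset_closure hx)]
  have hmem := hφ.continuous.memLp_of_hasCompactSupport hφc (μ := surfaceMeasure U) (p := 2)
  have hb := h.trans (sInf_le ⟨φ, gradient φ, φ, memH1_of_contDiff U hφ hφc,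
    isTrace_of_ae_eq U hφ hφc hmem (ae_eq_refl φ), hne, rfl⟩)
  rw [EReal.coe_le_coe_iff, rayleigh] at hb
  have hvN := integral_norm_sq_eq (μ := volume.restrict U) hφ.continuous.aestronglyMeasurable
  have hgN := integral_norm_sq_eq (μ := surfaceMeasure U) hφ.continuous.aestronglyMeasurable
  have hGN := integral_norm_sq_eq (μ := volume.restrict U)
    (continuous_gradient hφ).aestronglyMeasurable
  simp only [Real.norm_eq_abs, sq_abs] at hvN hgN
  simp_rw [enorm_gradient] at hGN
  have hmono : ∀ F : 𝔼 → ℝ≥0∞, ∫⁻ x, F x < ⊤ → ∫⁻ x in U, F x ≠ ⊤ := fun F hF =>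
    ((lintegral_mono' Measure.restrict_le_self le_rfl).trans_lt hF).ne
  have hvt := hmono _ (lintegral_sq_lt_top hφ.continuous hφc volume)
  have hGt := hmono _ (lintegral_sq_lt_top (continuous_gradient hφ)
    (hasCompactSupport_gradient hφc) volume)
  simp_rw [enorm_gradient] at hGt
  have hgt := (lintegral_sq_lt_top hφ.continuous hφc (surfaceMeasure U)).ne
  have hpos : 0 < ∫ x in U, φ x ^ 2 := by
    rw [hvN]
    refine ENNReal.toReal_pos ?_ hvt
    rw [← eLpNorm_two_sq]
    refine pow_ne_zero 2 fun h0 => hne ?_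
    exact (eLpNorm_eq_zero_iff hφ.continuous.aestronglyMeasurable two_ne_zero).1 h0
  rw [le_div_iff₀ hpos, hvN, hgN, hGN] at hb
  rw [← ENNReal.toReal_le_toReal (ENNReal.mul_ne_top ENNReal.coe_ne_top hgt)
    (ENNReal.add_ne_top.2 ⟨hGt, ENNReal.mul_ne_top ENNReal.coe_ne_top hvt⟩),
    ENNReal.toReal_add hGt (ENNReal.mul_ne_top ENNReal.coe_ne_top hvt), ENNReal.toReal_mul,
    ENNReal.toReal_mul, ENNReal.coe_toReal, ENNReal.coe_toReal]
  linarith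

/-- Test functions supported inside `U` bound the bottom of the spectrum from above. -/
theorem bottom_le_of_tsupport_subset {U : Set 𝔼} (hU : IsOpen U) {φ : 𝔼 → ℝ}
    (hφ : ContDiff ℝ ∞ φ) (hφc : HasCompactSupport φ) (hφs : tsupport φ ⊆ U)
    {q : ℝ≥0} (hq : ∫⁻ x in U, ‖fderiv ℝ φ x‖ₑ ^ 2 ≤ q * ∫⁻ x in U, ‖φ x‖ₑ ^ 2)
    (hne : ∃ x, φ x ≠ 0) (γ : ℝ) : bottom U γ ≤ ((q : ℝ) : EReal) := by
  have hz : φ =ᵐ[surfaceMeasure U] 0 := by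
    rw [EventuallyEq, surfaceMeasure, ae_restrict_iff' measurableSet_frontier]
    refine Eventually.of_forall fun x hx => ?_
    refine image_eq_zero_of_notMem_tsupport fun hh => ?_
    rw [hU.frontier_eq] at hx
    exact hx.2 (hφs hh)
  have hne' : ¬ φ =ᵐ[volume.restrict U] 0 := fun h0 => by
    have h1 := Measure.eqOn_of_ae_eq h0 hφ.continuous.continuousOn continuousOn_const
      (by rw [hU.interior_eq]; exact subset_closure)
    obtain ⟨x, hx⟩ := hne
    exact hx (h1 (hφs (subset_tsupport φ hx)))
  have hle : bottom U γ ≤ (rayleigh U γ φ (gradient φ) 0 : ℝ) :=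
    sInf_le ⟨φ, gradient φ, 0, memH1_of_contDiff U hφ hφc,
      isTrace_of_ae_eq U hφ hφc MemLp.zero hz, hne', rfl⟩
  refine hle.trans ?_
  have hvN := integral_norm_sq_eq (μ := volume.restrict U) hφ.continuous.aestronglyMeasurable
  have hGN := integral_norm_sq_eq (μ := volume.restrict U)
    (continuous_gradient hφ).aestronglyMeasurable
  simp only [Real.norm_eq_abs, sq_abs] at hvN
  simp_rw [enorm_gradient] at hGN
  have hvt : ∫⁻ x in U, ‖φ x‖ₑ ^ 2 ≠ ⊤ :=
    ((lintegral_mono' Measure.restrict_le_self le_rfl).trans_lt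
      (lintegral_sq_lt_top hφ.continuous hφc volume)).ne
  have hpos : 0 < ∫ x in U, φ x ^ 2 := by
    rw [hvN]
    refine ENNReal.toReal_pos ?_ hvt
    rw [← eLpNorm_two_sq]
    refine pow_ne_zero 2 fun h0 => hne' ?_
    exact (eLpNorm_eq_zero_iff hφ.continuous.aestronglyMeasurable two_ne_zero).1 h0
  rw [EReal.coe_le_coe_iff, rayleigh, div_le_iff₀ hpos, hvN, hGN]
  have := ENNReal.toReal_mono (ENNReal.mul_ne_top ENNReal.coe_ne_top hvt) hq
  rw [ENNReal.toReal_mul, ENNReal.coe_toReal] at this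
  simpa using this

theorem exists_interior_test {U : Set 𝔼} (hU : IsOpen U) (hne : U.Nonempty) :
    ∃ (φ : 𝔼 → ℝ) (q : ℝ≥0), ContDiff ℝ ∞ φ ∧ HasCompactSupport φ ∧ tsupport φ ⊆ U ∧
      (∃ x, φ x ≠ 0) ∧ ∫⁻ x in U, ‖fderiv ℝ φ x‖ₑ ^ 2 ≤ q * ∫⁻ x in U, ‖φ x‖ₑ ^ 2 := by
  obtain ⟨x, hx⟩ := hne
  obtain ⟨r, hr, hb⟩ := Metric.isOpen_iff.1 hU x hx
  let η : ContDiffBump x := ⟨r / 4, r / 2, by positivity, by linarith⟩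
  have hη : ContDiff ℝ ∞ η := η.contDiff
  have hs : tsupport η ⊆ U := by
    rw [η.tsupport_eq]
    exact (Metric.closedBall_subset_ball (by simp only [η]; linarith)).trans hb
  have hx1 : η x ≠ 0 := by
    rw [η.one_of_mem_closedBall (Metric.mem_closedBall_self η.rIn_pos.le)]
    exact one_ne_zero
  have hmono : ∀ F : 𝔼 → ℝ≥0∞, ∫⁻ x, F x < ⊤ → ∫⁻ x in U, F x ≠ ⊤ := fun F hF =>
    ((lintegral_mono' Measure.restrict_le_self le_rfl).trans_lt hF).ne
  have hvt := hmono _ (lintegral_sq_lt_top hη.continuous η.hasCompactSupport volume)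
  have hGt := hmono _ (lintegral_sq_lt_top (hη.continuous_fderiv (by simp))
    (η.hasCompactSupport.fderiv ℝ) volume)
  have hv0 : ∫⁻ x in U, ‖η x‖ₑ ^ 2 ≠ 0 := fun h0 => by
    rw [← eLpNorm_two_sq] at h0
    have h1 := (eLpNorm_eq_zero_iff hη.continuous.aestronglyMeasurable two_ne_zero).1
      (pow_eq_zero_iff two_ne_zero |>.1 h0)
    exact hx1 (Measure.eqOn_of_ae_eq h1 hη.continuous.continuousOn continuousOn_const
      (by rw [hU.interior_eq]; exact subset_closure) hx)
  refine ⟨η, ((∫⁻ x in U, ‖fderiv ℝ η x‖ₑ ^ 2) / ∫⁻ x in U, ‖η x‖ₑ ^ 2).toNNReal, hη,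
    η.hasCompactSupport, hs, ⟨x, hx1⟩, ?_⟩
  rw [ENNReal.coe_toNNReal (ENNReal.div_ne_top hGt hv0), ENNReal.div_mul_cancel hv0 hvt]

/-! ### Dilation of the form on a cone -/

theorem contDiff_comp_smul {φ : 𝔼 → ℝ} {n : ℕ∞} (hφ : ContDiff ℝ n φ) (t : ℝ) :
    ContDiff ℝ n fun x => φ (t • x) := hφ.comp (by fun_prop)

theorem hasCompactSupport_comp_smul' {φ : 𝔼 → ℝ} (hφ : HasCompactSupport φ) {t : ℝ} (ht : t ≠ 0) :
    HasCompactSupport fun x => φ (t • x) :=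
  hφ.comp_homeomorph (Homeomorph.smulOfNeZero t ht)

section Scaling

variable {K : Set 𝔼} {φ : 𝔼 → ℝ} {t : ℝ≥0}

theorem IsCone.biLipOn_smul (hK : IsCone K) (ht : (t : ℝ) ≠ 0) :
    BiLipOn (affineHomeo 0 t ht) univ t t⁻¹ K K :=
  biLipOn_affineHomeo 0 ht fun x => by
    rw [zero_add, hK.smul_mem_iff (t := (t : ℝ)) (lt_of_le_of_ne t.coe_nonneg ht.symm)]

theorem affineHomeo_image_univ (l : 𝔼) (t : ℝ) (ht : t ≠ 0) : affineHomeo l t ht '' univ = univ :=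
  (affineHomeo l t ht).image_source_eq_target

theorem mul_eq_of_le_inv_mul {a b x y : ℝ≥0∞} (hab : a * b = 1) (h1 : x ≤ a * y)
    (h2 : y ≤ b * x) : a * y = x := by
  refine le_antisymm ?_ h1
  calc a * y ≤ a * (b * x) := by gcongr
    _ = x := by rw [← mul_assoc, hab, one_mul]

theorem coe_mul_coe_inv (ht : t ≠ 0) : (t : ℝ≥0∞) * ((t⁻¹ : ℝ≥0) : ℝ≥0∞) = 1 := by
  rw [← ENNReal.coe_mul, mul_inv_cancel₀ ht, ENNReal.coe_one]

/-- The dilation has Lipschitz constants t and t⁻¹, so the estimates in the two directions have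
reciprocal constants and are equalities. The next two scaling laws arise in the same way. -/
theorem IsCone.lintegral_comp_smul (hK : IsCone K) (hKo : IsOpen K) (hφ : ContDiff ℝ ∞ φ)
    (ht : t ≠ 0) :
    (t : ℝ≥0∞) ^ m * ∫⁻ x in K, ‖φ ((t : ℝ) • x)‖ₑ ^ 2 = ∫⁻ x in K, ‖φ x‖ₑ ^ 2 := by
  have ht' : (t : ℝ) ≠ 0 := by exact_mod_cast ht
  have h := hK.biLipOn_smul ht'
  have hi := affineHomeo_image_univ (0 : 𝔼) t ht'
  have huv : ∀ x ∈ univ, φ ((t : ℝ) • x) = φ (affineHomeo 0 t ht' x) := fun x _ => by simp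
  have h1 := h.lintegral_pow_le hKo hφ.continuous (by simp [hi]) huv two_ne_zero
  have h2 := h.symm.lintegral_pow_le hKo (contDiff_comp_smul hφ t).continuous
    (by rw [h.symm_image]; exact subset_univ _) (fun y hy => h.eq_comp_symm huv hy) two_ne_zero
  refine mul_eq_of_le_inv_mul ?_ h1 h2
  rw [← mul_pow, coe_mul_coe_inv ht, one_pow]

theorem IsCone.lintegral_surface_comp_smul (hm : 1 ≤ m) (hK : IsCone K) (hφ : ContDiff ℝ ∞ φ)
    (ht : t ≠ 0) :
    (t : ℝ≥0∞) ^ m * ∫⁻ x, ‖φ ((t : ℝ) • x)‖ₑ ^ 2 ∂surfaceMeasure K =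
      t * ∫⁻ x, ‖φ x‖ₑ ^ 2 ∂surfaceMeasure K := by
  have ht' : (t : ℝ) ≠ 0 := by exact_mod_cast ht
  have h := hK.biLipOn_smul ht'
  have hi := affineHomeo_image_univ (0 : 𝔼) t ht'
  have huv : ∀ x ∈ univ, φ ((t : ℝ) • x) = φ (affineHomeo 0 t ht' x) := fun x _ => by simp
  have h1 := h.lintegral_surface_pow_le hφ.continuous (by simp [hi]) huv two_ne_zero
  have h2 := h.symm.lintegral_surface_pow_le (contDiff_comp_smul hφ t).continuous
    (by rw [h.symm_image]; exact subset_univ _) (fun y hy => h.eq_comp_symm huv hy) two_ne_zero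
  have := mul_eq_of_le_inv_mul (by rw [← mul_pow, coe_mul_coe_inv ht, one_pow]) h1 h2
  rw [← this, ← mul_assoc, ← pow_succ', Nat.sub_add_cancel hm]

theorem IsCone.lintegral_fderiv_comp_smul (hK : IsCone K) (hKo : IsOpen K) (hφ : ContDiff ℝ ∞ φ)
    (ht : t ≠ 0) :
    (t : ℝ≥0∞) ^ m * ∫⁻ x in K, ‖fderiv ℝ (fun x => φ ((t : ℝ) • x)) x‖ₑ ^ 2 =
      (t : ℝ≥0∞) ^ 2 * ∫⁻ x in K, ‖fderiv ℝ φ x‖ₑ ^ 2 := by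
  have ht' : (t : ℝ) ≠ 0 := by exact_mod_cast ht
  have h := hK.biLipOn_smul ht'
  have hi := affineHomeo_image_univ (0 : 𝔼) t ht'
  have huv : ∀ x ∈ univ, φ ((t : ℝ) • x) = φ (affineHomeo 0 t ht' x) := fun x _ => by simp
  have hφ1 : ContDiff ℝ 1 φ := hφ.of_le (by exact_mod_cast le_top)
  have hψ1 : ContDiff ℝ 1 fun x => φ ((t : ℝ) • x) := contDiff_comp_smul (n := 1) hφ1 t
  have h1 := h.lintegral_fderiv_pow_le hKo hφ1 hψ1 (by simp [hi]) huv two_ne_zero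
  have h2 := h.symm.lintegral_fderiv_pow_le hKo hψ1 hφ1
    (by rw [h.symm_image]; exact subset_univ _) (fun y hy => h.eq_comp_symm huv hy) two_ne_zero
  have hone := coe_mul_coe_inv ht
  have := mul_eq_of_le_inv_mul (by
    calc (t : ℝ≥0∞) ^ m * ((t⁻¹ : ℝ≥0) : ℝ≥0∞) ^ 2 * (((t⁻¹ : ℝ≥0) : ℝ≥0∞) ^ m * (t : ℝ≥0∞) ^ 2)
        = ((t : ℝ≥0∞) * ((t⁻¹ : ℝ≥0) : ℝ≥0∞)) ^ (m + 2) := by ring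
      _ = 1 := by rw [hone, one_pow]) h1 h2
  rw [← this]
  calc _ = ((t : ℝ≥0∞) * ((t⁻¹ : ℝ≥0) : ℝ≥0∞)) ^ 2 * ((t : ℝ≥0∞) ^ m *
        ∫⁻ x in K, ‖fderiv ℝ (fun x => φ ((t : ℝ) • x)) x‖ₑ ^ 2) := by rw [hone]; simp
    _ = _ := by ring

/-- Substituting φ(x/γ) multiplies the boundary, gradient and mass terms by γ^(-1), γ^(-2) and 1, up
to a common factor; multiplying by γ² gives the claim. -/
theorem FormBound.smul (hm : 1 ≤ m) (hK : IsCone K) (hKo : IsOpen K) {β : ℝ≥0}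
    (h : FormBound K 1 β) (γ : ℝ≥0) : FormBound K γ (γ ^ 2 * β) := by
  intro φ hφ hφc
  rcases eq_or_ne γ 0 with rfl | hγ
  · simp
  have ht : γ⁻¹ ≠ 0 := inv_ne_zero hγ
  have ht' : ((γ⁻¹ : ℝ≥0) : ℝ) ≠ 0 := by exact_mod_cast ht
  have h1 := h _ (contDiff_comp_smul (n := ⊤) hφ ((γ⁻¹ : ℝ≥0) : ℝ))
    (hasCompactSupport_comp_smul' hφc ht')
  have h2 := mul_le_mul_right h1 (((γ⁻¹ : ℝ≥0) : ℝ≥0∞) ^ m)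
  rw [ENNReal.coe_one, one_mul, mul_add, mul_left_comm _ (β : ℝ≥0∞),
    hK.lintegral_surface_comp_smul hm hφ ht, hK.lintegral_fderiv_comp_smul hKo hφ ht,
    hK.lintegral_comp_smul hKo hφ ht] at h2
  have h3 := mul_le_mul_right h2 ((γ : ℝ≥0∞) ^ 2)
  have hone := coe_mul_coe_inv hγ
  calc (γ : ℝ≥0∞) * ∫⁻ x, ‖φ x‖ₑ ^ 2 ∂surfaceMeasure K
      = (γ : ℝ≥0∞) * (γ * ((γ⁻¹ : ℝ≥0) : ℝ≥0∞)) * ∫⁻ x, ‖φ x‖ₑ ^ 2 ∂surfaceMeasure K := by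
        rw [hone, mul_one]
    _ = (γ : ℝ≥0∞) ^ 2 * (((γ⁻¹ : ℝ≥0) : ℝ≥0∞) * ∫⁻ x, ‖φ x‖ₑ ^ 2 ∂surfaceMeasure K) := by ring
    _ ≤ _ := h3
    _ = (γ * ((γ⁻¹ : ℝ≥0) : ℝ≥0∞)) ^ 2 * (∫⁻ x in K, ‖fderiv ℝ φ x‖ₑ ^ 2) +
          (γ : ℝ≥0∞) ^ 2 * β * ∫⁻ x in K, ‖φ x‖ₑ ^ 2 := by ring
    _ = _ := by rw [hone]; simp

/-- An interior test function spread out by φ(t x) has Rayleigh quotient at most t² q, which tends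
to 0 as t → 0. -/
theorem IsCone.bottom_nonpos (hK : IsCone K) (hKo : IsOpen K) (hne : K.Nonempty) (γ : ℝ) :
    bottom K γ ≤ 0 := by
  obtain ⟨φ, q, hφ, hφc, hφs, ⟨x, hx⟩, hq⟩ := exists_interior_test hKo hne
  have key : ∀ t : ℝ≥0, t ≠ 0 → bottom K γ ≤ (((t ^ 2 * q : ℝ≥0) : ℝ) : EReal) := by
    intro t ht
    have ht' : (t : ℝ) ≠ 0 := by exact_mod_cast ht
    have htp : 0 < (t : ℝ) := lt_of_le_of_ne t.coe_nonneg ht'.symm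
    refine bottom_le_of_tsupport_subset hKo (contDiff_comp_smul (n := ⊤) hφ t)
      (hasCompactSupport_comp_smul' hφc ht') ?_ ?_ ⟨(t : ℝ)⁻¹ • x, ?_⟩ γ
    · intro y hy
      have h1 : (t : ℝ) • y ∈ tsupport φ :=
        tsupport_comp_subset_preimage φ (continuous_const_smul (t : ℝ)) hy
      exact (hK.smul_mem_iff htp).1 (hφs h1)
    · have ht0 : (t : ℝ≥0∞) ^ m ≠ 0 := pow_ne_zero _ (by exact_mod_cast ht)
      have htt : (t : ℝ≥0∞) ^ m ≠ ⊤ := ENNReal.pow_ne_top ENNReal.coe_ne_top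
      rw [← ENNReal.mul_le_mul_iff_right ht0 htt, mul_left_comm,
        hK.lintegral_fderiv_comp_smul hKo hφ ht, hK.lintegral_comp_smul hKo hφ ht]
      push_cast
      rw [mul_assoc]
      gcongr
    · simpa [smul_smul, mul_inv_cancel₀ ht'] using hx
  have hlim : Tendsto (fun t : ℝ≥0 => (((t ^ 2 * q : ℝ≥0) : ℝ) : EReal)) (𝓝[≠] 0) (𝓝 0) := by
    have hc : Continuous fun t : ℝ≥0 => (((t ^ 2 * q : ℝ≥0) : ℝ) : EReal) :=
      continuous_coe_real_ereal.comp (NNReal.continuous_coe.comp (by fun_prop))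
    simpa using (hc.tendsto 0).mono_left nhdsWithin_le_nhds
  have : (𝓝[≠] (0 : ℝ≥0)).NeBot := inferInstance
  exact ge_of_tendsto hlim (eventually_mem_nhdsWithin.mono fun t ht => key t ht)

end Scaling

/-! ### Upper bound: transplantation of test functions from the model cone -/

/-- Near the vertex, a diffeomorphism tangent to the identity is nearly an isometry. -/
theorem IsModelCone.exists_biLipOn {Ω K : Set 𝔼} {y : 𝔼} (h : IsModelCone Ω y K) {L : ℝ≥0}
    (hL : 1 < L) : ∃ (f : OpenPartialHomeomorph 𝔼 𝔼) (W : Set 𝔼), 0 ∈ W ∧ f 0 = y ∧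
      BiLipOn f W L L K Ω := by
  obtain ⟨f, hf, hf0, hfd⟩ := h.exists_localDiffeo
  have hid : ‖ContinuousLinearMap.id ℝ 𝔼‖₊ ≤ 1 := ContinuousLinearMap.norm_id_le
  have hfd' : fderiv ℝ f.symm (f 0) = ContinuousLinearMap.id ℝ 𝔼 := by
    have := hf.symm_fderiv_comp
    rwa [hfd, ContinuousLinearMap.comp_id] at this
  obtain ⟨W, hW0, hW⟩ := hf.exists_biLipOn (L₁ := L) (L₂ := L)
    (by rw [hfd]; exact hid.trans_lt hL) (by rw [hfd']; exact hid.trans_lt hL)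
  exact ⟨f, W, hW0, hf0, hW⟩

theorem exists_one_lt_pow_mul_lt {a b : ℝ≥0∞} (hab : a < b) (n : ℕ) :
    ∃ L : ℝ≥0, 1 < L ∧ (L : ℝ≥0∞) ^ n * a < b := by
  have hc : Tendsto (fun L : ℝ≥0 => (L : ℝ≥0∞) ^ n * a) (𝓝[>] 1) (𝓝 a) := by
    have h1 : Tendsto (fun L : ℝ≥0 => (L : ℝ≥0∞) ^ n) (𝓝 1) (𝓝 1) := by
      have h0 := ENNReal.Tendsto.pow (n := n) (ENNReal.continuous_coe.tendsto (1 : ℝ≥0))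
      simpa using h0
    simpa using ENNReal.Tendsto.mul_const (h1.mono_left nhdsWithin_le_nhds)
      (Or.inr hab.ne_top)
  obtain ⟨L, h1, h2⟩ := ((hc.eventually_lt_const hab).and eventually_mem_nhdsWithin).exists
  exact ⟨L, h2, h1⟩

/-- A test function on the model cone at a boundary point yields test functions on the domain. -/
theorem IsModelCone.eventually_bottom_lt (hm : 1 ≤ m) {Ω K : Set 𝔼} (hΩ : IsOpen Ω)
    [IsFiniteMeasureOnCompacts (surfaceMeasure Ω)] {y : 𝔼} (h : IsModelCone Ω y K) {c : ℝ≥0}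
    (hc : (((c : ℝ) : ℝ) : EReal) < coneConst K) :
    ∀ᶠ γ : ℝ≥0 in atTop, bottom Ω γ < ((-((γ ^ 2 * c : ℝ≥0) : ℝ) : ℝ) : EReal) := by
  have hKo := h.isOpen hΩ
  have hnb : ¬ FormBound K 1 c := fun hb => by
    have h1 := hb.le_bottom
    have h2 := EReal.neg_lt_neg_iff.2 hc
    rw [coneConst, neg_neg] at h2
    rw [EReal.coe_neg] at h1
    exact absurd (h1.trans_lt (by simpa using h2)) (lt_irrefl _)
  simp only [FormBound, not_forall, not_le] at hnb
  obtain ⟨φ, hφ, hφc, hlt⟩ := hnb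
  rw [ENNReal.coe_one, one_mul] at hlt
  -- The exponent is (m - 1) + m + 2: the losses in the surface integral, the volume integral and
  -- the squared gradient. The strict inequality for φ leaves room for them.
  obtain ⟨L, hL, hLlt⟩ := exists_one_lt_pow_mul_lt hlt (2 * m + 1)
  obtain ⟨f, W, hW0, hf0, hW⟩ := h.exists_biLipOn hL
  obtain ⟨R, hR0, hR⟩ := hφc.isCompact.isBounded.subset_closedBall_lt 0 (0 : 𝔼)
  obtain ⟨r, hr, hrW⟩ := Metric.isOpen_iff.1 hW.isOpen 0 hW0
  -- For γ > R/r the support of φ(γ x) fits into the ball of radius r on which the chart is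
  -- controlled.
  filter_upwards [eventually_gt_atTop (R / r).toNNReal] with γ hγ
  have hγ' : R / r < γ := Real.toNNReal_lt_iff_lt_coe (by positivity) |>.1 hγ
  have hγ0 : 0 < (γ : ℝ) := lt_trans (by positivity) hγ'
  have hγn : γ ≠ 0 := by exact_mod_cast hγ0.ne'
  by_contra hcon
  rw [not_lt] at hcon
  have hb := formBound_of_le_bottom hΩ hcon
  set ψ : 𝔼 → ℝ := fun x => φ ((γ : ℝ) • x) with hψ
  have hψs : ContDiff ℝ ∞ ψ := contDiff_comp_smul (n := ⊤) hφ γ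
  have hψc : HasCompactSupport ψ := hasCompactSupport_comp_smul' hφc hγ0.ne'
  have hψW : tsupport ψ ⊆ W := by
    intro x hx
    have h1 : (γ : ℝ) • x ∈ tsupport φ :=
      tsupport_comp_subset_preimage φ (continuous_const_smul (γ : ℝ)) hx
    have h2 := hR h1
    rw [mem_closedBall_zero_iff, norm_smul, Real.norm_of_nonneg hγ0.le] at h2
    refine hrW ?_
    rw [mem_ball_zero_iff]
    rw [div_lt_iff₀ hr] at hγ'
    exact lt_of_mul_lt_mul_left (h2.trans_lt hγ') hγ0.le
  obtain ⟨v, hv, hvc, hvW, hvψ⟩ := hW.symm.exists_pullback (n := ⊤) hψs hψc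
    (by rw [hW.symm_image]; exact hψW)
  have hψ1 : ContDiff ℝ 1 ψ := hψs.of_le (by exact_mod_cast le_top)
  have hv1 : ContDiff ℝ 1 v := hv.of_le (by exact_mod_cast le_top)
  have hψv : ∀ x ∈ W, ψ x = v (f x) := fun x hx => by
    rw [hvψ _ (mem_image_of_mem f hx), hW.left_inv hx]
  have hS := hW.symm.lintegral_surface_pow_le hψs.continuous (by rw [hW.symm_image]; exact hψW)
    hvψ two_ne_zero
  have hN := hW.lintegral_pow_le hKo hv.continuous hvW hψv two_ne_zero
  have hD := hW.lintegral_fderiv_pow_le hKo hv1 hψ1 hvW hψv two_ne_zero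
  have hΩb := hb v hv hvc
  have hS' := h.1.lintegral_surface_comp_smul hm hφ hγn
  have hN' := h.1.lintegral_comp_smul hKo hφ hγn
  have hD' := h.1.lintegral_fderiv_comp_smul hKo hφ hγn
  set S := ∫⁻ x, ‖φ x‖ₑ ^ 2 ∂surfaceMeasure K
  set N := ∫⁻ x in K, ‖φ x‖ₑ ^ 2
  set D := ∫⁻ x in K, ‖fderiv ℝ φ x‖ₑ ^ 2
  set Sψ := ∫⁻ x, ‖ψ x‖ₑ ^ 2 ∂surfaceMeasure K
  set Nψ := ∫⁻ x in K, ‖ψ x‖ₑ ^ 2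
  set Dψ := ∫⁻ x in K, ‖fderiv ℝ ψ x‖ₑ ^ 2
  have hL1 : (1 : ℝ≥0∞) ≤ L := by exact_mod_cast hL.le
  have hchain : (γ : ℝ≥0∞) ^ 2 * S ≤ (γ : ℝ≥0∞) ^ 2 * ((L : ℝ≥0∞) ^ (2 * m + 1) * (D + c * N)) :=
    calc (γ : ℝ≥0∞) ^ 2 * S = γ * ((γ : ℝ≥0∞) ^ m * Sψ) := by rw [hS']; ring
      _ ≤ γ * ((γ : ℝ≥0∞) ^ m * ((L : ℝ≥0∞) ^ (m - 1) *
            ∫⁻ x, ‖v x‖ₑ ^ 2 ∂surfaceMeasure Ω)) := by gcongr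
      _ = (γ : ℝ≥0∞) ^ m * (L : ℝ≥0∞) ^ (m - 1) *
            (γ * ∫⁻ x, ‖v x‖ₑ ^ 2 ∂surfaceMeasure Ω) := by ring
      _ ≤ (γ : ℝ≥0∞) ^ m * (L : ℝ≥0∞) ^ (m - 1) * ((L : ℝ≥0∞) ^ m * (L : ℝ≥0∞) ^ 2 * Dψ +
            (γ ^ 2 * c : ℝ≥0) * ((L : ℝ≥0∞) ^ m * Nψ)) := by
          gcongr
          exact hΩb.trans (by gcongr)
      _ ≤ (γ : ℝ≥0∞) ^ m * (L : ℝ≥0∞) ^ (m - 1) * ((L : ℝ≥0∞) ^ m * (L : ℝ≥0∞) ^ 2 * Dψ +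
            (γ ^ 2 * c : ℝ≥0) * ((L : ℝ≥0∞) ^ m * (L : ℝ≥0∞) ^ 2 * Nψ)) := by
          gcongr
          exact le_mul_of_one_le_right zero_le (one_le_pow₀ hL1)
      _ = (L : ℝ≥0∞) ^ (m - 1 + m + 2) * ((γ : ℝ≥0∞) ^ m * Dψ +
            (γ : ℝ≥0∞) ^ 2 * (c * ((γ : ℝ≥0∞) ^ m * Nψ))) := by push_cast; ring
      _ = _ := by
          rw [hD', hN', show m - 1 + m + 2 = 2 * m + 1 by omega]
          ring
  have hγ2 : (γ : ℝ≥0∞) ^ 2 ≠ 0 := pow_ne_zero _ (by exact_mod_cast hγn)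
  rw [ENNReal.mul_le_mul_iff_right hγ2 (ENNReal.pow_ne_top ENNReal.coe_ne_top)] at hchain
  exact absurd hLlt (not_lt.2 hchain)

/-! ### Lower bound: localisation and gluing -/

/-- `γ ∫_∂U |φ|² ≤ θ (∫_U |∇φ|² + γ² C ∫_U |φ|²)` for all `γ` and all test functions supported in
`B`. -/
def LocalFormBound (U B : Set 𝔼) (θ C : ℝ≥0) : Prop :=
  ∀ γ : ℝ≥0, ∀ φ : 𝔼 → ℝ, ContDiff ℝ ∞ φ → HasCompactSupport φ → tsupport φ ⊆ B →
    γ * ∫⁻ x, ‖φ x‖ₑ ^ 2 ∂surfaceMeasure U ≤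
      θ * ((∫⁻ x in U, ‖fderiv ℝ φ x‖ₑ ^ 2) + γ ^ 2 * C * ∫⁻ x in U, ‖φ x‖ₑ ^ 2)

theorem LocalFormBound.mono {U B B' : Set 𝔼} {θ C : ℝ≥0} (h : LocalFormBound U B θ C)
    (hB : B' ⊆ B) : LocalFormBound U B' θ C :=
  fun γ φ hφ hφc hφs => h γ φ hφ hφc (hφs.trans hB)

/-- The cone inequality, scaled to γ, is transported by a nearly isometric chart. The radius depends
on L but not on γ, which is what makes the later gluing error o(γ²). -/
theorem IsModelCone.exists_localFormBound (hm : 1 ≤ m) {Ω K : Set 𝔼} (hΩ : IsOpen Ω) {y : 𝔼}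
    (h : IsModelCone Ω y K) {C : ℝ≥0} (hC : FormBound K 1 C) {L : ℝ≥0} (hL : 1 < L) :
    ∃ ρ > 0, LocalFormBound Ω (Metric.ball y ρ) (L ^ (2 * m + 1)) C := by
  have hKo := h.isOpen hΩ
  obtain ⟨f, W, hW0, hf0, hW⟩ := h.exists_biLipOn hL
  have hWs := hW.symm.isOpen
  obtain ⟨ρ, hρ, hρW⟩ := Metric.isOpen_iff.1 hWs y (hf0 ▸ mem_image_of_mem f hW0)
  refine ⟨ρ, hρ, fun γ φ hφ hφc hφs => ?_⟩
  have hφW := hφs.trans hρW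
  obtain ⟨v, hv, hvc, hvW, hvφ⟩ := hW.exists_pullback (n := ⊤) hφ hφc hφW
  have hφ1 : ContDiff ℝ 1 φ := hφ.of_le (by exact_mod_cast le_top)
  have hv1 : ContDiff ℝ 1 v := hv.of_le (by exact_mod_cast le_top)
  have hvφ' : ∀ y ∈ f '' W, φ y = v (f.symm y) := fun y hy => hW.eq_comp_symm hvφ hy
  have hvW' : tsupport v ⊆ f.symm '' (f '' W) := by rwa [hW.symm_image]
  have hS := hW.lintegral_surface_pow_le hφ.continuous hφW hvφ two_ne_zero
  have hN := hW.symm.lintegral_pow_le hΩ hv.continuous hvW' hvφ' two_ne_zero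
  have hD := hW.symm.lintegral_fderiv_pow_le hΩ hv1 hφ1 hvW' hvφ' two_ne_zero
  have hb := hC.smul hm h.1 hKo γ v hv hvc
  have hL1 : (1 : ℝ≥0∞) ≤ L := by exact_mod_cast hL.le
  set S := ∫⁻ x, ‖φ x‖ₑ ^ 2 ∂surfaceMeasure Ω
  set N := ∫⁻ x in Ω, ‖φ x‖ₑ ^ 2
  set D := ∫⁻ x in Ω, ‖fderiv ℝ φ x‖ₑ ^ 2
  calc (γ : ℝ≥0∞) * S
      ≤ γ * ((L : ℝ≥0∞) ^ (m - 1) * ∫⁻ x, ‖v x‖ₑ ^ 2 ∂surfaceMeasure K) := by gcongr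
    _ = (L : ℝ≥0∞) ^ (m - 1) * (γ * ∫⁻ x, ‖v x‖ₑ ^ 2 ∂surfaceMeasure K) := by ring
    _ ≤ (L : ℝ≥0∞) ^ (m - 1) * ((L : ℝ≥0∞) ^ m * (L : ℝ≥0∞) ^ 2 * D +
          (γ ^ 2 * C : ℝ≥0) * ((L : ℝ≥0∞) ^ m * N)) := by
        gcongr
        exact hb.trans (by gcongr)
    _ ≤ (L : ℝ≥0∞) ^ (m - 1) * ((L : ℝ≥0∞) ^ m * (L : ℝ≥0∞) ^ 2 * D +
          (γ ^ 2 * C : ℝ≥0) * ((L : ℝ≥0∞) ^ m * (L : ℝ≥0∞) ^ 2 * N)) := by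
        gcongr
        exact le_mul_of_one_le_right zero_le (one_le_pow₀ hL1)
    _ = (L : ℝ≥0∞) ^ (m - 1 + m + 2) * (D + γ ^ 2 * C * N) := by push_cast; ring
    _ = _ := by rw [show m - 1 + m + 2 = 2 * m + 1 by omega]; push_cast; rfl

theorem exists_uniform_localFormBound {U S : Set 𝔼} (hS : IsCompact S) {θ C : ℝ≥0}
    (h : ∀ y ∈ S, ∃ ρ > 0, LocalFormBound U (Metric.ball y ρ) θ C) :
    ∃ ρ > 0, ∀ y ∈ S, LocalFormBound U (Metric.ball y ρ) θ C := by
  refine hS.induction_on (p := fun S => ∃ ρ > 0, ∀ y ∈ S, LocalFormBound U (Metric.ball y ρ) θ C)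
    ⟨1, one_pos, by simp⟩ ?_ ?_ ?_
  · rintro s t hst ⟨ρ, hρ, hB⟩
    exact ⟨ρ, hρ, fun z hz => hB z (hst hz)⟩
  · rintro s t ⟨ρ, hρ, hB⟩ ⟨ρ', hρ', hB'⟩
    refine ⟨min ρ ρ', lt_min hρ hρ', ?_⟩
    rintro z (hz | hz)
    · exact (hB z hz).mono (Metric.ball_subset_ball (min_le_left _ _))
    · exact (hB' z hz).mono (Metric.ball_subset_ball (min_le_right _ _))
  · intro z hz
    obtain ⟨ρ, hρ, hB⟩ := h z hz
    refine ⟨Metric.ball z (ρ / 2),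
      mem_nhdsWithin_of_mem_nhds (Metric.ball_mem_nhds _ (by positivity)),
      ρ / 2, by positivity, fun y hy => hB.mono (Metric.ball_subset_ball' ?_)⟩
    rw [Metric.mem_ball] at hy
    linarith

theorem localFormBound_of_frontier {U : Set 𝔼} {θ C : ℝ≥0} {ρ : ℝ}
    (h : ∀ y ∈ frontier U, LocalFormBound U (Metric.ball y ρ) θ C) (z : 𝔼) :
    LocalFormBound U (Metric.ball z (ρ / 2)) θ C := by
  by_cases hz : ∃ y ∈ frontier U, y ∈ Metric.ball z (ρ / 2)
  · obtain ⟨y, hy, hyz⟩ := hz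
    refine (h y hy).mono (Metric.ball_subset_ball' ?_)
    rw [Metric.mem_ball, dist_comm] at hyz
    linarith
  · push Not at hz
    intro γ φ hφ hφc hφs
    rw [surfaceMeasure, setLIntegral_eq_zero measurableSet_frontier]
    · simp
    · intro x hx
      have : φ x = 0 := image_eq_zero_of_notMem_tsupport fun hh => hz x hx (hφs hh)
      simp [this]

theorem sq_add_le_mul_sq_add {δ : ℝ≥0} (hδ : δ ≠ 0) {a b : ℝ≥0∞} (ha : a ≠ ⊤) (hb : b ≠ ⊤) :
    (a + b) ^ 2 ≤ (1 + δ : ℝ≥0) * a ^ 2 + (1 + δ⁻¹ : ℝ≥0) * b ^ 2 := by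
  lift a to ℝ≥0 using ha
  lift b to ℝ≥0 using hb
  norm_cast
  rw [← NNReal.coe_le_coe]
  push_cast
  have hδ' : 0 < (δ : ℝ) := lt_of_le_of_ne δ.coe_nonneg (by exact_mod_cast hδ.symm)
  have h1 : 0 ≤ (δ : ℝ)⁻¹ * (δ * a - b) ^ 2 := by positivity
  have h2 : (δ : ℝ)⁻¹ * (δ * a - b) ^ 2 = δ * a ^ 2 - 2 * a * b + (δ : ℝ)⁻¹ * b ^ 2 := by
    field_simp
    ring
  nlinarith

/-- Localised bounds are glued by averaging over all translates of a cutoff. -/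
theorem exists_formBound_of_local {U : Set 𝔼} [SFinite (surfaceMeasure U)] {ρ : ℝ} (hρ : 0 < ρ)
    {θ C : ℝ≥0} (h : ∀ z, LocalFormBound U (Metric.ball z ρ) θ C) {δ : ℝ≥0} (hδ : δ ≠ 0) :
    ∃ M : ℝ≥0, ∀ γ : ℝ≥0, ∀ φ : 𝔼 → ℝ, ContDiff ℝ ∞ φ → HasCompactSupport φ →
      γ * ∫⁻ x, ‖φ x‖ₑ ^ 2 ∂surfaceMeasure U ≤
        (θ * (1 + δ) : ℝ≥0) * ((∫⁻ x in U, ‖fderiv ℝ φ x‖ₑ ^ 2) +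
          (M + γ ^ 2 * C : ℝ≥0) * ∫⁻ x in U, ‖φ x‖ₑ ^ 2) := by
  let η : ContDiffBump (0 : 𝔼) := ⟨ρ / 4, ρ / 2, by positivity, by linarith⟩
  have hη : ContDiff ℝ ∞ η := η.contDiff
  have hη1 : ContDiff ℝ 1 η := η.contDiff
  have hηme : Measurable (η : 𝔼 → ℝ) := hη.continuous.measurable
  have hdη : Continuous (fderiv ℝ η) := hη1.continuous_fderiv one_ne_zero
  set c : ℝ≥0∞ := ∫⁻ x, ‖η x‖ₑ ^ 2 with hc
  set d : ℝ≥0∞ := ∫⁻ x, ‖fderiv ℝ η x‖ₑ ^ 2 with hd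
  have hct : c ≠ ⊤ := (lintegral_sq_lt_top hη.continuous η.hasCompactSupport volume).ne
  have hdt : d ≠ ⊤ := (lintegral_sq_lt_top hdη (η.hasCompactSupport.fderiv ℝ) volume).ne
  have hc0 : c ≠ 0 := fun h0 => by
    rw [hc, ← eLpNorm_two_sq] at h0
    have h1 := (eLpNorm_eq_zero_iff hη.continuous.aestronglyMeasurable two_ne_zero).1
      (pow_eq_zero_iff two_ne_zero |>.1 h0)
    have h2 := congrFun ((hη.continuous.ae_eq_iff_eq volume continuous_const).1 h1) 0
    rw [η.one_of_mem_closedBall (Metric.mem_closedBall_self η.rIn_pos.le)] at h2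
    exact one_ne_zero h2
  have hcη : ∀ x, ∫⁻ z, ‖η (x - z)‖ₑ ^ 2 = c := fun x =>
    lintegral_sub_left_eq_self (fun z => ‖η z‖ₑ ^ 2) x
  have hdη' : ∀ x, ∫⁻ z, ‖fderiv ℝ η (x - z)‖ₑ ^ 2 = d := fun x =>
    lintegral_sub_left_eq_self (fun z => ‖fderiv ℝ η z‖ₑ ^ 2) x
  have hMt : (1 + δ⁻¹ : ℝ≥0) * d / c ≠ ⊤ :=
    ENNReal.div_ne_top (ENNReal.mul_ne_top ENNReal.coe_ne_top hdt) hc0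
  -- The localisation error: (1 + 1/δ) comes from Young's inequality for the gradient of the
  -- product, and d/c compares ∫ |∇η|² with ∫ η².
  obtain ⟨k, hk⟩ : ∃ k : ℝ≥0, (k : ℝ≥0∞) = (1 + δ⁻¹ : ℝ≥0) * d / c :=
    ⟨_, ENNReal.coe_toNNReal hMt⟩
  have hcd : c * k = (1 + δ⁻¹ : ℝ≥0) * d := by rw [hk, ENNReal.mul_div_cancel hc0 hct]
  refine ⟨k, fun γ φ hφ hφc => ?_⟩
  have hφ1 : ContDiff ℝ 1 φ := hφ.of_le (by exact_mod_cast le_top)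
  have hφm : Measurable φ := hφ.continuous.measurable
  have hdφ : Continuous (fderiv ℝ φ) := hφ1.continuous_fderiv one_ne_zero
  set S := ∫⁻ x, ‖φ x‖ₑ ^ 2 ∂surfaceMeasure U with hS
  set N := ∫⁻ x in U, ‖φ x‖ₑ ^ 2 with hN
  set D := ∫⁻ x in U, ‖fderiv ℝ φ x‖ₑ ^ 2 with hD
  -- Fubini for a product of a translate and a fixed function
  have swap : ∀ {F G : 𝔼 → ℝ≥0∞} {μ : Measure 𝔼} [SFinite μ] {k : ℝ≥0∞}, Measurable F →
      Measurable G → (∀ x, ∫⁻ z, F (x - z) = k) →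
      ∫⁻ z, ∫⁻ x, F (x - z) * G x ∂μ = k * ∫⁻ x, G x ∂μ := by
    intro F G μ _ k hF hG hk
    rw [lintegral_lintegral_swap (by fun_prop), ← lintegral_const_mul _ hG]
    refine lintegral_congr fun x => ?_
    rw [lintegral_mul_const _ (by fun_prop), hk]
  have hηm : Measurable fun x => ‖η x‖ₑ ^ 2 := hηme.enorm.pow_const 2
  have hdηm : Measurable fun x => ‖fderiv ℝ η x‖ₑ ^ 2 := by fun_prop
  have hφm2 : Measurable fun x => ‖φ x‖ₑ ^ 2 := by fun_prop
  have hdφm2 : Measurable fun x => ‖fderiv ℝ φ x‖ₑ ^ 2 := by fun_prop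
  have hpt : ∀ z, γ * ∫⁻ x, ‖η (x - z)‖ₑ ^ 2 * ‖φ x‖ₑ ^ 2 ∂surfaceMeasure U ≤
      θ * ((1 + δ : ℝ≥0) * (∫⁻ x in U, ‖η (x - z)‖ₑ ^ 2 * ‖fderiv ℝ φ x‖ₑ ^ 2) +
        (1 + δ⁻¹ : ℝ≥0) * (∫⁻ x in U, ‖fderiv ℝ η (x - z)‖ₑ ^ 2 * ‖φ x‖ₑ ^ 2) +
        γ ^ 2 * C * ∫⁻ x in U, ‖η (x - z)‖ₑ ^ 2 * ‖φ x‖ₑ ^ 2) := by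
    intro z
    have hs : ContDiff ℝ ∞ fun x => η (x - z) := hη.comp (by fun_prop)
    have hs1 : ContDiff ℝ 1 fun x => η (x - z) := hη1.comp (by fun_prop)
    have hsupp : tsupport (fun x => η (x - z)) ⊆ Metric.ball z ρ := by
      have : tsupport (fun x => η (x - z)) ⊆ Metric.closedBall z (ρ / 2) := by
        refine closure_minimal (fun x hx => ?_) Metric.isClosed_closedBall
        by_contra hh
        rw [Metric.mem_closedBall, dist_eq_norm, not_le] at hh
        exact hx (η.zero_of_le_dist (by rw [dist_zero_right]; exact hh.le))
      exact this.trans (Metric.closedBall_subset_ball (by linarith))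
    have h1 := h z γ _ (hs.mul hφ) hφc.mul_left ((tsupport_mul_subset_left).trans hsupp)
    simp_rw [enorm_mul, mul_pow] at h1
    refine h1.trans ?_
    gcongr
    have hm1 : Measurable fun x => ‖η (x - z)‖ₑ ^ 2 * ‖fderiv ℝ φ x‖ₑ ^ 2 :=
      (hηm.comp (measurable_sub_const z)).mul hdφm2
    have hm2 : Measurable fun x => ‖fderiv ℝ η (x - z)‖ₑ ^ 2 * ‖φ x‖ₑ ^ 2 :=
      (hdηm.comp (measurable_sub_const z)).mul hφm2
    rw [← lintegral_const_mul _ hm1, ← lintegral_const_mul _ hm2,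
      ← lintegral_add_left (hm1.const_mul _)]
    refine lintegral_mono fun x => ?_
    have h2 := enorm_fderiv_mul_le hs1 hφ1 x
    rw [fderiv_comp_sub] at h2
    calc _ ≤ (‖η (x - z)‖ₑ * ‖fderiv ℝ φ x‖ₑ + ‖φ x‖ₑ * ‖fderiv ℝ η (x - z)‖ₑ) ^ 2 := by
          gcongr
      _ ≤ _ := sq_add_le_mul_sq_add hδ (ENNReal.mul_ne_top enorm_ne_top enorm_ne_top)
          (ENNReal.mul_ne_top enorm_ne_top enorm_ne_top)
      _ = _ := by ring
  -- Integrating over all centres z replaces a partition of unity, since the integrals of the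
  -- squared translates of η and ∇η over z do not depend on x.
  have hint := lintegral_mono (μ := volume) hpt
  have hme : ∀ {F G : 𝔼 → ℝ≥0∞}, Measurable F → Measurable G →
      Measurable fun z => ∫⁻ x in U, F (x - z) * G x := by
    intro F G hF hG
    exact Measurable.lintegral_prod_right' (f := fun p : 𝔼 × 𝔼 => F (p.2 - p.1) * G p.2)
      (by fun_prop)
  rw [lintegral_const_mul' _ _ ENNReal.coe_ne_top, swap hηm hφm2 hcη,
    lintegral_const_mul' _ _ ENNReal.coe_ne_top,
    lintegral_add_right _ ((hme hηm hφm2).const_mul _),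
    lintegral_add_right _ ((hme hdηm hφm2).const_mul _),
    lintegral_const_mul' _ _ ENNReal.coe_ne_top, lintegral_const_mul' _ _ ENNReal.coe_ne_top,
    lintegral_const_mul' _ _ (by finiteness), swap hηm hφm2 hcη, swap hηm hdφm2 hcη,
    swap hdηm hφm2 hdη'] at hint
  rw [← ENNReal.mul_le_mul_iff_right hc0 hct]
  push_cast
  have h1δ : (1 : ℝ≥0∞) ≤ 1 + δ := le_self_add
  calc c * (γ * S) = γ * (c * S) := by ring
    _ ≤ _ := hint
    _ = θ * ((1 + δ) * (c * D) + c * k * N +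
          γ ^ 2 * C * (c * N)) := by rw [hcd]; push_cast; ring
    _ ≤ θ * ((1 + δ) * (c * D) + (1 + δ) * (c * k * N) +
          (1 + δ) * (γ ^ 2 * C * (c * N))) := by
        have hle : ∀ a : ℝ≥0∞, a ≤ (1 + δ) * a := fun a => le_mul_of_one_le_left zero_le h1δ
        exact mul_le_mul_right (add_le_add (add_le_add le_rfl (hle _)) (hle _)) _
    _ = _ := by ring

/-- The form bounds for the model cones at all boundary points imply one for the domain. -/
theorem exists_formBound_domain (hm : 1 ≤ m) {Ω : Set 𝔼} {K : 𝔼 → Set 𝔼} (hΩ : IsOpen Ω)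
    (hb : Bornology.IsBounded Ω) [SFinite (surfaceMeasure Ω)]
    (hK : ∀ y ∈ frontier Ω, IsModelCone Ω y (K y)) {C : ℝ≥0}
    (hC : ∀ y ∈ frontier Ω, FormBound (K y) 1 C) {ε : ℝ≥0} (hε : 0 < ε) :
    ∃ M : ℝ≥0, ∀ γ : ℝ≥0, FormBound Ω γ (M + γ ^ 2 * (C + ε)) := by
  have hΓ : IsCompact (frontier Ω) :=
    Metric.isCompact_of_isClosed_isBounded isClosed_frontier
      (hb.closure.subset frontier_subset_closure)
  have hlt : (C : ℝ≥0∞) < (C + ε : ℝ≥0) := by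
    exact_mod_cast lt_add_of_pos_right C hε
  -- The local loss L^(2m+1) and the gluing factor 1 + δ = L combine to τ = L^(2m+2). Using the
  -- glued bound at τγ cancels τ and turns C into τ² C, hence the doubled exponent.
  obtain ⟨L, hL, hLC⟩ := exists_one_lt_pow_mul_lt hlt ((2 * m + 1 + 1) * 2)
  obtain ⟨ρ, hρ, hloc⟩ := exists_uniform_localFormBound hΓ fun y hy =>
    (hK y hy).exists_localFormBound hm hΩ (hC y hy) hL
  obtain ⟨M, hM⟩ := exists_formBound_of_local (half_pos hρ) (localFormBound_of_frontier hloc)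
    (δ := L - 1) (tsub_pos_of_lt hL).ne'
  refine ⟨M, fun γ φ hφ hφc => ?_⟩
  rw [add_tsub_cancel_of_le hL.le, ← pow_succ] at hM
  set τ := L ^ (2 * m + 1 + 1) with hτ
  have hτ0 : (τ : ℝ≥0∞) ≠ 0 := by
    have : τ ≠ 0 := pow_ne_zero _ (zero_lt_one.trans hL).ne'
    exact_mod_cast this
  have h1 := hM (τ * γ) φ hφ hφc
  rw [ENNReal.coe_mul, mul_assoc,
    ENNReal.mul_le_mul_iff_right hτ0 ENNReal.coe_ne_top] at h1
  refine h1.trans ?_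
  have h2 : τ ^ 2 * C ≤ C + ε := by
    rw [hτ, ← pow_mul]
    exact_mod_cast hLC.le
  have h3 : (τ * γ) ^ 2 * C ≤ γ ^ 2 * (C + ε) :=
    calc (τ * γ) ^ 2 * C = γ ^ 2 * (τ ^ 2 * C) := by ring
      _ ≤ _ := by gcongr
  exact add_le_add_right (mul_le_mul_left
    (ENNReal.coe_le_coe.2 (add_le_add_right h3 M)) _) _

theorem two_mul_enorm_le {a b : ℝ≥0∞} (ha : a ≠ ⊤) (hb : b ≠ ⊤) : 2 * a * b ≤ a ^ 2 + b ^ 2 := by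
  lift a to ℝ≥0 using ha
  lift b to ℝ≥0 using hb
  exact_mod_cast two_mul_le_add_sq a b

/-- Apply the W^{1,1} inequality to φ² and split 2γB |φ| |∇φ| ≤ |∇φ|² + γ²B² φ². -/
theorem HasTraceInequality.exists_formBound {U : Set 𝔼} (h : HasTraceInequality U) :
    ∃ B : ℝ≥0, ∀ γ : ℝ≥0, FormBound U γ (γ ^ 2 * B ^ 2 + γ * B) := by
  obtain ⟨B, hB⟩ := h
  refine ⟨B, fun γ φ hφ hφc => ?_⟩
  have hφ1 : ContDiff ℝ 1 φ := hφ.of_le (by exact_mod_cast le_top)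
  have hφm : Measurable φ := hφ.continuous.measurable
  have hdφ : Continuous (fderiv ℝ φ) := hφ1.continuous_fderiv one_ne_zero
  have h1 := hB _ (hφ1.mul hφ1) hφc.mul_left
  calc (γ : ℝ≥0∞) * ∫⁻ x, ‖φ x‖ₑ ^ 2 ∂surfaceMeasure U
      = γ * ∫⁻ x, ‖φ x * φ x‖ₑ ∂surfaceMeasure U := by simp_rw [enorm_mul, pow_two]
    _ ≤ γ * (B * ∫⁻ x in U, (‖fderiv ℝ (fun x => φ x * φ x) x‖ₑ + ‖φ x * φ x‖ₑ)) := by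
        gcongr
    _ = ∫⁻ x in U, γ * B * (‖fderiv ℝ (fun x => φ x * φ x) x‖ₑ + ‖φ x * φ x‖ₑ) := by
        rw [lintegral_const_mul' _ _ (by finiteness), mul_assoc]
    _ ≤ ∫⁻ x in U, (‖fderiv ℝ φ x‖ₑ ^ 2 + (γ ^ 2 * B ^ 2 + γ * B : ℝ≥0) * ‖φ x‖ₑ ^ 2) := by
        refine lintegral_mono fun x => ?_
        calc _ ≤ (γ : ℝ≥0∞) * B * ((‖φ x‖ₑ * ‖fderiv ℝ φ x‖ₑ + ‖φ x‖ₑ * ‖fderiv ℝ φ x‖ₑ) +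
              ‖φ x * φ x‖ₑ) := by
              gcongr
              exact enorm_fderiv_mul_le hφ1 hφ1 x
          _ = 2 * ‖fderiv ℝ φ x‖ₑ * (γ * B * ‖φ x‖ₑ) + γ * B * ‖φ x‖ₑ ^ 2 := by
              rw [enorm_mul]
              ring
          _ ≤ ‖fderiv ℝ φ x‖ₑ ^ 2 + (γ * B * ‖φ x‖ₑ) ^ 2 + γ * B * ‖φ x‖ₑ ^ 2 := by
              gcongr
              exact two_mul_enorm_le enorm_ne_top (by finiteness)
          _ = _ := by
              push_cast
              ring
    _ = _ := by
        rw [lintegral_add_left (by fun_prop), lintegral_const_mul' _ _ ENNReal.coe_ne_top]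

theorem nonempty_frontier (hm : 1 ≤ m) {Ω : Set 𝔼} (hb : Bornology.IsBounded Ω)
    (hne : Ω.Nonempty) : (frontier Ω).Nonempty := by
  have : Nontrivial 𝔼 := Module.nontrivial_of_finrank_pos (R := ℝ) (by rw [finrank_euclideanSpace_fin]; omega)
  rw [nonempty_frontier_iff]
  refine ⟨hne, ?_⟩
  rintro rfl
  have := NormedSpace.noncompactSpace ℝ 𝔼
  exact noncompact_univ 𝔼 (Metric.isCompact_of_isClosed_isBounded isClosed_univ hb)

theorem eventually_le_mul_sq (a : ℝ) {b : ℝ} (hb : 0 < b) :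
    ∀ᶠ γ : ℝ≥0 in atTop, a ≤ b * (γ : ℝ) ^ 2 := by
  have h1 : Tendsto (fun γ : ℝ≥0 => (γ : ℝ)) atTop atTop := NNReal.tendsto_coe_atTop.2 tendsto_id
  exact (((tendsto_pow_atTop two_ne_zero).comp h1).const_mul_atTop hb).eventually_ge_atTop a

/-! ### Finiteness and the two asymptotic bounds -/

section Main

variable {Ω : Set 𝔼} {K : 𝔼 → Set 𝔼}

/-- A value C_y > B² + B would, by transplantation, push the bottom on Ω below -γ²(B² + B) for large
γ, against the bound -(γ²B² + γB) once γ ≥ 1. Thus the trace constant of Ω alone controls every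
cone. -/
theorem exists_coneConst_le (hm : 1 ≤ m) (hΩ : IsOpen Ω) (hb : Bornology.IsBounded Ω)
    (hK : ∀ y ∈ frontier Ω, IsModelCone Ω y (K y)) :
    ∃ B : ℝ≥0, ∀ y ∈ frontier Ω, coneConst (K y) ≤ ((B : ℝ) : EReal) := by
  have htr := hasTraceInequality_domain hm hΩ hb hK
  have := htr.isFiniteMeasureOnCompacts
  obtain ⟨B, hB⟩ := htr.exists_formBound
  refine ⟨B ^ 2 + B, fun y hy => not_lt.1 fun hlt => ?_⟩
  obtain ⟨γ, hγ, hγ1⟩ := (((hK y hy).eventually_bottom_lt hm hΩ hlt).and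
    (eventually_ge_atTop 1)).exists
  have h1 := (hB γ).le_bottom.trans_lt hγ
  rw [EReal.coe_lt_coe_iff, neg_lt_neg_iff, NNReal.coe_lt_coe, mul_add] at h1
  refine absurd h1 (not_lt.2 ?_)
  gcongr
  exact le_self_pow₀ hγ1 two_ne_zero

theorem exists_iSup_coneConst_eq (hm : 1 ≤ m) (hΩ : IsOpen Ω) (hb : Bornology.IsBounded Ω)
    (hne : Ω.Nonempty) (hK : ∀ y ∈ frontier Ω, IsModelCone Ω y (K y)) :
    ∃ C : ℝ≥0, ⨆ y ∈ frontier Ω, coneConst (K y) = ((C : ℝ) : EReal) := by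
  obtain ⟨B, hB⟩ := exists_coneConst_le hm hΩ hb hK
  obtain ⟨y, hy⟩ := nonempty_frontier hm hb hne
  set s := ⨆ y ∈ frontier Ω, coneConst (K y)
  have h1 : s ≤ ((B : ℝ) : EReal) := iSup₂_le hB
  have h0 : 0 ≤ s := by
    refine le_trans ?_ (le_iSup₂ (f := fun y _ => coneConst (K y)) y hy)
    have := (hK y hy).1.bottom_nonpos ((hK y hy).isOpen hΩ) ((hK y hy).nonempty hy) 1
    rw [coneConst]
    simpa using EReal.neg_le_neg_iff.2 this
  refine ⟨s.toReal.toNNReal, ?_⟩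
  rw [Real.coe_toNNReal _ (EReal.toReal_nonneg h0), EReal.coe_toReal]
  · exact ne_top_of_le_ne_top (EReal.coe_ne_top _) h1
  · exact ne_bot_of_le_ne_bot EReal.zero_ne_bot h0

theorem exists_bottom_eq_coe (hm : 1 ≤ m) (hΩ : IsOpen Ω) (hb : Bornology.IsBounded Ω)
    (hne : Ω.Nonempty) (hK : ∀ y ∈ frontier Ω, IsModelCone Ω y (K y)) (γ : ℝ≥0) :
    bottom Ω γ = ((bottom Ω γ).toReal : EReal) := by
  obtain ⟨B, hB⟩ := (hasTraceInequality_domain hm hΩ hb hK).exists_formBound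
  obtain ⟨φ, q, hφ, hφc, hφs, hφ0, hq⟩ := exists_interior_test hΩ hne
  refine (EReal.coe_toReal ?_ ?_).symm
  · exact ne_top_of_le_ne_top (EReal.coe_ne_top _)
      (bottom_le_of_tsupport_subset hΩ hφ hφc hφs hq hφ0 γ)
  · exact ne_bot_of_le_ne_bot (EReal.coe_ne_bot _) (hB γ).le_bottom

theorem eventually_bottom_le (hm : 1 ≤ m) (hΩ : IsOpen Ω) (hb : Bornology.IsBounded Ω)
    (hne : Ω.Nonempty) (hK : ∀ y ∈ frontier Ω, IsModelCone Ω y (K y)) {C : ℝ≥0}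
    (hC : ⨆ y ∈ frontier Ω, coneConst (K y) = ((C : ℝ) : EReal)) {ε : ℝ≥0} (hε : 0 < ε) :
    ∀ᶠ γ : ℝ≥0 in atTop, bottom Ω γ ≤ ((-(γ : ℝ) ^ 2 * C + ε * (γ : ℝ) ^ 2 : ℝ) : EReal) := by
  have := (hasTraceInequality_domain hm hΩ hb hK).isFiniteMeasureOnCompacts
  -- When C = 0 no boundary point need have C_y above the truncated difference C - ε = 0; a fixed
  -- interior test function gives a bound independent of γ instead.
  rcases eq_zero_or_pos C with rfl | hC0
  · obtain ⟨φ, q, hφ, hφc, hφs, hφ0, hq⟩ := exists_interior_test hΩ hne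
    filter_upwards [eventually_le_mul_sq q (b := ε) (by exact_mod_cast hε)] with γ hγ
    refine (bottom_le_of_tsupport_subset hΩ hφ hφc hφs hq hφ0 γ).trans ?_
    rw [EReal.coe_le_coe_iff]
    simpa using hγ
  · have hlt : (((C - ε : ℝ≥0) : ℝ) : EReal) < ⨆ y ∈ frontier Ω, coneConst (K y) := by
      rw [hC, EReal.coe_lt_coe_iff, NNReal.coe_lt_coe]
      exact tsub_lt_self hC0 hε
    simp only [lt_iSup_iff] at hlt
    obtain ⟨y, hy, hlt⟩ := hlt
    filter_upwards [(hK y hy).eventually_bottom_lt hm hΩ hlt] with γ hγ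
    refine hγ.le.trans ?_
    rw [EReal.coe_le_coe_iff]
    have h1 : (C : ℝ) ≤ (C - ε : ℝ≥0) + ε := by exact_mod_cast le_tsub_add
    push_cast
    nlinarith [sq_nonneg (γ : ℝ)]

theorem eventually_le_bottom (hm : 1 ≤ m) (hΩ : IsOpen Ω) (hb : Bornology.IsBounded Ω)
    (hK : ∀ y ∈ frontier Ω, IsModelCone Ω y (K y)) {C : ℝ≥0}
    (hC : ⨆ y ∈ frontier Ω, coneConst (K y) = ((C : ℝ) : EReal)) {ε : ℝ≥0} (hε : 0 < ε) :
    ∀ᶠ γ : ℝ≥0 in atTop, ((-(γ : ℝ) ^ 2 * C - ε * (γ : ℝ) ^ 2 : ℝ) : EReal) ≤ bottom Ω γ := by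
  have := (hasTraceInequality_domain hm hΩ hb hK).isFiniteMeasureOnCompacts
  have hε2 : 0 < ε / 2 := half_pos hε
  have hform : ∀ y ∈ frontier Ω, FormBound (K y) 1 C := fun y hy => by
    have := (hasTraceInequality_modelCone hm hΩ hK hy).isFiniteMeasureOnCompacts
    refine formBound_of_le_bottom ((hK y hy).isOpen hΩ) ?_
    have h1 : coneConst (K y) ≤ ((C : ℝ) : EReal) :=
      hC ▸ le_iSup₂ (f := fun y _ => coneConst (K y)) y hy
    rw [NNReal.coe_one, EReal.coe_neg]
    exact EReal.neg_le.1 h1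
  -- Half of ε is spent on the constant C; the other half, times γ², absorbs M for large γ.
  obtain ⟨M, hM⟩ := exists_formBound_domain hm hΩ hb hK hform hε2
  filter_upwards [eventually_le_mul_sq M (b := (ε / 2 : ℝ≥0)) (by exact_mod_cast hε2)] with γ hγ
  refine le_trans ?_ (hM γ).le_bottom
  rw [EReal.coe_le_coe_iff]
  push_cast at hγ ⊢
  nlinarith

end Main

end RobinCone

end

theorem mainTheorem1 (m : ℕ) (hm : 1 ≤ m) (Ω : Set (EuclideanSpace ℝ (Fin m)))
    (hΩ_open : IsOpen Ω) (hΩ_bdd : Bornology.IsBounded Ω) (hΩ_ne : Ω.Nonempty)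
    (hΩ_side : RobinCone.surfaceMeasure Ω (interior (closure Ω)) = 0)
    (K : EuclideanSpace ℝ (Fin m) → Set (EuclideanSpace ℝ (Fin m)))
    (hK : ∀ y ∈ frontier Ω, RobinCone.IsModelCone Ω y (K y))
    (hcone : RobinCone.UniformInteriorCone Ω K) :
    ∃ (Λ : ℝ → ℝ) (C : ℝ),
      (∀ γ > 0, RobinCone.bottom Ω γ = (Λ γ : EReal)) ∧
      (⨆ y ∈ frontier Ω, RobinCone.coneConst (K y)) = (C : EReal) ∧
      (fun γ => Λ γ - (- γ ^ 2 * C)) =o[atTop] (fun γ : ℝ => γ ^ 2) := by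
  obtain ⟨C, hC⟩ := RobinCone.exists_iSup_coneConst_eq hm hΩ_open hΩ_bdd hΩ_ne hK
  have hfin : ∀ γ : ℝ, 0 ≤ γ →
      RobinCone.bottom Ω γ = ((RobinCone.bottom Ω γ).toReal : EReal) := fun γ hγ => by
    lift γ to NNReal using hγ
    exact RobinCone.exists_bottom_eq_coe hm hΩ_open hΩ_bdd hΩ_ne hK γ
  refine ⟨fun γ => (RobinCone.bottom Ω γ).toReal, C, fun γ hγ => hfin γ hγ.le, hC, ?_⟩
  rw [Asymptotics.isLittleO_iff]
  intro ε hε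
  have hε' : 0 < ε.toNNReal := Real.toNNReal_pos.2 hε
  have hev := (RobinCone.eventually_bottom_le hm hΩ_open hΩ_bdd hΩ_ne hK hC hε').and
    (RobinCone.eventually_le_bottom hm hΩ_open hΩ_bdd hK hC hε')
  filter_upwards [Real.tendsto_toNNReal_atTop.eventually hev, eventually_ge_atTop 0] with γ hγ hγ0
  rw [Real.coe_toNNReal _ hγ0, Real.coe_toNNReal _ hε.le, hfin γ hγ0, EReal.coe_le_coe_iff,
    EReal.coe_le_coe_iff] at hγ
  rw [Real.norm_eq_abs, Real.norm_of_nonneg (sq_nonneg γ), abs_le]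
  constructor <;> linarith [hγ.1, hγ.2]
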